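/- Let $X$ be a locally compact Hausdorff space with countable base. A kernel $T$ on $X$ (with respect to the Borel sets) is a *boundary kernel* for an open set $U$ if $T(x,X\setminus\partial U)=0$ for $x\in U$ and $T(x,\cdot)=\varepsilon_x$ for $x\notin U$; write $Tf(x)=\int f\,dT(x,\cdot)$. Let $\mathcal V$ be a base of relatively compact open sets and, for $V\in\mathcal V$, let $H_V$ be a boundary kernel for $V$. For open $U$ let $\mathcal V(U)=\{W\in\mathcal V:\overline W\subset U\}$. A *local choice* $\mathcal W$ on $U$ assigns to every $x\in U$ a fundamental system $\mathcal W(x)\subset\mathcal V(U)$ of neighborhoods of $x$; a lower semicontinuous $u:U\to(-\infty,\infty]$ is *$\mathcal W$-hyperharmonic* if $H_Wu(x)\le u(x)$ for all $x\in U$, $W\in\mathcal W(x)$, and *hyperharmonic* if this holds with $\mathcal W(x)=\{W\in\mathcal V(U):x\in W\}$. A continuous $h:U\to\mathbb R$ is *harmonic* if $H_Vh=h$ on $V$ for all $V\in\mathcal V(U)$. The family $(H_V)_{V\in\mathcal V}$ is a *normal Bauer family of harmonic boundary kernels* if for every $V\in\mathcal V$: (1) $H_WH_V=H_V$ for $W\in\mathcal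 V$, $W\subset V$; (2) $H_V1=1$ and $H_Vf$ is continuous on $X$ for continuous $f:X\to\mathbb R$; (3) for some local choice $\mathcal W$ on $V$ the positive $\mathcal W$-hyperharmonic functions separate the points of $V$; (4) $H_Vf$ is continuous on $V$ for every bounded Borel function $f$. Let $(H_V)_{V\in\mathcal V}$ be such a family. An open set $U$ is a *$\mathcal P$-set* if the positive hyperharmonic functions on $U$ separate its points. A relatively compact open set $U$ is *regular* if every $f\in C(\partial U)$ has a unique continuous extension to $\overline U$ that is harmonic on $U$, and this extension is positive if $f\ge 0$; $H_U$ denotes the corresponding boundary kernel for $U$. A compact set $K\neq\emptyset$ is *strongly stable* if it is contained in a $\mathcal P$-set $W$ such that some strictly positive harmonic function on $W\setminus K$ tends to zero at $\partial K$. Fix a strongly stable compact $K$. (i) Let $W_0\supset K$ be any regular $\mathcal P$-set such that $W_0\setminus K$ is regular and $g:=H_{W_0\setminus K}1_{\partial W_0}>0$ on $W_0\setminus K$. For $0<r<1$ let $A_r=\{x\in W_0\setminus K: g(x)<r\}$, $S_r=\{x\in W_0\setminus K: g(x)=r\}$ (the sets $A_r$ are regular). Let $(\eta_n)$ be a sequence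 in $(0,1)$ strictly decreasing to $0$ and, for every $n$, let $\nu_n$ be a probability measure on $S_{\eta_n}$. Then there is a subsequence $(\nu_{n_k})$ such that, for every $0<r<1$, the measures $$\sigma_{r,k}:=\frac{r}{\eta_{n_k}}\,(\nu_{n_k}H_{A_r})|_{S_r}\qquad(\eta_{n_k}<r)$$ are probability measures on $S_r$ which converge weakly, as $k\to\infty$, to a probability measure $\sigma_r$ on $S_r$. The measures $\sigma_r$ are compatible, that is, $\sigma_rH_{A_t}=(r/t)\,\sigma_t$ on $S_t$ for all $0<r<t<1$. (ii) A darning of $K$ exists: the space $X_0$ obtained from $X$ by identifying $K$ with a single point is locally compact Hausdorff with countable base, and there is a normal Bauer family of harmonic boundary kernels on $X_0$ which contains all kernels $H_V$, $V\in\mathcal V$, $\overline V\cap K=\emptyset$ (transported to $X_0$). -/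

import Mathlib

open MeasureTheory ProbabilityTheory Set Filter Topology
open scoped ENNReal

noncomputable section

namespace Darning

section Families

variable {X : Type*} [TopologicalSpace X] [MeasurableSpace X]

/-- `T` is a boundary kernel for `U`: the measures `T(x,·)`, `x ∈ U`, do not charge the complement
of `∂U`, and `T(x,·)` is the Dirac measure at `x` for `x ∉ U`. -/
def IsBoundaryKernel (U : Set X) (T : Kernel X X) : Prop :=
  (∀ x ∈ U, T x (frontier U)ᶜ = 0) ∧ ∀ x ∉ U, T x = Measure.dirac x

/-- The integral `∫ u⁺ dμ - ∫ u⁻ dμ` of an extended real function. It is used only for functions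
which are lower semicontinuous and `> -∞` on a compact set carrying the finite measure `μ`, so that
the negative part has a finite integral. -/
def eintegral (μ : Measure X) (u : X → EReal) : EReal :=
  ((∫⁻ y, (u y).toENNReal ∂μ : ℝ≥0∞) : EReal) - ((∫⁻ y, (-u y).toENNReal ∂μ : ℝ≥0∞) : EReal)

/-- A local choice from `𝒱` in `U`: each `𝒲 x`, `x ∈ U`, is a fundamental system of neighborhoods
of `x` consisting of sets `W ∈ 𝒱` with closure in `U`. -/
def IsLocalChoice (𝒱 : Set (Set X)) (U : Set X) (𝒲 : X → Set (Set X)) : Prop :=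
  ∀ x ∈ U, (∀ W ∈ 𝒲 x, W ∈ 𝒱 ∧ closure W ⊆ U ∧ x ∈ W) ∧ ∀ N ∈ 𝓝 x, ∃ W ∈ 𝒲 x, W ⊆ N

/-- The choice of all `W ∈ 𝒱` which contain `x` and have closure in `U`. -/
def fullChoice (𝒱 : Set (Set X)) (U : Set X) (x : X) : Set (Set X) :=
  {W | W ∈ 𝒱 ∧ closure W ⊆ U ∧ x ∈ W}

/-- `u` is `𝒲`-hyperharmonic on `U`. Only the values of `u` on `U` matter. -/
def IsHyperharmonicOn (H : Set X → Kernel X X) (𝒲 : X → Set (Set X)) (u : X → EReal)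
    (U : Set X) : Prop :=
  LowerSemicontinuousOn u U ∧ (∀ x ∈ U, u x ≠ ⊥) ∧
    ∀ x ∈ U, ∀ W ∈ 𝒲 x, eintegral (H W x) u ≤ u x

/-- The positive `𝒲`-hyperharmonic functions on `U` separate the points of `U`. -/
def PosHyperharmonicSeparates (H : Set X → Kernel X X) (𝒲 : X → Set (Set X)) (U : Set X) : Prop :=
  ∀ x ∈ U, ∀ y ∈ U, x ≠ y →
    ∃ u : X → EReal, IsHyperharmonicOn H 𝒲 u U ∧ (∀ z ∈ U, 0 ≤ u z) ∧ u x ≠ u y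

/-- `h` is harmonic on `U`. Only the values of `h` on `U` matter. -/
def IsHarmonicOn (𝒱 : Set (Set X)) (H : Set X → Kernel X X) (h : X → ℝ) (U : Set X) : Prop :=
  ContinuousOn h U ∧ ∀ V ∈ 𝒱, closure V ⊆ U → ∀ x ∈ V, ∫ y, h y ∂(H V x) = h x

/-- `(H V)_{V ∈ 𝒱}` is a normal Bauer family of harmonic boundary kernels.
(Values `H V` for `V ∉ 𝒱` are irrelevant.) -/
structure IsNormalBauerFamily (𝒱 : Set (Set X)) (H : Set X → Kernel X X) : Prop where
  isTopologicalBasis : TopologicalSpace.IsTopologicalBasis 𝒱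
  isCompact_closure : ∀ V ∈ 𝒱, IsCompact (closure V)
  isBoundaryKernel : ∀ V ∈ 𝒱, IsBoundaryKernel V (H V)
  /-- `H_W H_V = H_V` for `W ⊆ V`; the composition `H V ∘ₖ H W` is `x ↦ ∫ H_V(y,·) H_W(x,dy)`. -/
  comp_eq : ∀ V ∈ 𝒱, ∀ W ∈ 𝒱, W ⊆ V → H V ∘ₖ H W = H V
  continuous_integral : ∀ V ∈ 𝒱, ∀ f : X → ℝ, Continuous f →
    Continuous fun x => ∫ y, f y ∂(H V x)
  normal : ∀ V ∈ 𝒱, ∀ x, H V x univ = 1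
  separates : ∀ V ∈ 𝒱, ∃ 𝒲 : X → Set (Set X),
    IsLocalChoice 𝒱 V 𝒲 ∧ PosHyperharmonicSeparates H 𝒲 V
  continuousOn_integral : ∀ V ∈ 𝒱, ∀ f : X → ℝ, Measurable f → (∃ C : ℝ, ∀ x, |f x| ≤ C) →
    ContinuousOn (fun x => ∫ y, f y ∂(H V x)) V

variable (𝒱 : Set (Set X)) (H : Set X → Kernel X X)

/-- `U` is a `𝒫`-set: the positive hyperharmonic functions on the open set `U` separate points. -/
def IsPSet (U : Set X) : Prop :=
  IsOpen U ∧ PosHyperharmonicSeparates H (fullChoice 𝒱 U) U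

/-- `h` is continuous on `closure U`, harmonic on `U`, and equal to `f` on `∂U`. -/
def IsDirichletSolution (U : Set X) (f h : X → ℝ) : Prop :=
  ContinuousOn h (closure U) ∧ IsHarmonicOn 𝒱 H h U ∧ EqOn h f (frontier U)

/-- `U` is regular: `U` is open and relatively compact, and every continuous real function `f` on
`∂U` has a unique continuous extension to `closure U` which is harmonic on `U`; this extension is
positive if `f` is positive. -/
def IsRegular (U : Set X) : Prop :=
  IsOpen U ∧ IsCompact (closure U) ∧
    ∀ f : X → ℝ, ContinuousOn f (frontier U) →
      (∃ h, IsDirichletSolution 𝒱 H U f h) ∧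
      (∀ h₁ h₂, IsDirichletSolution 𝒱 H U f h₁ → IsDirichletSolution 𝒱 H U f h₂ →
        EqOn h₁ h₂ (closure U)) ∧
      ((∀ z ∈ frontier U, 0 ≤ f z) →
        ∀ h, IsDirichletSolution 𝒱 H U f h → ∀ x ∈ closure U, 0 ≤ h x)

/-- `T` is the boundary kernel for `U` which solves the Dirichlet problem on `U`. -/
def IsHarmonicKernel (U : Set X) (T : Kernel X X) : Prop :=
  IsBoundaryKernel U T ∧
    ∀ f : X → ℝ, Continuous f → IsDirichletSolution 𝒱 H U f fun x => ∫ y, f y ∂(T x)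

open Classical in
/-- The harmonic kernel `H_U` of a regular set `U` (with value `0` if there is no such kernel). -/
def harmonicKernel (U : Set X) : Kernel X X :=
  if h : ∃ T, IsHarmonicKernel 𝒱 H U T then h.choose else 0

/-- A compact `K ≠ ∅` is strongly stable if it is contained in a `𝒫`-set `W` such that there is a
strictly positive harmonic function on `W \ K` which tends to zero at `∂K`. -/
def IsStronglyStable (K : Set X) : Prop :=
  IsCompact K ∧ K.Nonempty ∧ ∃ W, IsPSet 𝒱 H W ∧ K ⊆ W ∧
    ∃ h : X → ℝ, IsHarmonicOn 𝒱 H h (W \ K) ∧ (∀ x ∈ W \ K, 0 < h x) ∧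
      ∀ z ∈ frontier K, Tendsto h (𝓝[W \ K] z) (𝓝 0)

/-- The function `g = H_{W₀ \ K} 1_{∂W₀}`. -/
def gFun (W₀ K : Set X) (x : X) : ℝ :=
  (harmonicKernel 𝒱 H (W₀ \ K) x).real (frontier W₀)

/-- `W₀` is a regular `𝒫`-set containing `K` such that `W₀ \ K` is regular
and `g = H_{W₀ \ K} 1_{∂W₀}` is strictly positive on `W₀ \ K`. -/
structure IsAdmissible (K W₀ : Set X) : Prop where
  isRegular : IsRegular 𝒱 H W₀
  isPSet : IsPSet 𝒱 H W₀
  subset : K ⊆ W₀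
  isRegular_diff : IsRegular 𝒱 H (W₀ \ K)
  gFun_pos : ∀ x ∈ W₀ \ K, 0 < gFun 𝒱 H W₀ K x

/-- `A_r = {x ∈ W₀ \ K : g(x) < r}`. -/
def A (W₀ K : Set X) (r : ℝ) : Set X := {x ∈ W₀ \ K | gFun 𝒱 H W₀ K x < r}

/-- `S_r = {x ∈ W₀ \ K : g(x) = r}`. -/
def S (W₀ K : Set X) (r : ℝ) : Set X := {x ∈ W₀ \ K | gFun 𝒱 H W₀ K x = r}

/-- The swept measure `ν H_{A_r} = ∫ H_{A_r}(y,·) ν(dy)`. -/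
def swept (W₀ K : Set X) (ν : Measure X) (r : ℝ) : Measure X :=
  ν.bind (harmonicKernel 𝒱 H (A 𝒱 H W₀ K r))

/-- Compatibility: `σ_r H_{A_t} = (r/t) σ_t` on `S_t` for all `0 < r < t < 1`. -/
def IsCompatible (W₀ K : Set X) (σ : ℝ → Measure X) : Prop :=
  ∀ r t : ℝ, 0 < r → r < t → t < 1 →
    (swept 𝒱 H W₀ K (σ r) t).restrict (S 𝒱 H W₀ K t) =
      ENNReal.ofReal (r / t) • (σ t).restrict (S 𝒱 H W₀ K t)

end Families

section Collapse

variable {X : Type*} [TopologicalSpace X]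

/-- The equivalence relation identifying all points of `K`. -/
def collapseSetoid (K : Set X) : Setoid X where
  r x y := x = y ∨ (x ∈ K ∧ y ∈ K)
  iseqv := by
    refine ⟨fun x => Or.inl rfl, ?_, ?_⟩
    · rintro x y (h | h)
      · exact Or.inl h.symm
      · exact Or.inr ⟨h.2, h.1⟩
    · rintro x y z (rfl | h) (rfl | h')
      · exact Or.inl rfl
      · exact Or.inr h'
      · exact Or.inr h
      · exact Or.inr ⟨h.1, h'.2⟩

/-- The space `X₀` obtained from `X` by identifying `K` with a single point, with the quotient
topology: for closed `K ≠ ∅`, the open sets of `X₀` avoiding that point are the open subsets of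
`X \ K`, and its neighborhoods are given by the neighborhoods of `K` in `X`. -/
def Collapse (K : Set X) : Type _ := Quotient (collapseSetoid K)

instance (K : Set X) : TopologicalSpace (Collapse K) :=
  inferInstanceAs (TopologicalSpace (Quotient (collapseSetoid K)))

/-- `X₀` carries its Borel `σ`-algebra. -/
instance (K : Set X) : MeasurableSpace (Collapse K) := borel _

instance (K : Set X) : BorelSpace (Collapse K) := ⟨rfl⟩

/-- The canonical projection `X → X₀`. -/
def proj (K : Set X) (x : X) : Collapse K := Quotient.mk (collapseSetoid K) x

variable [MeasurableSpace X]

/-- `(H₀ V)_{V ∈ 𝒱₀}` is obtained by darning of `K`: it is a normal Bauer family of harmonic boundary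
kernels on the (locally compact Hausdorff, second countable) space `X₀` which contains the kernels
`H V`, `V ∈ 𝒱`, `closure V ∩ K = ∅`, transported to `X₀`. -/
structure IsDarning (𝒱 : Set (Set X)) (H : Set X → Kernel X X) (K : Set X)
    (𝒱₀ : Set (Set (Collapse K))) (H₀ : Set (Collapse K) → Kernel (Collapse K) (Collapse K)) :
    Prop where
  t2Space : T2Space (Collapse K)
  locallyCompactSpace : LocallyCompactSpace (Collapse K)
  secondCountableTopology : SecondCountableTopology (Collapse K)
  isNormalBauerFamily : IsNormalBauerFamily 𝒱₀ H₀
  image_mem : ∀ V ∈ 𝒱, Disjoint (closure V) K → proj K '' V ∈ 𝒱₀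
  kernel_eq : ∀ V ∈ 𝒱, Disjoint (closure V) K →
    ∀ x, H₀ (proj K '' V) (proj K x) = (H V x).map (proj K)

end Collapse

end Darning

end

noncomputable section

set_option linter.unusedSectionVars false

namespace Darning

section

/-! ### Absorbing sets and the minimum principle on `𝒫`-sets -/

section Basic

variable {X : Type*} [TopologicalSpace X] [T2Space X] [LocallyCompactSpace X]
  [SecondCountableTopology X] [MeasurableSpace X] [BorelSpace X]
  {𝒱 : Set (Set X)} {H : Set X → Kernel X X}

/-! Everything is driven by a function `g` near `K` which vanishes on `K`, is harmonic and strictly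
positive off `K`, and has compact sublevel sets (`IsAnnular`). The annulus `A_r = {0 < g < r}` has
the barriers `g` and `r - g`, hence is regular, and since `g / r` is `0` on `K` and `1` on `S_r`,
uniqueness in the Dirichlet problem gives `H_{A_r}(x, S_r) = g(x) / r` (`IsAnnular.measure_level`).
So sweeping a probability measure from `S_s` to `S_t` and multiplying by `t / s` gives a probability
measure again. Mass that reaches `K` stays there, so these normalized sweepings compose
(`IsAnnular.sweep_sweep`).

For (i), the product over `m` of the spaces of probability measures on the compact sets `S_{η m}` is
compact, so some subsequence converges on all these levels simultaneously. Harmonic kernels map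
bounded Borel functions to functions continuous on the annulus, so sweeping between levels is weakly
continuous (`IsAnnular.tendsto_sweep`). This carries the convergence to every level and makes the
limits compatible.

For (ii), compatible measures `σ_r` serve as an entrance law from the collapsed point. The kernel
`T_r` for `{g < r}` runs a point to the boundary of `A_r` and replaces arrival in `K` by `σ_r`.
Consistency of these kernels reduces to `σ_s T_r = σ_r` for `s < r` (`IsAnnular.bind_ballKernel`):
the fraction `s / r` of the mass reaches `S_r` directly, distributed like `σ_r`, and the rest falls
into `K` and is redistributed as `σ_r`. If `|f| ≤ C`, then near `K` the function `T_r f` differs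
from `∫ f dσ_r` by at most `2 C g / r`, so it is continuous even for Borel `f`. Points are separated
by functions `min (v + N (r - g)) d`, which attain their maximum `d` on all of `K` and so satisfy
the mean value inequality there trivially.

The underlying potential theory comes from one fact: a `𝒫`-set contains no nonempty compact
absorbing set. It yields the minimum principle and the passage from local to global
superharmonicity. Perron's method with barriers then solves Dirichlet problems (`IsPSet.isRegular`),
and the Riesz representation theorem turns the solutions into harmonic kernels. -/

lemma IsNormalBauerFamily.isOpen (hH : IsNormalBauerFamily 𝒱 H) {V : Set X} (hV : V ∈ 𝒱) :
    IsOpen V :=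
  hH.isTopologicalBasis.isOpen hV

lemma IsNormalBauerFamily.isProbabilityMeasure (hH : IsNormalBauerFamily 𝒱 H) {V : Set X}
    (hV : V ∈ 𝒱) (x : X) : IsProbabilityMeasure (H V x) :=
  ⟨hH.normal V hV x⟩

lemma IsNormalBauerFamily.isMarkovKernel (hH : IsNormalBauerFamily 𝒱 H) {V : Set X}
    (hV : V ∈ 𝒱) : IsMarkovKernel (H V) :=
  ⟨hH.isProbabilityMeasure hV⟩

lemma IsNormalBauerFamily.ae_mem_frontier (hH : IsNormalBauerFamily 𝒱 H) {V : Set X}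
    (hV : V ∈ 𝒱) {x : X} (hx : x ∈ V) : ∀ᵐ y ∂(H V x), y ∈ frontier V :=
  (hH.isBoundaryKernel V hV).1 x hx

lemma IsNormalBauerFamily.eq_dirac (hH : IsNormalBauerFamily 𝒱 H) {V : Set X}
    (hV : V ∈ 𝒱) {x : X} (hx : x ∉ V) : H V x = Measure.dirac x :=
  (hH.isBoundaryKernel V hV).2 x hx

lemma IsNormalBauerFamily.exists_closure_subset (hH : IsNormalBauerFamily 𝒱 H) {x : X} {N : Set X}
    (hN : N ∈ 𝓝 x) : ∃ V ∈ 𝒱, x ∈ V ∧ closure V ⊆ N := by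
  obtain ⟨C, hC, hCc, hCN⟩ := exists_mem_nhds_isClosed_subset hN
  obtain ⟨V, hV, hxV, hVC⟩ := hH.isTopologicalBasis.mem_nhds_iff.1 hC
  exact ⟨V, hV, hxV, (closure_minimal hVC hCc).trans hCN⟩

/-- Hyperharmonic functions are controlled only on their own open set, while integration wants
measurability on all of `X`. Positivity keeps the zero extension lower semicontinuous at boundary
points. -/
lemma lowerSemicontinuous_piecewise_zero {u : X → EReal} {P : Set X}
    [∀ x, Decidable (x ∈ P)] (hP : IsOpen P)
    (hu : LowerSemicontinuousOn u P) (hpos : ∀ x ∈ P, 0 ≤ u x) :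
    LowerSemicontinuous (P.piecewise u fun _ => 0) := by
  intro x t ht
  by_cases hx : x ∈ P
  · rw [piecewise_eq_of_mem _ _ _ hx] at ht
    have := hu x hx t ht
    rw [hP.nhdsWithin_eq hx] at this
    filter_upwards [this, hP.mem_nhds hx] with y hy hyP
    rwa [piecewise_eq_of_mem _ _ _ hyP]
  · rw [piecewise_eq_of_notMem _ _ _ hx] at ht
    filter_upwards with y
    by_cases hy : y ∈ P
    · rw [piecewise_eq_of_mem _ _ _ hy]; exact ht.trans_le (hpos y hy)
    · rwa [piecewise_eq_of_notMem _ _ _ hy]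

/-- If `∫ u dμ ≤ c ≤ u` almost everywhere for a probability measure `μ`, then `u = c` a.e. -/
lemma ae_le_of_eintegral_le {μ : Measure X} [IsProbabilityMeasure μ] {u : X → EReal} {P : Set X}
    (hP : IsOpen P) (hu : LowerSemicontinuousOn u P) (hpos : ∀ x ∈ P, 0 ≤ u x)
    (hμP : ∀ᵐ y ∂μ, y ∈ P) {c : EReal} (hc0 : 0 ≤ c) (hc : c ≠ ⊤) (hle : eintegral μ u ≤ c)
    (hcu : ∀ᵐ y ∂μ, c ≤ u y) : ∀ᵐ y ∂μ, u y ≤ c := by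
  classical
  set u' : X → EReal := P.piecewise u fun _ => 0 with hu'
  have hm : Measurable u' := (lowerSemicontinuous_piecewise_zero hP hu hpos).measurable
  have hmu : AEMeasurable (fun y => (u y).toENNReal) μ := by
    refine ⟨fun y => (u' y).toENNReal, measurable_ereal_toENNReal.comp hm, ?_⟩
    filter_upwards [hμP] with y hy
    simp [hu', piecewise_eq_of_mem _ _ _ hy]
  have hneg : ∫⁻ y, (-u y).toENNReal ∂μ = 0 := by
    rw [← lintegral_zero (μ := μ)]
    refine lintegral_congr_ae ?_
    filter_upwards [hμP] with y hy
    simp [EReal.toENNReal_of_nonpos, hpos y hy]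
  have hintg : ∫⁻ y, (u y).toENNReal ∂μ ≤ c.toENNReal := by
    rw [eintegral, hneg] at hle
    simp only [EReal.coe_ennreal_zero, sub_zero] at hle
    have := EReal.toENNReal_le_toENNReal hle
    simpa using this
  have hcfin : c.toENNReal ≠ ⊤ := by simpa using hc
  have h2 : ∀ᵐ y ∂μ, c.toENNReal ≤ (u y).toENNReal := by
    filter_upwards [hcu] with y hy using EReal.toENNReal_le_toENNReal hy
  have h3 : (fun _ => c.toENNReal) =ᵐ[μ] fun y => (u y).toENNReal := by
    refine ae_eq_of_ae_le_of_lintegral_le h2 ?_ hmu ?_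
    · simpa using hcfin
    · simpa using hintg
  filter_upwards [h3, hμP] with y hy hyP
  have h4 : ((c.toENNReal : ℝ≥0∞) : EReal) = ((u y).toENNReal : ℝ≥0∞) := by
    rw [show c.toENNReal = (u y).toENNReal from hy]
  rw [EReal.coe_toENNReal hc0, EReal.coe_toENNReal (hpos y hyP)] at h4
  exact h4.ge

/-- In a `𝒫`-set there is no nonempty compact set which is absorbing for a choice of kernels. -/
lemma IsPSet.exists_measure_compl_ne_zero (hH : IsNormalBauerFamily 𝒱 H) {P : Set X}
    (hP : IsPSet 𝒱 H P) {M : Set X} (hM : IsCompact M) (hne : M.Nonempty) (hMP : M ⊆ P)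
    (W : X → Set X) (hW : ∀ x ∈ M, W x ∈ 𝒱 ∧ x ∈ W x ∧ closure (W x) ⊆ P) :
    ∃ x ∈ M, H (W x) x Mᶜ ≠ 0 := by
  by_contra! hcon
  -- Nonempty compact sets which the chosen kernels do not leave. Separation forces a minimal one to
  -- be a single point, and a point cannot be absorbing: `H (W x) x` lives on the boundary of `W x`,
  -- which misses `x`.
  let 𝒮 : Set (Set X) := {L | IsCompact L ∧ L.Nonempty ∧ L ⊆ M ∧ ∀ x ∈ L, H (W x) x Lᶜ = 0}
  obtain ⟨L, -, hLmin⟩ : ∃ L, L ⊆ M ∧ Minimal (· ∈ 𝒮) L := by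
    refine zorn_superset_nonempty 𝒮 ?_ M ⟨hM, hne, Subset.rfl, hcon⟩
    intro c hc hchain hcne
    have := hcne.to_subtype
    refine ⟨⋂₀ c, ⟨?_, ?_, ?_, ?_⟩, fun s hs => sInter_subset_of_mem hs⟩
    · obtain ⟨s, hs⟩ := hcne
      exact (hc hs).1.of_isClosed_subset (isClosed_sInter fun t ht => (hc ht).1.isClosed)
        (sInter_subset_of_mem hs)
    · exact IsCompact.nonempty_sInter_of_directed_nonempty_isCompact_isClosed
        (show IsChain (· ⊇ ·) c from hchain.symm).directedOn
        (fun s hs => (hc hs).2.1) (fun s hs => (hc hs).1)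
        (fun s hs => (hc hs).1.isClosed)
    · obtain ⟨s, hs⟩ := hcne
      exact (sInter_subset_of_mem hs).trans (hc hs).2.2.1
    · intro x hx
      rw [compl_sInter]
      -- The chain may be uncountable, but by second countability countably many of the open
      -- complements already cover their union.
      obtain ⟨T, hTc, hTs, hTu⟩ := TopologicalSpace.isOpen_sUnion_countable (compl '' c) (by
        rintro _ ⟨s, hs, rfl⟩
        exact (hc hs).1.isClosed.isOpen_compl)
      rw [← hTu, measure_sUnion_null_iff hTc]
      intro t ht
      obtain ⟨s, hs, rfl⟩ := hTs ht
      exact (hc hs).2.2.2 x (hx s hs)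
  obtain ⟨hLc, ⟨x, hx⟩, hLM, hLabs⟩ := hLmin.prop
  by_cases hsing : ∃ y ∈ L, y ≠ x
  · obtain ⟨y, hy, hyx⟩ := hsing
    obtain ⟨u, ⟨hulsc, hubot, huint⟩, hupos, hune⟩ := hP.2 y (hMP (hLM hy)) x (hMP (hLM hx)) hyx
    have hLP : L ⊆ P := hLM.trans hMP
    obtain ⟨z, hzL, hz⟩ := (hulsc.mono hLP).exists_isMinOn ⟨x, hx⟩ hLc
    have hzmin : ∀ w ∈ L, u z ≤ u w := fun w hw => hz hw
    have hztop : u z ≠ ⊤ := by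
      intro h
      apply hune
      have h1 := hzmin y hy
      have h2 := hzmin x hx
      rw [h, top_le_iff] at h1 h2
      rw [h1, h2]
    -- The set where `u` attains its minimum on `L` is again absorbing, since a mean value not
    -- exceeding the minimum forces equality almost everywhere. Minimality of `L` then makes `u`
    -- constant on `L`.
    have hmem : {w ∈ L | u w ≤ u z} ∈ 𝒮 := by
      refine ⟨?_, ⟨z, hzL, le_rfl⟩, fun w hw => hLM hw.1, ?_⟩
      · exact (hulsc.mono hLP).isCompact_inter_preimage_Iic hLc (u z)
      · intro w hw
        obtain ⟨hW1, hW2, hW3⟩ := hW w (hLM hw.1)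
        have := hH.isProbabilityMeasure hW1 w
        have hLae : ∀ᵐ y ∂(H (W w) w), y ∈ L := hLabs w hw.1
        have := ae_le_of_eintegral_le (μ := H (W w) w) hP.1 hulsc hupos
          (hLae.mono fun y hy => hLP hy) (hupos z (hLP hzL)) hztop
          ((huint w (hLP hw.1) (W w) ⟨hW1, hW3, hW2⟩).trans hw.2)
          (hLae.mono fun y hy => hzmin y hy)
        have h5 : ∀ᵐ y ∂(H (W w) w), y ∈ {w ∈ L | u w ≤ u z} := by
          filter_upwards [this, hLae] with y h1 h2 using ⟨h2, h1⟩
        exact h5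
    have hsub := hLmin.le_of_le hmem (fun w hw => hw.1)
    apply hune
    exact le_antisymm ((hsub hy).2.trans (hzmin x hx)) ((hsub hx).2.trans (hzmin y hy))
  · push Not at hsing
    obtain ⟨hW1, hW2, hW3⟩ := hW x (hLM hx)
    have := hH.isProbabilityMeasure hW1 x
    have hLae : ∀ᵐ y ∂(H (W x) x), y ∈ L := hLabs x hx
    obtain ⟨y, hyL, hyf⟩ := (hLae.and (hH.ae_mem_frontier hW1 hW2)).exists
    rw [hsing y hyL] at hyf
    rw [(hH.isOpen hW1).frontier_eq] at hyf
    exact hyf.2 hW2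

/-- Boundary minimum principle. -/
lemma IsPSet.nonneg_of_frontier_nonneg (hH : IsNormalBauerFamily 𝒱 H) {P U : Set X}
    (hP : IsPSet 𝒱 H P) (hU : IsOpen U) (hUP : U ⊆ P) (hUc : IsCompact (closure U)) {v : X → ℝ}
    (hv : LowerSemicontinuousOn v (closure U)) (hfr : ∀ x ∈ frontier U, 0 ≤ v x)
    (hloc : ∀ x ∈ U, ∃ W ∈ 𝒱, x ∈ W ∧ closure W ⊆ U ∧ Integrable v (H W x) ∧
      ∫ y, v y ∂(H W x) ≤ v x) : ∀ x ∈ closure U, 0 ≤ v x := by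
  intro x hx
  by_contra! hneg
  obtain ⟨z, hz, hmin⟩ := hv.exists_isMinOn ⟨x, hx⟩ hUc
  have hzmin : ∀ w ∈ closure U, v z ≤ v w := fun w hw => hmin hw
  have hz0 : v z < 0 := (hzmin x hx).trans_lt hneg
  -- A negative minimum is attained on a compact set inside `U`, and the mean value inequality keeps
  -- the kernels in that set, so it would be absorbing.
  set M := {w ∈ closure U | v w ≤ v z} with hMdef
  have hMc : IsCompact M := hv.isCompact_inter_preimage_Iic hUc (v z)
  have hMU : M ⊆ U := by
    intro w hw
    by_contra hwU
    have := hfr w (by rw [hU.frontier_eq]; exact ⟨hw.1, hwU⟩)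
    linarith [hw.2]
  choose! W hW𝒱 hxW hWU hWint hWle using hloc
  obtain ⟨w, hwM, hw⟩ := hP.exists_measure_compl_ne_zero hH hMc ⟨z, hz, le_rfl⟩ (hMU.trans hUP) W
    fun w hw => ⟨hW𝒱 w (hMU hw), hxW w (hMU hw), (hWU w (hMU hw)).trans hUP⟩
  apply hw
  have hwU := hMU hwM
  have := hH.isProbabilityMeasure (hW𝒱 w hwU) w
  have hcl : ∀ᵐ y ∂(H (W w) w), y ∈ closure U := by
    filter_upwards [hH.ae_mem_frontier (hW𝒱 w hwU) (hxW w hwU)] with y hy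
    exact subset_closure (hWU w hwU (frontier_subset_closure hy))
  have hnn : 0 ≤ᵐ[H (W w) w] fun y => v y - v z := by
    filter_upwards [hcl] with y hy using sub_nonneg.2 (hzmin y hy)
  have hintg : Integrable (fun y => v y - v z) (H (W w) w) :=
    (hWint w hwU).sub (integrable_const _)
  have h0 : ∫ y, (v y - v z) ∂(H (W w) w) = 0 := by
    refine le_antisymm ?_ (integral_nonneg_of_ae hnn)
    rw [integral_sub (hWint w hwU) (integrable_const _)]
    simp only [integral_const, probReal_univ, one_smul]
    linarith [hWle w hwU, hwM.2]
  have h1 := (integral_eq_zero_iff_of_nonneg_ae hnn hintg).1 h0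
  have h2 : ∀ᵐ y ∂(H (W w) w), y ∈ M := by
    filter_upwards [h1, hcl] with y hy hyc
    refine ⟨hyc, ?_⟩
    simp only [Pi.zero_apply] at hy
    linarith
  exact h2

end Basic

end

section

/-! ### Lower semicontinuous functions: from local to global superharmonicity -/

section Semicontinuous

variable {X : Type*} [TopologicalSpace X] [T2Space X] [LocallyCompactSpace X]
  [SecondCountableTopology X] [MeasurableSpace X] [BorelSpace X]
  {𝒱 : Set (Set X)} {H : Set X → Kernel X X}

lemma integrable_of_measurable_of_abs_le {Y : Type*} [MeasurableSpace Y] {μ : Measure Y}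
    [IsFiniteMeasure μ] {f : Y → ℝ} (hf : Measurable f) {C : ℝ} (hC : ∀ x, |f x| ≤ C) :
    Integrable f μ :=
  Integrable.of_bound hf.aestronglyMeasurable C (ae_of_all _ hC)

lemma measurable_integral_kernel {Y Z : Type*} [MeasurableSpace Y] [MeasurableSpace Z]
    (κ : Kernel Y Z) [IsFiniteKernel κ] {f : Z → ℝ} (hf : Measurable f) :
    Measurable fun y => ∫ z, f z ∂(κ y) :=
  (hf.stronglyMeasurable.integral_kernel (κ := κ)).measurable

lemma abs_integral_le_of_abs_le {Y : Type*} [MeasurableSpace Y] {μ : Measure Y}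
    [IsProbabilityMeasure μ] {f : Y → ℝ} {C : ℝ} (hC : ∀ x, |f x| ≤ C) :
    |∫ x, f x ∂μ| ≤ C := by
  have := norm_integral_le_of_norm_le_const (μ := μ) (f := f) (C := C) (ae_of_all _ hC)
  simpa using this

lemma integral_comp_kernel_of_abs_le {Y₁ Y₂ Y₃ : Type*} [MeasurableSpace Y₁] [MeasurableSpace Y₂]
    [MeasurableSpace Y₃] (η : Kernel Y₂ Y₃) (κ : Kernel Y₁ Y₂) [IsMarkovKernel η]
    [IsMarkovKernel κ] {f : Y₃ → ℝ} (hf : Measurable f) {C : ℝ} (hC : ∀ x, |f x| ≤ C) (x : Y₁) :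
    ∫ z, f z ∂((η ∘ₖ κ) x) = ∫ y, ∫ z, f z ∂(η y) ∂(κ x) :=
  Kernel.integral_comp (integrable_of_measurable_of_abs_le hf hC)

/-- A bounded lower semicontinuous function is a limit of continuous functions below it. -/
lemma exists_continuous_tendsto_of_lowerSemicontinuous {u : X → ℝ} (hu : LowerSemicontinuous u)
    {C : ℝ} (hC : ∀ x, |u x| ≤ C) :
    ∃ φ : ℕ → X → ℝ, (∀ n, Continuous (φ n)) ∧ (∀ n x, φ n x ≤ u x) ∧ (∀ n x, |φ n x| ≤ C) ∧
      ∀ x, Tendsto (fun n => φ n x) atTop (𝓝 (u x)) := by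
  let _ := TopologicalSpace.metrizableSpaceMetric X
  have hlow : ∀ x, -C ≤ u x := fun x => (abs_le.1 (hC x)).1
  have hb : ∀ (n : ℕ) (x y : X), -C ≤ u y + n * dist x y := fun n x y => by
    have := hlow y
    have : 0 ≤ (n : ℝ) * dist x y := by positivity
    linarith [hlow y]
  have hbdd : ∀ (n : ℕ) (x : X), BddBelow (range fun y => u y + n * dist x y) := fun n x =>
    ⟨-C, by rintro _ ⟨y, rfl⟩; exact hb n x y⟩
  have hle : ∀ (n : ℕ) x, ⨅ y, (u y + n * dist x y) ≤ u x := fun n x => by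
    refine (ciInf_le (hbdd n x) x).trans ?_
    simp
  -- Inf-convolution with `n * dist`, the largest `n`-Lipschitz minorant for a compatible metric.
  refine ⟨fun n x => ⨅ y, (u y + n * dist x y), fun n => ?_, hle, fun n x => ?_, fun x => ?_⟩
  · have hlip : LipschitzWith n fun x => ⨅ y, (u y + n * dist x y) := by
      refine LipschitzWith.of_le_add_mul _ fun x x' => ?_
      have : Nonempty X := ⟨x⟩
      simp only [NNReal.coe_natCast]
      rw [← sub_le_iff_le_add]
      refine le_ciInf fun y => ?_
      rw [sub_le_iff_le_add]
      refine (ciInf_le (hbdd n x) y).trans ?_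
      have h1 := mul_le_mul_of_nonneg_left (dist_triangle x x' y) (Nat.cast_nonneg (α := ℝ) n)
      linarith
    exact hlip.continuous
  · have : Nonempty X := ⟨x⟩
    exact abs_le.2 ⟨le_ciInf fun y => hb n x y, (hle n x).trans (abs_le.1 (hC x)).2⟩
  · rw [Metric.tendsto_atTop]
    intro ε hε
    obtain ⟨δ, hδ, hball⟩ := Metric.eventually_nhds_iff.1 (hu x (u x - ε / 2) (by linarith))
    -- From distance `δ` on, the penalty exceeds the largest possible oscillation `2 * C`, so only
    -- points near `x` matter.
    obtain ⟨N, hN⟩ := exists_nat_gt (2 * C / δ)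
    refine ⟨N, fun n hn => ?_⟩
    have : Nonempty X := ⟨x⟩
    have hge : u x - ε / 2 ≤ ⨅ y, (u y + n * dist x y) := by
      refine le_ciInf fun y => ?_
      by_cases hy : dist y x < δ
      · have h1 := hball hy
        have : 0 ≤ (n : ℝ) * dist x y := by positivity
        linarith
      · push Not at hy
        rw [dist_comm] at hy
        have h1 : 2 * C < n * dist x y := by
          have h2 : (N : ℝ) ≤ n := by exact_mod_cast hn
          rw [div_lt_iff₀ hδ] at hN
          calc 2 * C < N * δ := hN
            _ ≤ n * dist x y := by gcongr
        linarith [hlow y, (abs_le.1 (hC x)).2]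
    rw [Real.dist_eq, abs_lt]
    constructor <;> linarith [hle n x]

lemma IsNormalBauerFamily.integral_integral (hH : IsNormalBauerFamily 𝒱 H) {V W : Set X}
    (hV : V ∈ 𝒱) (hW : W ∈ 𝒱) (hWV : W ⊆ V) {f : X → ℝ} (hf : Measurable f) {C : ℝ}
    (hC : ∀ x, |f x| ≤ C) (x : X) :
    ∫ y, ∫ z, f z ∂(H V y) ∂(H W x) = ∫ z, f z ∂(H V x) := by
  have := hH.isMarkovKernel hV
  have := hH.isMarkovKernel hW
  rw [← integral_comp_kernel_of_abs_le (H V) (H W) hf hC x, hH.comp_eq V hV W hW hWV]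

lemma IsNormalBauerFamily.integral_eq_of_notMem (hH : IsNormalBauerFamily 𝒱 H) {V : Set X}
    (hV : V ∈ 𝒱) {x : X} (hx : x ∉ V) (f : X → ℝ) : ∫ y, f y ∂(H V x) = f x := by
  rw [hH.eq_dirac hV hx, integral_dirac]

lemma tendsto_integral_of_abs_le {Y : Type*} [MeasurableSpace Y] {μ : Measure Y}
    [IsFiniteMeasure μ] {φ : ℕ → Y → ℝ} {u : Y → ℝ} {C : ℝ} (hφ : ∀ n, Measurable (φ n))
    (hC : ∀ n x, |φ n x| ≤ C) (hlim : ∀ x, Tendsto (fun n => φ n x) atTop (𝓝 (u x))) :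
    Tendsto (fun n => ∫ y, φ n y ∂μ) atTop (𝓝 (∫ y, u y ∂μ)) :=
  tendsto_integral_of_dominated_convergence (fun _ => C) (fun n => (hφ n).aestronglyMeasurable)
    (integrable_const C) (fun n => ae_of_all _ fun x => hC n x) (ae_of_all _ hlim)

/-- The continuity axiom covers continuous integrands only; approximating `u` from below exhibits
the integral as a pointwise limit of continuous minorants. -/
lemma IsNormalBauerFamily.lowerSemicontinuous_integral (hH : IsNormalBauerFamily 𝒱 H) {V : Set X}
    (hV : V ∈ 𝒱) {u : X → ℝ} (hu : LowerSemicontinuous u) {C : ℝ} (hC : ∀ x, |u x| ≤ C) :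
    LowerSemicontinuous fun x => ∫ y, u y ∂(H V x) := by
  have := hH.isMarkovKernel hV
  obtain ⟨φ, hφc, hφu, hφC, hlim⟩ := exists_continuous_tendsto_of_lowerSemicontinuous hu hC
  intro x t ht
  obtain ⟨n, hn⟩ := ((tendsto_integral_of_abs_le (μ := H V x) (fun n => (hφc n).measurable) hφC
    hlim).eventually (lt_mem_nhds ht)).exists
  filter_upwards [(hH.continuous_integral V hV (φ n) (hφc n)).continuousAt.eventually
    (lt_mem_nhds hn)] with y hy
  refine hy.trans_le (integral_mono ?_ ?_ (hφu n))
  · exact integrable_of_measurable_of_abs_le (hφc n).measurable (hφC n)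
  · exact integrable_of_measurable_of_abs_le hu.measurable hC

/-- Local superharmonicity implies superharmonicity. -/
lemma IsPSet.integral_le_of_local (hH : IsNormalBauerFamily 𝒱 H) {P V : Set X}
    (hP : IsPSet 𝒱 H P) (hV : V ∈ 𝒱) (hVP : V ⊆ P) {u : X → ℝ} (hu : LowerSemicontinuous u)
    {C : ℝ} (hC : ∀ x, |u x| ≤ C)
    (hloc : ∀ x ∈ V, ∀ N ∈ 𝓝 x, ∃ W ∈ 𝒱, x ∈ W ∧ closure W ⊆ N ∧ ∫ y, u y ∂(H W x) ≤ u x)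
    (x : X) : ∫ y, u y ∂(H V x) ≤ u x := by
  by_cases hx : x ∉ V
  · rw [hH.integral_eq_of_notMem hV hx]
  push Not at hx
  have := hH.isMarkovKernel hV
  obtain ⟨φ, hφc, hφu, hφC, hlim⟩ := exists_continuous_tendsto_of_lowerSemicontinuous hu hC
  refine le_of_tendsto (tendsto_integral_of_abs_le (μ := H V x) (fun n => (hφc n).measurable) hφC
    hlim) (Eventually.of_forall fun n => ?_)
  -- The minimum principle is applied to `u - H_V (φ n)`. It is nonnegative on `∂V`, where `H_V` is
  -- Dirac, and replacing `u` by the continuous `φ n` in the second term keeps the difference lower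
  -- semicontinuous.
  have hcont := hH.continuous_integral V hV (φ n) (hφc n)
  have hCn : ∀ y, |∫ z, φ n z ∂(H V y)| ≤ C := fun y => abs_integral_le_of_abs_le (hφC n)
  rw [← sub_nonneg]
  refine hP.nonneg_of_frontier_nonneg hH (hH.isOpen hV) hVP (hH.isCompact_closure V hV)
    (v := fun y => u y - ∫ z, φ n z ∂(H V y)) ?_ ?_ ?_ x (subset_closure hx)
  · have := hu.add hcont.neg.lowerSemicontinuous
    simpa [sub_eq_add_neg] using this.lowerSemicontinuousOn (closure V)
  · intro y hy
    rw [(hH.isOpen hV).frontier_eq] at hy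
    rw [hH.integral_eq_of_notMem hV hy.2]
    exact sub_nonneg.2 (hφu n y)
  · intro y hy
    obtain ⟨W, hW, hyW, hWV, hle⟩ := hloc y hy V ((hH.isOpen hV).mem_nhds hy)
    have := hH.isMarkovKernel hW
    have i1 : Integrable u (H W y) := integrable_of_measurable_of_abs_le hu.measurable hC
    have i2 : Integrable (fun y => ∫ z, φ n z ∂(H V y)) (H W y) :=
      integrable_of_measurable_of_abs_le hcont.measurable hCn
    refine ⟨W, hW, hyW, hWV, i1.sub i2, ?_⟩
    rw [integral_sub i1 i2, hH.integral_integral hV hW (subset_closure.trans hWV)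
      (hφc n).measurable (hφC n)]
    linarith

/-- Local harmonicity of bounded continuous functions implies harmonicity. -/
lemma IsPSet.integral_eq_of_local (hH : IsNormalBauerFamily 𝒱 H) {P V : Set X}
    (hP : IsPSet 𝒱 H P) (hV : V ∈ 𝒱) (hVP : V ⊆ P) {u : X → ℝ} (hu : Continuous u)
    {C : ℝ} (hC : ∀ x, |u x| ≤ C)
    (hloc : ∀ x ∈ V, ∀ N ∈ 𝓝 x, ∃ W ∈ 𝒱, x ∈ W ∧ closure W ⊆ N ∧ ∫ y, u y ∂(H W x) = u x)
    (x : X) : ∫ y, u y ∂(H V x) = u x := by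
  refine le_antisymm (hP.integral_le_of_local hH hV hVP hu.lowerSemicontinuous hC
    (fun x hx N hN => ?_) x) ?_
  · obtain ⟨W, hW, hxW, hWN, h⟩ := hloc x hx N hN
    exact ⟨W, hW, hxW, hWN, h.le⟩
  · have := hP.integral_le_of_local hH hV hVP (u := fun y => -u y) hu.neg.lowerSemicontinuous
      (C := C) (by simpa using hC)
      (fun x hx N hN => by
        obtain ⟨W, hW, hxW, hWN, h⟩ := hloc x hx N hN
        refine ⟨W, hW, hxW, hWN, ?_⟩
        rw [integral_neg, h]) x
    rw [integral_neg] at this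
    linarith

end Semicontinuous

end

section

/-! ### Perron's method -/

section Perron

variable {X : Type*} [TopologicalSpace X] [T2Space X] [LocallyCompactSpace X]
  [SecondCountableTopology X] [MeasurableSpace X] [BorelSpace X]
  {𝒱 : Set (Set X)} {H : Set X → Kernel X X}

/-- The upper class of the Dirichlet problem on `U` with boundary data `F`: functions bounded by
`C` which are superharmonic on `U`, equal to `F` off `U`, and lower semicontinuous on `X`. -/
structure IsUpper (𝒱 : Set (Set X)) (H : Set X → Kernel X X) (U : Set X) (F : X → ℝ) (C : ℝ)
    (u : X → ℝ) : Prop where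
  lsc : LowerSemicontinuous u
  abs_le : ∀ x, |u x| ≤ C
  eq_of_notMem : ∀ x ∉ U, u x = F x
  integral_le : ∀ V ∈ 𝒱, closure V ⊆ U → ∀ x, ∫ y, u y ∂(H V x) ≤ u x

variable {U P : Set X} {F : X → ℝ} {C : ℝ}

lemma IsUpper.inf (hH : IsNormalBauerFamily 𝒱 H) {u v : X → ℝ} (hu : IsUpper 𝒱 H U F C u)
    (hv : IsUpper 𝒱 H U F C v) : IsUpper 𝒱 H U F C fun x => min (u x) (v x) where
  lsc := hu.lsc.inf hv.lsc
  abs_le x := by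
    rcases min_choice (u x) (v x) with h | h <;> rw [h]
    exacts [hu.abs_le x, hv.abs_le x]
  eq_of_notMem x hx := by rw [hu.eq_of_notMem x hx, hv.eq_of_notMem x hx, min_self]
  integral_le V hV hVU x := by
    have := hH.isMarkovKernel hV
    have iu : Integrable u (H V x) := integrable_of_measurable_of_abs_le hu.lsc.measurable hu.abs_le
    have iv : Integrable v (H V x) := integrable_of_measurable_of_abs_le hv.lsc.measurable hv.abs_le
    refine le_min ((integral_mono (iu.inf iv) iu fun y => min_le_left _ _).trans
      (hu.integral_le V hV hVU x)) ((integral_mono (iu.inf iv) iv fun y => min_le_right _ _).trans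
      (hv.integral_le V hV hVU x))

/-- Poisson modification stays in the upper class. Inside `V` small means are preserved by `H_W H_V
= H_V`; at points off `V` the value is still that of `u`, while elsewhere the function has not
increased. -/
lemma IsUpper.integral_kernel (hH : IsNormalBauerFamily 𝒱 H) (hP : IsPSet 𝒱 H P) (hUP : U ⊆ P)
    {u : X → ℝ} (hu : IsUpper 𝒱 H U F C u) {V : Set X} (hV : V ∈ 𝒱) (hVU : closure V ⊆ U) :
    IsUpper 𝒱 H U F C fun x => ∫ y, u y ∂(H V x) where
  lsc := hH.lowerSemicontinuous_integral hV hu.lsc hu.abs_le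
  abs_le x := by
    have := hH.isMarkovKernel hV
    exact abs_integral_le_of_abs_le hu.abs_le
  eq_of_notMem x hx := by
    rw [hH.integral_eq_of_notMem hV fun h => hx (hVU (subset_closure h)), hu.eq_of_notMem x hx]
  integral_le W hW hWU := by
    have := hH.isMarkovKernel hV
    refine hP.integral_le_of_local hH hW ((subset_closure.trans hWU).trans hUP)
      (hH.lowerSemicontinuous_integral hV hu.lsc hu.abs_le)
      (fun x => abs_integral_le_of_abs_le hu.abs_le) fun x hx N hN => ?_
    by_cases hxV : x ∈ V
    · obtain ⟨W', hW', hxW', hWN⟩ :=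
        hH.exists_closure_subset (inter_mem hN ((hH.isOpen hV).mem_nhds hxV))
      refine ⟨W', hW', hxW', fun y hy => (hWN hy).1, ?_⟩
      rw [hH.integral_integral hV hW' (fun y hy => (hWN (subset_closure hy)).2) hu.lsc.measurable
        hu.abs_le]
    · obtain ⟨W', hW', hxW', hWN⟩ :=
        hH.exists_closure_subset (inter_mem hN ((hH.isOpen hW).mem_nhds hx))
      have := hH.isMarkovKernel hW'
      refine ⟨W', hW', hxW', fun y hy => (hWN hy).1, ?_⟩
      rw [hH.integral_eq_of_notMem hV hxV]
      refine (integral_mono ?_ ?_ fun y => hu.integral_le V hV hVU y).trans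
        (hu.integral_le W' hW' ((fun y hy => hWU (subset_closure (hWN hy).2))) x)
      · exact integrable_of_measurable_of_abs_le (measurable_integral_kernel _ hu.lsc.measurable)
          fun x => abs_integral_le_of_abs_le hu.abs_le
      · exact integrable_of_measurable_of_abs_le hu.lsc.measurable hu.abs_le

-- This is the largest candidate; it witnesses that the upper class is nonempty, without which the
-- infimum `perron` carries no information.
open Classical in
lemma isUpper_const (hH : IsNormalBauerFamily 𝒱 H) (hU : IsOpen U) (hF : Continuous F)
    (hC : ∀ x, |F x| ≤ C) : IsUpper 𝒱 H U F C (U.piecewise (fun _ => C) F) := by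
  have hab : ∀ x, |U.piecewise (fun _ => C) F x| ≤ C := fun x => by
    by_cases hx : x ∈ U
    · rw [piecewise_eq_of_mem _ _ _ hx]
      exact (abs_of_nonneg ((abs_nonneg _).trans (hC x))).le
    · rw [piecewise_eq_of_notMem _ _ _ hx]
      exact hC x
  have hl : LowerSemicontinuous (U.piecewise (fun _ => C) F) := by
    intro x t ht
    by_cases hx : x ∈ U
    · filter_upwards [hU.mem_nhds hx] with y hy
      rw [piecewise_eq_of_mem _ _ _ hx] at ht
      rwa [piecewise_eq_of_mem _ _ _ hy]
    · rw [piecewise_eq_of_notMem _ _ _ hx] at ht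
      filter_upwards [hF.continuousAt.eventually (lt_mem_nhds ht)] with y hy
      by_cases hyU : y ∈ U
      · rw [piecewise_eq_of_mem _ _ _ hyU]
        exact hy.trans_le (abs_le.1 (hC y)).2
      · rwa [piecewise_eq_of_notMem _ _ _ hyU]
  refine ⟨hl, hab, fun x hx => piecewise_eq_of_notMem _ _ _ hx, fun V hV hVU x => ?_⟩
  have := hH.isMarkovKernel hV
  by_cases hx : x ∈ U
  · rw [piecewise_eq_of_mem _ _ _ hx]
    exact (abs_le.1 (abs_integral_le_of_abs_le hab)).2
  · rw [hH.integral_eq_of_notMem hV fun h => hx (hVU (subset_closure h))]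

/-- The Perron solution: the infimum of the upper class. -/
def perron (𝒱 : Set (Set X)) (H : Set X → Kernel X X) (U : Set X) (F : X → ℝ) (C : ℝ) (x : X) : ℝ :=
  ⨅ u : {u : X → ℝ // IsUpper 𝒱 H U F C u}, u.1 x

lemma perron_le {u : X → ℝ} (hu : IsUpper 𝒱 H U F C u) (x : X) :
    perron 𝒱 H U F C x ≤ u x :=
  ciInf_le (f := fun u : {u : X → ℝ // IsUpper 𝒱 H U F C u} => u.1 x)
    ⟨-C, by rintro _ ⟨v, rfl⟩; exact (abs_le.1 (v.2.abs_le x)).1⟩ ⟨u, hu⟩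

lemma exists_lt_perron_add (hne : ∃ u, IsUpper 𝒱 H U F C u) (x : X) {ε : ℝ} (hε : 0 < ε) :
    ∃ u, IsUpper 𝒱 H U F C u ∧ u x < perron 𝒱 H U F C x + ε := by
  obtain ⟨u₀, hu₀⟩ := hne
  have : Nonempty {u : X → ℝ // IsUpper 𝒱 H U F C u} := ⟨⟨u₀, hu₀⟩⟩
  obtain ⟨u, hu⟩ := exists_lt_of_ciInf_lt (lt_add_of_pos_right (perron 𝒱 H U F C x) hε)
  exact ⟨u.1, u.2, hu⟩

lemma le_perron (hne : ∃ u, IsUpper 𝒱 H U F C u) {x : X} {a : ℝ}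
    (h : ∀ u, IsUpper 𝒱 H U F C u → a ≤ u x) : a ≤ perron 𝒱 H U F C x := by
  obtain ⟨u₀, hu₀⟩ := hne
  have : Nonempty {u : X → ℝ // IsUpper 𝒱 H U F C u} := ⟨⟨u₀, hu₀⟩⟩
  exact le_ciInf fun u => h u.1 u.2

lemma perron_of_notMem (hne : ∃ u, IsUpper 𝒱 H U F C u) {x : X} (hx : x ∉ U) :
    perron 𝒱 H U F C x = F x := by
  obtain ⟨u₀, hu₀⟩ := id hne
  refine le_antisymm ((perron_le hu₀ x).trans (hu₀.eq_of_notMem x hx).le) ?_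
  exact le_perron hne fun u hu => (hu.eq_of_notMem x hx).ge

lemma abs_perron_le (hne : ∃ u, IsUpper 𝒱 H U F C u) (x : X) : |perron 𝒱 H U F C x| ≤ C := by
  obtain ⟨u₀, hu₀⟩ := id hne
  exact abs_le.2 ⟨le_perron hne fun u hu => (abs_le.1 (hu.abs_le x)).1,
    (perron_le hu₀ x).trans (abs_le.1 (hu₀.abs_le x)).2⟩

/-- Successive minima over an enumeration of near-optimal upper functions, one for each point `e k`
and each accuracy `1 / (j + 1)`: a single decreasing sequence reaches the infimum at countably many
points. -/
lemma exists_antitone_tendsto_perron (hH : IsNormalBauerFamily 𝒱 H)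
    (hne : ∃ u, IsUpper 𝒱 H U F C u) (e : ℕ → X) :
    ∃ u : ℕ → X → ℝ, (∀ x, Antitone fun n => u n x) ∧ (∀ n, IsUpper 𝒱 H U F C (u n)) ∧
      ∀ k, Tendsto (fun n => u n (e k)) atTop (𝓝 (perron 𝒱 H U F C (e k))) := by
  have hex : ∀ k j : ℕ, ∃ w, IsUpper 𝒱 H U F C w ∧
      w (e k) < perron 𝒱 H U F C (e k) + 1 / ((j : ℝ) + 1) := fun k j =>
    exists_lt_perron_add hne (e k) (by positivity)
  choose w hw hwlt using hex
  let ω : ℕ → X → ℝ := fun m => w m.unpair.1 m.unpair.2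
  let u : ℕ → X → ℝ := fun n => Nat.rec (ω 0) (fun k v x => min (v x) (ω (k + 1) x)) n
  have hus : ∀ n x, u (n + 1) x = min (u n x) (ω (n + 1) x) := fun n x => rfl
  have hanti : ∀ x, Antitone fun n => u n x := fun x =>
    antitone_nat_of_succ_le fun n => (hus n x).le.trans (min_le_left _ _)
  have huω : ∀ n x, u n x ≤ ω n x := fun n x => by
    cases n with
    | zero => exact le_rfl
    | succ n => exact (hus n x).le.trans (min_le_right _ _)
  have hup : ∀ n, IsUpper 𝒱 H U F C (u n) := fun n => by
    induction n with
    | zero => exact hw _ _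
    | succ n ih => exact ih.inf hH (hw _ _)
  refine ⟨u, hanti, hup, fun k => ?_⟩
  rw [Metric.tendsto_atTop]
  intro ε hε
  obtain ⟨j, hj⟩ := exists_nat_one_div_lt hε
  refine ⟨Nat.pair k j, fun n hn => ?_⟩
  have h1 : u n (e k) ≤ w k j (e k) := by
    refine (hanti (e k) hn).trans ((huω _ _).trans ?_)
    simp [ω]
  have h2 := hwlt k j
  have h3 := perron_le (hup n) (e k)
  rw [Real.dist_eq, abs_lt]
  constructor <;> linarith

/-- Take for `v` the limit of a decreasing sequence of upper functions that is optimal along `e`.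
Their Poisson modifications are upper functions, whence the lower bound; their superharmonicity
gives the reverse inequality along `e`. -/
lemma exists_perron_le_integral (hH : IsNormalBauerFamily 𝒱 H) (hP : IsPSet 𝒱 H P) (hUP : U ⊆ P)
    (hne : ∃ u, IsUpper 𝒱 H U F C u) {V : Set X} (hV : V ∈ 𝒱) (hVU : closure V ⊆ U) (e : ℕ → X) :
    ∃ v : X → ℝ, Measurable v ∧ (∀ x, |v x| ≤ C) ∧
      (∀ x, perron 𝒱 H U F C x ≤ ∫ y, v y ∂(H V x)) ∧
      ∀ k, ∫ y, v y ∂(H V (e k)) = perron 𝒱 H U F C (e k) := by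
  have := hH.isMarkovKernel hV
  obtain ⟨u, hanti, hup, hlim⟩ := exists_antitone_tendsto_perron hH hne e
  have hbdd : ∀ x, BddBelow (range fun n => u n x) := fun x =>
    ⟨-C, by rintro _ ⟨n, rfl⟩; exact (abs_le.1 ((hup n).abs_le x)).1⟩
  have hconv : ∀ x, Tendsto (fun n => u n x) atTop (𝓝 (⨅ n, u n x)) := fun x =>
    tendsto_atTop_ciInf (hanti x) (hbdd x)
  have hm : Measurable fun x => ⨅ n, u n x :=
    measurable_of_tendsto_metrizable (fun n => (hup n).lsc.measurable)
      (tendsto_pi_nhds.2 hconv)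
  have hintg : ∀ x, Tendsto (fun n => ∫ y, u n y ∂(H V x)) atTop (𝓝 (∫ y, ⨅ n, u n y ∂(H V x))) :=
    fun x => tendsto_integral_of_abs_le (fun n => (hup n).lsc.measurable)
      (fun n => (hup n).abs_le) hconv
  have hge : ∀ x, perron 𝒱 H U F C x ≤ ∫ y, ⨅ n, u n y ∂(H V x) := fun x =>
    ge_of_tendsto' (hintg x) fun n => perron_le ((hup n).integral_kernel hH hP hUP hV hVU) x
  refine ⟨fun x => ⨅ n, u n x, hm, fun x => ?_, hge, fun k => le_antisymm ?_ (hge _)⟩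
  · exact le_of_tendsto' (hconv x).abs fun n => (hup n).abs_le x
  · exact le_of_tendsto_of_tendsto' (hintg (e k)) (hlim k) fun n =>
      (hup n).integral_le V hV hVU (e k)

/-- `H_V` maps bounded Borel functions to functions continuous on `V`, so two limit functions that
are optimal along the same dense sequence have the same integrals on all of `V`. Adding an arbitrary
`x` to the sequence identifies the value of `perron` at `x`. -/
lemma perron_eq_integral (hH : IsNormalBauerFamily 𝒱 H) (hP : IsPSet 𝒱 H P) (hUP : U ⊆ P)
    (hne : ∃ u, IsUpper 𝒱 H U F C u) {V : Set X} (hV : V ∈ 𝒱) (hVU : closure V ⊆ U) :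
    ∃ v : X → ℝ, Measurable v ∧ (∀ x, |v x| ≤ C) ∧
      ∀ x ∈ V, perron 𝒱 H U F C x = ∫ y, v y ∂(H V x) := by
  by_cases hXne : Nonempty X
  swap
  · refine ⟨perron 𝒱 H U F C, ?_, abs_perron_le hne, fun x => (hXne ⟨x⟩).elim⟩
    have := not_nonempty_iff.1 hXne
    exact measurable_of_empty _
  obtain ⟨v, hvm, hvC, hvge, hve⟩ :=
    exists_perron_le_integral hH hP hUP hne hV hVU (TopologicalSpace.denseSeq X)
  refine ⟨v, hvm, hvC, fun x hx => ?_⟩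
  obtain ⟨v', hvm', hvC', hvge', hve'⟩ := exists_perron_le_integral hH hP hUP hne hV hVU
    fun n => Nat.casesOn n x (TopologicalSpace.denseSeq X)
  have hEq : EqOn (fun y => ∫ z, v z ∂(H V y)) (fun y => ∫ z, v' z ∂(H V y)) V := by
    refine EqOn.of_subset_closure (s := V ∩ range (TopologicalSpace.denseSeq X)) ?_
      (hH.continuousOn_integral V hV v hvm ⟨C, hvC⟩)
      (hH.continuousOn_integral V hV v' hvm' ⟨C, hvC'⟩)
      inter_subset_left
      ((TopologicalSpace.denseRange_denseSeq X).open_subset_closure_inter (hH.isOpen hV))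
    rintro _ ⟨-, n, rfl⟩
    exact (hve n).trans (hve' (n + 1)).symm
  exact (hve' 0).symm.trans (hEq hx).symm

lemma continuousOn_perron (hH : IsNormalBauerFamily 𝒱 H) (hP : IsPSet 𝒱 H P) (hU : IsOpen U)
    (hUP : U ⊆ P) (hne : ∃ u, IsUpper 𝒱 H U F C u) : ContinuousOn (perron 𝒱 H U F C) U := by
  intro x hx
  obtain ⟨V, hV, hxV, hVU⟩ := hH.exists_closure_subset (hU.mem_nhds hx)
  obtain ⟨v, hvm, hvC, hve⟩ := perron_eq_integral hH hP hUP hne hV hVU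
  have h1 : ContinuousOn (perron 𝒱 H U F C) V :=
    (hH.continuousOn_integral V hV v hvm ⟨C, hvC⟩).congr hve
  exact (h1.continuousAt ((hH.isOpen hV).mem_nhds hxV)).continuousWithinAt

lemma integral_perron_of_local (hH : IsNormalBauerFamily 𝒱 H) (hP : IsPSet 𝒱 H P) (hU : IsOpen U)
    (hUP : U ⊆ P) (hne : ∃ u, IsUpper 𝒱 H U F C u) {x : X} (hx : x ∈ U) {N : Set X}
    (hN : N ∈ 𝓝 x) :
    ∃ W ∈ 𝒱, x ∈ W ∧ closure W ⊆ N ∧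
      ∫ y, perron 𝒱 H U F C y ∂(H W x) = perron 𝒱 H U F C x := by
  obtain ⟨V, hV, hxV, hVU⟩ := hH.exists_closure_subset (hU.mem_nhds hx)
  obtain ⟨v, hvm, hvC, hve⟩ := perron_eq_integral hH hP hUP hne hV hVU
  obtain ⟨W, hW, hxW, hWN⟩ := hH.exists_closure_subset (inter_mem hN ((hH.isOpen hV).mem_nhds hxV))
  refine ⟨W, hW, hxW, fun y hy => (hWN hy).1, ?_⟩
  rw [hve x hxV, ← hH.integral_integral hV hW (fun y hy => (hWN (subset_closure hy)).2) hvm hvC]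
  refine integral_congr_ae ?_
  filter_upwards [hH.ae_mem_frontier hW hxW] with y hy
  exact hve y (hWN (frontier_subset_closure hy)).2

end Perron

end

section

/-! ### Barriers and regularity -/

section Regular

variable {X : Type*} [TopologicalSpace X] [T2Space X] [LocallyCompactSpace X]
  [SecondCountableTopology X] [MeasurableSpace X] [BorelSpace X]
  {𝒱 : Set (Set X)} {H : Set X → Kernel X X} {U P : Set X} {F : X → ℝ} {C : ℝ}

lemma IsNormalBauerFamily.integrable_of_continuousOn (hH : IsNormalBauerFamily 𝒱 H) {V : Set X}
    (hV : V ∈ 𝒱) {x : X} (hx : x ∈ V) {f : X → ℝ} (hf : ContinuousOn f (closure V)) :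
    Integrable f (H V x) := by
  have := hH.isMarkovKernel hV
  have h1 : IntegrableOn f (closure V) (H V x) :=
    hf.integrableOn_compact (hH.isCompact_closure V hV)
  rwa [IntegrableOn, Measure.restrict_eq_self_of_ae_mem] at h1
  filter_upwards [hH.ae_mem_frontier hV hx] with y hy using frontier_subset_closure hy

lemma IsHarmonicOn.mono {h : X → ℝ} {U' : Set X} (hh : IsHarmonicOn 𝒱 H h U) (hU' : U' ⊆ U) :
    IsHarmonicOn 𝒱 H h U' :=
  ⟨hh.1.mono hU', fun V hV hVU => hh.2 V hV (hVU.trans hU')⟩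

lemma isHarmonicOn_const (hH : IsNormalBauerFamily 𝒱 H) (c : ℝ) :
    IsHarmonicOn 𝒱 H (fun _ => c) U := by
  refine ⟨continuousOn_const, fun V hV _ x _ => ?_⟩
  have := hH.isMarkovKernel hV
  simp

lemma IsHarmonicOn.add (hH : IsNormalBauerFamily 𝒱 H) {h k : X → ℝ} (hh : IsHarmonicOn 𝒱 H h U)
    (hk : IsHarmonicOn 𝒱 H k U) : IsHarmonicOn 𝒱 H (fun x => h x + k x) U := by
  refine ⟨hh.1.add hk.1, fun V hV hVU x hx => ?_⟩
  rw [integral_add (hH.integrable_of_continuousOn hV hx (hh.1.mono hVU))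
    (hH.integrable_of_continuousOn hV hx (hk.1.mono hVU)), hh.2 V hV hVU x hx, hk.2 V hV hVU x hx]

lemma IsHarmonicOn.const_mul {h : X → ℝ} (c : ℝ) (hh : IsHarmonicOn 𝒱 H h U) :
    IsHarmonicOn 𝒱 H (fun x => c * h x) U := by
  refine ⟨hh.1.const_mul c, fun V hV hVU x hx => ?_⟩
  rw [integral_const_mul, hh.2 V hV hVU x hx]

lemma IsHarmonicOn.sub (hH : IsNormalBauerFamily 𝒱 H) {h k : X → ℝ} (hh : IsHarmonicOn 𝒱 H h U)
    (hk : IsHarmonicOn 𝒱 H k U) : IsHarmonicOn 𝒱 H (fun x => h x - k x) U := by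
  simpa [sub_eq_add_neg] using hh.add hH (hk.const_mul (-1))

/-- Minimum principle for harmonic functions. -/
lemma IsPSet.nonneg_of_isHarmonicOn (hH : IsNormalBauerFamily 𝒱 H) (hP : IsPSet 𝒱 H P)
    (hU : IsOpen U) (hUP : U ⊆ P) (hUc : IsCompact (closure U)) {h : X → ℝ}
    (hc : ContinuousOn h (closure U)) (hh : IsHarmonicOn 𝒱 H h U)
    (hfr : ∀ x ∈ frontier U, 0 ≤ h x) : ∀ x ∈ closure U, 0 ≤ h x := by
  refine hP.nonneg_of_frontier_nonneg hH hU hUP hUc hc.lowerSemicontinuousOn hfr fun x hx => ?_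
  obtain ⟨W, hW, hxW, hWU⟩ := hH.exists_closure_subset (hU.mem_nhds hx)
  exact ⟨W, hW, hxW, hWU, hH.integrable_of_continuousOn hW hxW
    (hc.mono (hWU.trans subset_closure)), (hh.2 W hW hWU x hxW).le⟩

lemma IsPSet.eqOn_of_isDirichletSolution (hH : IsNormalBauerFamily 𝒱 H) (hP : IsPSet 𝒱 H P)
    (hU : IsOpen U) (hUP : U ⊆ P) (hUc : IsCompact (closure U)) {f h₁ h₂ : X → ℝ}
    (h1 : IsDirichletSolution 𝒱 H U f h₁) (h2 : IsDirichletSolution 𝒱 H U f h₂) :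
    EqOn h₁ h₂ (closure U) := by
  intro x hx
  have a1 := hP.nonneg_of_isHarmonicOn hH hU hUP hUc (h1.1.sub h2.1) (h1.2.1.sub hH h2.2.1)
    (fun y hy => by simp [h1.2.2 hy, h2.2.2 hy]) x hx
  have a2 := hP.nonneg_of_isHarmonicOn hH hU hUP hUc (h2.1.sub h1.1) (h2.2.1.sub hH h1.2.1)
    (fun y hy => by simp [h1.2.2 hy, h2.2.2 hy]) x hx
  simp only [Pi.sub_apply] at a1 a2
  linarith

open Classical in
/-- A barrier at `z` yields functions of the upper class which are close to `F z` near `z`. -/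
lemma exists_isUpper_le_of_barrier (hH : IsNormalBauerFamily 𝒱 H) (hP : IsPSet 𝒱 H P)
    (hU : IsOpen U) (hUP : U ⊆ P) (hF : Continuous F) (hC : ∀ x, |F x| ≤ C) {z : X}
    {w : X → ℝ} (hw : IsHarmonicOn 𝒱 H w U) (hwpos : ∀ x ∈ U, 0 < w x)
    (hwlim : Tendsto w (𝓝[U] z) (𝓝 0)) {ε : ℝ} (hε : 0 < ε) :
    ∃ u, IsUpper 𝒱 H U F C u ∧ ∀ᶠ x in 𝓝[U] z, u x ≤ F z + ε := by
  have hC0 : 0 ≤ C := (abs_nonneg _).trans (hC z)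
  have hlow : -C ≤ F z := (abs_le.1 (hC z)).1
  obtain ⟨V, hV, hzV, hVN⟩ := hH.exists_closure_subset (x := z) (N := {y | F y < F z + ε / 2})
    (hF.continuousAt.eventually (gt_mem_nhds (by linarith)))
  have hVo := hH.isOpen hV
  have := hH.isMarkovKernel hV
  -- Chosen so that `2 * C * (2 * δ) ≤ ε / 2` in the final estimate.
  set δ : ℝ := ε / (8 * (C + 1)) with hδ
  have hδ0 : 0 < δ := by positivity
  -- The barrier is bounded away from `0` only on compact subsets of `U`. The rest `B` of `∂V ∩ U`
  -- is made small in harmonic measure seen from `z` and is taken care of by `b = H_V 1_B`.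
  obtain ⟨K', hK'sub, hK', hK'lt⟩ :=
    (isClosed_frontier.measurableSet.inter hU.measurableSet :
      MeasurableSet (frontier V ∩ U)).exists_isCompact_sdiff_lt (μ := H V z)
      (measure_ne_top _ _) (ε := ENNReal.ofReal δ) (by simpa using hδ0)
  obtain ⟨c, hc0, hcK⟩ := hK'.exists_forall_le' (hw.1.mono (hK'sub.trans inter_subset_right))
    (a := 0) (fun y hy => hwpos y (hK'sub hy).2)
  set B := (frontier V ∩ U) \ K' with hB
  have hBm : MeasurableSet B :=
    (isClosed_frontier.measurableSet.inter hU.measurableSet).diff hK'.measurableSet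
  set χ : X → ℝ := B.indicator fun _ => 1 with hχ
  have hχm : Measurable χ := measurable_const.indicator hBm
  have hχ0 : ∀ y, 0 ≤ χ y := fun y => indicator_nonneg (fun _ _ => zero_le_one) y
  have hχ1 : ∀ y, χ y ≤ 1 := fun y => indicator_le_self' (fun _ _ => zero_le_one) y |>.trans le_rfl
  have hχabs : ∀ y, |χ y| ≤ 1 := fun y => by rw [abs_of_nonneg (hχ0 y)]; exact hχ1 y
  set b : X → ℝ := fun y => ∫ t, χ t ∂(H V y) with hb
  have hbm : Measurable b := measurable_integral_kernel _ hχm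
  have hbabs : ∀ y, |b y| ≤ 1 := fun y => abs_integral_le_of_abs_le hχabs
  have hb0 : ∀ y, 0 ≤ b y := fun y => integral_nonneg hχ0
  have hbc : ContinuousOn b V := hH.continuousOn_integral V hV χ hχm ⟨1, hχabs⟩
  have hbz : b z < δ := by
    have h1 : b z = (H V z).real B := by
      simp only [hb, hχ]
      exact integral_indicator_one hBm
    rw [h1, Measure.real]
    exact (ENNReal.toReal_lt_of_lt_ofReal hK'lt)
  -- The factor `2 * C` is the jump from the least possible `F z`, namely `-C`, up to `C`. Near `∂V
  -- ∩ U`, where `w / c + b` has lower limit at least `1`, it lifts `s` above `C`, so gluing `min C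
  -- s` with the constant `C` stays lower semicontinuous.
  set s : X → ℝ := fun y => F z + ε / 2 + 2 * C * (w y / c + b y) with hs
  have hsc : ContinuousOn s (U ∩ V) := by
    refine continuousOn_const.add (continuousOn_const.mul (((hw.1.mono inter_subset_left).div_const
      c).add (hbc.mono inter_subset_right)))
  have hsge : ∀ y ∈ U, F z + ε / 2 ≤ s y := fun y hy => by
    have h1 : 0 ≤ w y / c := div_nonneg (hwpos y hy).le hc0.le
    have h2 := hb0 y
    have : 0 ≤ 2 * C * (w y / c + b y) := by positivity
    simp only [hs]
    linarith
  set u : X → ℝ := fun y => if y ∈ U then (if y ∈ V then min C (s y) else C) else F y with hu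
  have uF : ∀ y ∉ U, u y = F y := fun y hy => if_neg hy
  have uV : ∀ y ∈ U, y ∈ V → u y = min C (s y) := fun y hy hyV => by
    simp only [hu, if_pos hy, if_pos hyV]
  have uC : ∀ y ∈ U, y ∉ V → u y = C := fun y hy hyV => by
    simp only [hu, if_pos hy, if_neg hyV]
  have hFu : ∀ y, F y ≤ u y := fun y => by
    have hFC := (abs_le.1 (hC y)).2
    by_cases hy : y ∈ U
    · by_cases hyV : y ∈ V
      · rw [uV y hy hyV]
        exact le_min hFC ((hVN (subset_closure hyV)).le.trans (hsge y hy))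
      · rwa [uC y hy hyV]
    · rw [uF y hy]
  have huC : ∀ y, u y ≤ C := fun y => by
    by_cases hy : y ∈ U
    · by_cases hyV : y ∈ V
      · rw [uV y hy hyV]
        exact min_le_left _ _
      · rw [uC y hy hyV]
    · rw [uF y hy]
      exact (abs_le.1 (hC y)).2
  have huabs : ∀ y, |u y| ≤ C := fun y =>
    abs_le.2 ⟨(abs_le.1 (hC y)).1.trans (hFu y), huC y⟩
  have hlsc : LowerSemicontinuous u := by
    intro x t ht
    by_cases hx : x ∈ U
    swap
    · rw [uF x hx] at ht
      filter_upwards [hF.continuousAt.eventually (lt_mem_nhds ht)] with y hy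
      exact hy.trans_le (hFu y)
    by_cases hxV : x ∈ V
    · rw [uV x hx hxV] at ht
      have hmem : U ∩ V ∈ 𝓝 x := (hU.inter hVo).mem_nhds ⟨hx, hxV⟩
      have h1 : ContinuousAt (fun y => min C (s y)) x :=
        continuousAt_const.min (hsc.continuousAt hmem)
      filter_upwards [h1.eventually (lt_mem_nhds ht), hmem] with y hy hyUV
      rwa [uV y hyUV.1 hyUV.2]
    rw [uC x hx hxV] at ht
    by_cases hxcl : x ∈ closure V
    swap
    · filter_upwards [hU.mem_nhds hx, isClosed_closure.isOpen_compl.mem_nhds hxcl] with y hy hyV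
      rwa [uC y hy fun h => hyV (subset_closure h)]
    have hxfr : x ∈ frontier V := by rw [hVo.frontier_eq]; exact ⟨hxcl, hxV⟩
    -- On `K'` the barrier term alone reaches `1`. On the rest of `∂V ∩ U`, a continuous `φ` with `φ
    -- x = 1` which is at most the indicator of `B` on `∂V` bounds `b` from below by a function
    -- continuous at `x`.
    have key : ∃ q : X → ℝ, ContinuousAt q x ∧ 1 ≤ q x ∧ ∀ᶠ y in 𝓝 x, y ∈ U → y ∈ V →
        q y ≤ w y / c + b y := by
      by_cases hxK : x ∈ K'
      · refine ⟨fun y => w y / c, (hw.1.continuousAt (hU.mem_nhds hx)).div_const c,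
          (one_le_div hc0).2 (hcK x hxK), Eventually.of_forall fun y _ _ => ?_⟩
        linarith [hb0 y]
      · obtain ⟨φ, hφ0, hφ1, hφ01⟩ := exists_continuous_zero_one_of_isClosed (s := (U \ K')ᶜ)
          (t := {x}) (hU.sdiff hK'.isClosed).isClosed_compl isClosed_singleton
          (by simp only [disjoint_singleton_right, mem_compl_iff, not_not]; exact ⟨hx, hxK⟩)
        refine ⟨fun y => ∫ t, φ t ∂(H V y),
          (hH.continuous_integral V hV φ φ.continuous).continuousAt, ?_,
          Eventually.of_forall fun y hy hyV => ?_⟩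
        · simp only [hH.integral_eq_of_notMem hV hxV, hφ1 rfl, Pi.one_apply, le_refl]
        · have h1 : ∫ t, φ t ∂(H V y) ≤ b y := by
            refine integral_mono_ae (integrable_of_measurable_of_abs_le φ.continuous.measurable
              (C := 1) fun t => ?_) (integrable_of_measurable_of_abs_le hχm hχabs) ?_
            · rw [abs_of_nonneg (hφ01 t).1]; exact (hφ01 t).2
            · filter_upwards [hH.ae_mem_frontier hV hyV] with t htf
              by_cases htB : t ∈ B
              · simp only [hχ, indicator_of_mem htB]
                exact (hφ01 t).2
              · have : φ t = 0 := hφ0 fun h => htB ⟨⟨htf, h.1⟩, h.2⟩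
                rw [this]
                exact hχ0 t
          have := div_nonneg (hwpos y hy).le hc0.le
          linarith
    obtain ⟨q, hqc, hq1, hq⟩ := key
    have h2 : t < F z + ε / 2 + 2 * C * q x := by
      have : 2 * C * 1 ≤ 2 * C * q x := by gcongr
      linarith
    have h3 : ContinuousAt (fun y => F z + ε / 2 + 2 * C * q y) x :=
      continuousAt_const.add (continuousAt_const.mul hqc)
    filter_upwards [h3.eventually (lt_mem_nhds h2), hq, hU.mem_nhds hx] with y hy hqy hyU
    by_cases hyV : y ∈ V
    · rw [uV y hyU hyV]
      refine lt_min ht (hy.trans_le ?_)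
      have := hqy hyU hyV
      simp only [hs]
      gcongr
    · rwa [uC y hyU hyV]
  refine ⟨u, ⟨hlsc, huabs, uF, fun V' hV' hV'U => hP.integral_le_of_local hH hV'
    ((subset_closure.trans hV'U).trans hUP) hlsc huabs fun x hx N hN => ?_⟩, ?_⟩
  · have hxU : x ∈ U := hV'U (subset_closure hx)
    -- On `U ∩ V` the function is the minimum of a constant and the locally harmonic `s`; at the
    -- remaining points of `U` it takes its maximal value `C`.
    by_cases hxV : x ∈ V
    · obtain ⟨W, hW, hxW, hWN⟩ := hH.exists_closure_subset
        (inter_mem hN ((hU.inter hVo).mem_nhds ⟨hxU, hxV⟩))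
      have := hH.isMarkovKernel hW
      refine ⟨W, hW, hxW, fun y hy => (hWN hy).1, ?_⟩
      have iu : Integrable u (H W x) := integrable_of_measurable_of_abs_le hlsc.measurable huabs
      have iw : Integrable w (H W x) := hH.integrable_of_continuousOn hW hxW
        (hw.1.mono fun y hy => (hWN hy).2.1)
      have ib : Integrable b (H W x) := integrable_of_measurable_of_abs_le hbm hbabs
      have iwb : Integrable (fun y => 2 * C * (w y / c + b y)) (H W x) :=
        ((iw.div_const c).add ib).const_mul _
      have is : Integrable s (H W x) := (integrable_const _).add iwb
      rw [uV x hxU hxV]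
      refine le_min (abs_le.1 (abs_integral_le_of_abs_le huabs)).2 ?_
      have hle : ∫ y, u y ∂(H W x) ≤ ∫ y, s y ∂(H W x) := by
        refine integral_mono_ae iu is ?_
        filter_upwards [hH.ae_mem_frontier hW hxW] with y hy
        have hy' := (hWN (frontier_subset_closure hy)).2
        rw [uV y hy'.1 hy'.2]
        exact min_le_right _ _
      refine hle.trans (le_of_eq ?_)
      have e1 : ∫ y, b y ∂(H W x) = b x := hH.integral_integral hV hW
        (fun y hy => (hWN (subset_closure hy)).2.2) hχm hχabs x
      have e2 : ∫ y, w y ∂(H W x) = w x := hw.2 W hW (fun y hy => (hWN hy).2.1) x hxW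
      simp only [hs]
      rw [integral_add (integrable_const _) iwb,
        integral_const_mul, integral_add (iw.div_const c) ib, integral_div, e1, e2]
      simp
    · obtain ⟨W, hW, hxW, hWN⟩ := hH.exists_closure_subset hN
      have := hH.isMarkovKernel hW
      refine ⟨W, hW, hxW, hWN, ?_⟩
      rw [uC x hxU hxV]
      exact (abs_le.1 (abs_integral_le_of_abs_le huabs)).2
  · have e1 : ∀ᶠ y in 𝓝[U] z, w y < c * δ := hwlim.eventually (gt_mem_nhds (by positivity))
    have e2 : ∀ᶠ y in 𝓝[U] z, b y < δ := nhdsWithin_le_nhds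
      ((hbc.continuousAt (hVo.mem_nhds hzV)).eventually (gt_mem_nhds hbz))
    filter_upwards [e1, e2, nhdsWithin_le_nhds (hVo.mem_nhds hzV), self_mem_nhdsWithin]
      with y h1 h2 h3 h4
    rw [uV y h4 h3]
    refine (min_le_right _ _).trans ?_
    have h5 : w y / c < δ := by rw [div_lt_iff₀ hc0]; linarith
    have h6 : 2 * C * (w y / c + b y) ≤ 2 * C * (2 * δ) := by
      gcongr
      linarith
    have h7 : 2 * C * (2 * δ) ≤ ε / 2 := by
      have : 8 * (C + 1) * δ = ε := by rw [hδ]; field_simp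
      nlinarith
    simp only [hs]
    linarith

/-- `U` has a barrier at every boundary point. -/
def HasBarriers (𝒱 : Set (Set X)) (H : Set X → Kernel X X) (U : Set X) : Prop :=
  ∀ z ∈ frontier U, ∃ w : X → ℝ, IsHarmonicOn 𝒱 H w U ∧ (∀ x ∈ U, 0 < w x) ∧
    Tendsto w (𝓝[U] z) (𝓝 0)

/-- At a boundary point the barrier bounds the solution from above. The lower bound comes from the
same construction for `-F`, because the sum of an upper function for `F` and one for `-F` is
nonnegative by the minimum principle. -/
lemma continuous_perron (hH : IsNormalBauerFamily 𝒱 H) (hP : IsPSet 𝒱 H P)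
    (hU : IsOpen U) (hUP : U ⊆ P) (hUc : IsCompact (closure U)) (hbar : HasBarriers 𝒱 H U)
    (hF : Continuous F) (hC : ∀ x, |F x| ≤ C) : Continuous (perron 𝒱 H U F C) := by
  have hne : ∃ u, IsUpper 𝒱 H U F C u := ⟨_, isUpper_const hH hU hF hC⟩
  rw [continuous_iff_continuousAt]
  intro x
  by_cases hx : x ∈ U
  · exact (continuousOn_perron hH hP hU hUP hne).continuousAt (hU.mem_nhds hx)
  have hFx := perron_of_notMem hne hx
  rw [ContinuousAt, hFx, ← nhdsWithin_univ, ← union_compl_self U, nhdsWithin_union, tendsto_sup]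
  constructor
  swap
  · refine (hF.continuousAt.tendsto.mono_left nhdsWithin_le_nhds).congr' ?_
    filter_upwards [self_mem_nhdsWithin] with y hy
    exact (perron_of_notMem hne hy).symm
  by_cases hxcl : x ∈ closure U
  swap
  · rw [mem_closure_iff_nhdsWithin_neBot, not_neBot] at hxcl
    rw [hxcl]
    exact tendsto_bot
  obtain ⟨w, hw, hwpos, hwlim⟩ := hbar x (by rw [hU.frontier_eq]; exact ⟨hxcl, hx⟩)
  rw [tendsto_order]
  constructor
  · intro t ht
    obtain ⟨u, hu, hule⟩ := exists_isUpper_le_of_barrier hH hP hU hUP hF.neg (C := C)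
      (by simpa using hC) hw hwpos hwlim (ε := (F x - t) / 2) (by linarith)
    filter_upwards [hule, self_mem_nhdsWithin] with y hy hyU
    have : -u y ≤ perron 𝒱 H U F C y := by
      refine le_perron hne fun v hv => ?_
      have hsum : 0 ≤ v y + u y := by
        refine hP.nonneg_of_frontier_nonneg hH hU hUP hUc (v := fun y => v y + u y)
          ((hv.lsc.add hu.lsc).lowerSemicontinuousOn _) (fun q hq => ?_) (fun q hq => ?_) y
          (subset_closure hyU)
        · rw [hU.frontier_eq] at hq
          rw [hv.eq_of_notMem q hq.2, hu.eq_of_notMem q hq.2]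
          simp
        · obtain ⟨W, hW, hqW, hWU⟩ := hH.exists_closure_subset (hU.mem_nhds hq)
          have := hH.isMarkovKernel hW
          have iv : Integrable v (H W q) :=
            integrable_of_measurable_of_abs_le hv.lsc.measurable hv.abs_le
          have iu : Integrable u (H W q) :=
            integrable_of_measurable_of_abs_le hu.lsc.measurable hu.abs_le
          refine ⟨W, hW, hqW, hWU, iv.add iu, ?_⟩
          rw [integral_add iv iu]
          exact add_le_add (hv.integral_le W hW hWU q) (hu.integral_le W hW hWU q)
      linarith
    simp only [Pi.neg_apply] at hy
    linarith
  · intro t ht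
    obtain ⟨u, hu, hule⟩ := exists_isUpper_le_of_barrier hH hP hU hUP hF hC hw hwpos hwlim
      (ε := (t - F x) / 2) (by linarith)
    filter_upwards [hule] with y hy
    linarith [perron_le hu y]

/-- Tietze extension: boundary data live on a compact set only, whereas the Perron construction uses
bounded continuous data on all of `X`. -/
lemma exists_continuous_eqOn_of_isCompact {s : Set X} (hs : IsCompact s) {f : X → ℝ}
    (hf : ContinuousOn f s) :
    ∃ (F : X → ℝ) (C : ℝ), Continuous F ∧ (∀ x, |F x| ≤ C) ∧ EqOn F f s := by
  obtain ⟨C, hC⟩ := hs.exists_bound_of_continuousOn hf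
  obtain ⟨g, hg, hgf⟩ := ContinuousMap.exists_restrict_eq_forall_mem_of_closed (s := s)
    ⟨s.domRestrict f, hf.domRestrict⟩ (t := Icc (-|C|) |C|)
    (fun x => abs_le.1 ((hC x x.2).trans (le_abs_self C))) ⟨0, by simp⟩ hs.isClosed
  exact ⟨g, |C|, g.continuous, fun x => abs_le.2 (hg x), fun x hx =>
    congrArg (fun k : C(s, ℝ) => k ⟨x, hx⟩) hgf⟩

/-- A relatively compact open subset of a `𝒫`-set having barriers is regular. -/
theorem IsPSet.isRegular (hH : IsNormalBauerFamily 𝒱 H) (hP : IsPSet 𝒱 H P)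
    (hU : IsOpen U) (hUP : U ⊆ P) (hUc : IsCompact (closure U)) (hbar : HasBarriers 𝒱 H U) :
    IsRegular 𝒱 H U := by
  refine ⟨hU, hUc, fun f hf => ⟨?_, ?_, ?_⟩⟩
  · obtain ⟨F, C, hF, hC, hFf⟩ := exists_continuous_eqOn_of_isCompact
      (hUc.of_isClosed_subset isClosed_frontier frontier_subset_closure) hf
    have hne : ∃ u, IsUpper 𝒱 H U F C u := ⟨_, isUpper_const hH hU hF hC⟩
    have hcont := continuous_perron hH hP hU hUP hUc hbar hF hC
    refine ⟨perron 𝒱 H U F C, hcont.continuousOn, ⟨hcont.continuousOn, fun V hV hVU x _ => ?_⟩,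
      fun x hx => ?_⟩
    · exact hP.integral_eq_of_local hH hV ((subset_closure.trans hVU).trans hUP) hcont
        (abs_perron_le hne) (fun y hy N hN => integral_perron_of_local hH hP hU hUP hne
          (hVU (subset_closure hy)) hN) x
    · rw [perron_of_notMem hne, hFf hx]
      rw [hU.frontier_eq] at hx
      exact hx.2
  · exact fun h₁ h₂ h1 h2 => hP.eqOn_of_isDirichletSolution hH hU hUP hUc h1 h2
  · intro hpos h hh x hx
    exact hP.nonneg_of_isHarmonicOn hH hU hUP hUc hh.1 hh.2.1
      (fun z hz => by rw [hh.2.2 hz]; exact hpos z hz) x hx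

end Regular

end

section

/-! ### Harmonic measures by Riesz representation -/

section Riesz

open scoped CompactlySupported NNReal

variable {X : Type*} [TopologicalSpace X] [T2Space X] [LocallyCompactSpace X]
  [SecondCountableTopology X] [MeasurableSpace X] [BorelSpace X]
  {𝒱 : Set (Set X)} {H : Set X → Kernel X X} {U : Set X}

lemma IsDirichletSolution.add (hH : IsNormalBauerFamily 𝒱 H) {f₁ f₂ h₁ h₂ : X → ℝ}
    (h1 : IsDirichletSolution 𝒱 H U f₁ h₁) (h2 : IsDirichletSolution 𝒱 H U f₂ h₂) :
    IsDirichletSolution 𝒱 H U (fun x => f₁ x + f₂ x) fun x => h₁ x + h₂ x :=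
  ⟨h1.1.add h2.1, h1.2.1.add hH h2.2.1, fun x hx => by simp only [h1.2.2 hx, h2.2.2 hx]⟩

lemma IsDirichletSolution.const_mul {f h : X → ℝ} (c : ℝ) (h1 : IsDirichletSolution 𝒱 H U f h) :
    IsDirichletSolution 𝒱 H U (fun x => c * f x) fun x => c * h x :=
  ⟨h1.1.const_mul c, h1.2.1.const_mul c, fun x hx => by simp only [h1.2.2 hx]⟩

lemma IsDirichletSolution.congr {f f' h : X → ℝ} (h1 : IsDirichletSolution 𝒱 H U f h)
    (hf : EqOn f f' (frontier U)) : IsDirichletSolution 𝒱 H U f' h :=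
  ⟨h1.1, h1.2.1, h1.2.2.trans hf⟩

lemma IsDirichletSolution.congr_left {f h h' : X → ℝ}
    (hH : IsNormalBauerFamily 𝒱 H) (h1 : IsDirichletSolution 𝒱 H U f h)
    (hh : EqOn h' h (closure U)) : IsDirichletSolution 𝒱 H U f h' := by
  refine ⟨h1.1.congr hh, ⟨h1.2.1.1.congr (hh.mono subset_closure), fun V hV hVU x hx => ?_⟩,
    fun x hx => (hh (frontier_subset_closure hx)).trans (h1.2.2 hx)⟩
  rw [hh (subset_closure (hVU (subset_closure hx))), ← h1.2.1.2 V hV hVU x hx]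
  refine integral_congr_ae ?_
  filter_upwards [hH.ae_mem_frontier hV hx] with y hy
  exact hh (subset_closure (hVU (frontier_subset_closure hy)))

/-- The harmonic measures of a regular set. -/
lemma IsRegular.exists_measure (hH : IsNormalBauerFamily 𝒱 H) (hU : IsRegular 𝒱 H U) {x : X}
    (hx : x ∈ U) : ∃ μ : Measure X, IsProbabilityMeasure μ ∧ μ (frontier U)ᶜ = 0 ∧
      ∀ f h : X → ℝ, Continuous f → IsDirichletSolution 𝒱 H U f h → ∫ y, f y ∂μ = h x := by
  obtain ⟨hUo, hUc, hreg⟩ := hU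
  have hxc : x ∈ closure U := subset_closure hx
  have hex : ∀ f : C_c(X, ℝ), ∃ h, IsDirichletSolution 𝒱 H U f h := fun f =>
    (hreg f f.continuous.continuousOn).1
  choose sol hsol using hex
  have huniq : ∀ (f : C_c(X, ℝ)) (f' h : X → ℝ), EqOn f' f (frontier U) →
      IsDirichletSolution 𝒱 H U f' h → sol f x = h x := fun f f' h hff' hh =>
    (hreg f f.continuous.continuousOn).2.1 _ _ (hsol f) (hh.congr hff') hxc
  -- Uniqueness of Dirichlet solutions makes `f ↦ sol f x` linear, and it depends only on `f` on
  -- `∂U`; this is why the representing measure is carried by `∂U`. Compact supports are needed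
  -- since `X` is only locally compact.
  let Λ : C_c(X, ℝ) →ₚ[ℝ] ℝ := PositiveLinearMap.mk₀
    { toFun := fun f => sol f x
      map_add' := fun f g => huniq (f + g) (fun y => f y + g y) _ (fun y _ => by simp)
        ((hsol f).add hH (hsol g))
      map_smul' := fun c f => huniq (c • f) (fun y => c * f y) _ (fun y _ => by simp)
        ((hsol f).const_mul c) }
    (fun f hf => (hreg f f.continuous.continuousOn).2.2 (fun z _ => hf z) _ (hsol f) x hxc)
  have hΛ : ∀ (f : C_c(X, ℝ)) (f' h : X → ℝ), EqOn f' f (frontier U) →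
      IsDirichletSolution 𝒱 H U f' h → Λ f = h x := huniq
  set μ := RealRMK.rieszMeasure Λ with hμ
  have hfr : μ (frontier U)ᶜ = 0 := by
    rw [isClosed_frontier.isOpen_compl.measure_eq_iSup_isCompact]
    simp only [ENNReal.iSup_eq_zero]
    intro L hL hLc
    obtain ⟨f, hf1, hf0, hfc, hf01⟩ := exists_continuous_one_zero_of_isCompact hLc
      (isClosed_frontier (s := U)) (disjoint_left.2 fun y hy => hL hy)
    have h1 := RealRMK.rieszMeasure_le_of_eq_one Λ (f := ⟨f, hfc⟩) (fun y => (hf01 y).1) hLc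
      (fun y hy => hf1 hy)
    rw [hΛ ⟨f, hfc⟩ (fun _ => 0) (fun _ => 0) (fun y hy => (hf0 hy).symm)
      ⟨continuousOn_const, isHarmonicOn_const hH 0, fun _ _ => rfl⟩] at h1
    simpa using h1
  have hfrc : IsCompact (frontier U) :=
    hUc.of_isClosed_subset isClosed_frontier frontier_subset_closure
  have hfin : IsFiniteMeasure μ := by
    refine ⟨?_⟩
    rw [← measure_add_measure_compl (isClosed_frontier (s := U)).measurableSet, hfr, add_zero]
    exact hfrc.measure_lt_top
  have hae : ∀ᵐ y ∂μ, y ∈ frontier U := hfr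
  have hintg : ∀ f h : X → ℝ, Continuous f → IsDirichletSolution 𝒱 H U f h →
      ∫ y, f y ∂μ = h x := by
    intro f h hf hh
    obtain ⟨φ, hφ1, -, hφc, -⟩ := exists_continuous_one_zero_of_isCompact hfrc isClosed_empty
      (disjoint_empty _)
    let fc : C_c(X, ℝ) := ⟨⟨fun y => f y * φ y, hf.mul φ.continuous⟩, hφc.mul_left⟩
    have hfc : EqOn f fc (frontier U) := fun y hy => by
      change f y = f y * φ y
      rw [hφ1 hy, Pi.one_apply, mul_one]
    rw [← hΛ fc f h hfc hh, ← RealRMK.integral_rieszMeasure]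
    refine integral_congr_ae ?_
    filter_upwards [hae] with y hy using hfc hy
  refine ⟨μ, ⟨?_⟩, hfr, hintg⟩
  have h1 := hintg (fun _ => 1) (fun _ => 1) continuous_const
    ⟨continuousOn_const, isHarmonicOn_const hH 1, fun _ _ => rfl⟩
  simp only [integral_const, smul_eq_mul, mul_one, Measure.real] at h1
  rw [← ENNReal.ofReal_toReal (measure_ne_top μ univ), h1, ENNReal.ofReal_one]

/-- Closed sets form a generating π-system and their indicators are pointwise limits of continuous
functions, so testing against continuous functions suffices. -/
lemma measurable_of_measurable_integral {T : X → Measure X} (hT : ∀ x, IsProbabilityMeasure (T x))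
    (h : ∀ f : X → ℝ, Continuous f → Measurable fun x => ∫ y, f y ∂(T x)) : Measurable T := by
  refine Measurable.measure_of_isPiSystem_of_isProbabilityMeasure
    (BorelSpace.measurable_eq.trans borel_eq_generateFrom_isClosed) isPiSystem_isClosed ?_
  intro Z hZ
  replace hZ : IsClosed Z := hZ
  refine measurable_of_tendsto_metrizable (f := fun n x => ∫⁻ y, (hZ.apprSeq n y : ℝ≥0∞) ∂(T x))
    (fun n => ?_) (tendsto_pi_nhds.2 fun x =>
      HasOuterApproxClosed.tendsto_lintegral_apprSeq hZ (T x))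
  have hc : Continuous fun y => (hZ.apprSeq n y : ℝ) := by fun_prop
  have : (fun x => ∫⁻ y, (hZ.apprSeq n y : ℝ≥0∞) ∂(T x)) =
      fun x => ENNReal.ofReal (∫ y, (hZ.apprSeq n y : ℝ) ∂(T x)) := by
    ext x
    rw [ofReal_integral_eq_lintegral_ofReal]
    · simp
    · exact integrable_of_measurable_of_abs_le (C := 1) hc.measurable fun y => by
        simpa using HasOuterApproxClosed.apprSeq_apply_le_one hZ n y
    · exact ae_of_all _ fun y => by simp
  rw [this]
  exact (h _ hc).ennreal_ofReal

open Classical in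
/-- A regular set has a harmonic kernel. -/
theorem IsRegular.exists_isHarmonicKernel (hH : IsNormalBauerFamily 𝒱 H) (hU : IsRegular 𝒱 H U) :
    ∃ T, IsHarmonicKernel 𝒱 H U T := by
  have hex : ∀ x, ∃ μ : Measure X, IsProbabilityMeasure μ ∧ (x ∈ U → μ (frontier U)ᶜ = 0 ∧
      ∀ f h : X → ℝ, Continuous f → IsDirichletSolution 𝒱 H U f h → ∫ y, f y ∂μ = h x) ∧
      (x ∉ U → μ = Measure.dirac x) := by
    intro x
    by_cases hx : x ∈ U
    · obtain ⟨μ, h1, h2, h3⟩ := hU.exists_measure hH hx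
      exact ⟨μ, h1, fun _ => ⟨h2, h3⟩, fun h => (h hx).elim⟩
    · exact ⟨Measure.dirac x, inferInstance, fun h => (hx h).elim, fun _ => rfl⟩
  choose T hTp hTU hTd using hex
  have heq : ∀ f h : X → ℝ, Continuous f → IsDirichletSolution 𝒱 H U f h →
      (fun x => ∫ y, f y ∂(T x)) = U.piecewise h f := by
    intro f h hf hh
    ext x
    by_cases hx : x ∈ U
    · rw [piecewise_eq_of_mem _ _ _ hx]
      exact (hTU x hx).2 f h hf hh
    · rw [piecewise_eq_of_notMem _ _ _ hx, hTd x hx, integral_dirac]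
  have hm : Measurable T := by
    refine measurable_of_measurable_integral hTp fun f hf => ?_
    obtain ⟨h, hh⟩ := (hU.2.2 f hf.continuousOn).1
    rw [heq f h hf hh]
    exact hh.2.1.1.measurable_piecewise hf.continuousOn hU.1.measurableSet
  refine ⟨⟨T, hm⟩, ⟨fun x hx => (hTU x hx).1, hTd⟩, fun f hf => ?_⟩
  obtain ⟨h, hh⟩ := (hU.2.2 f hf.continuousOn).1
  refine hh.congr_left hH fun x hx => ?_
  change (fun x => ∫ y, f y ∂(T x)) x = h x
  rw [heq f h hf hh]
  by_cases hxU : x ∈ U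
  · rw [piecewise_eq_of_mem _ _ _ hxU]
  · rw [piecewise_eq_of_notMem _ _ _ hxU, hh.2.2]
    rw [hU.1.frontier_eq]
    exact ⟨hx, hxU⟩

lemma IsRegular.isHarmonicKernel_harmonicKernel (hH : IsNormalBauerFamily 𝒱 H)
    (hU : IsRegular 𝒱 H U) : IsHarmonicKernel 𝒱 H U (harmonicKernel 𝒱 H U) := by
  have h := hU.exists_isHarmonicKernel hH
  rw [harmonicKernel, dif_pos h]
  exact h.choose_spec

end Riesz

end

section

/-! ### Composition and strong Feller property of harmonic kernels -/

section HarmonicKernel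

variable {X : Type*} [TopologicalSpace X] [T2Space X] [LocallyCompactSpace X]
  [SecondCountableTopology X] [MeasurableSpace X] [BorelSpace X]
  {𝒱 : Set (Set X)} {H : Set X → Kernel X X} {U U' P : Set X}

lemma IsRegular.integral_eq (hH : IsNormalBauerFamily 𝒱 H) (hU : IsRegular 𝒱 H U) {f h : X → ℝ}
    (hf : Continuous f) (hh : IsDirichletSolution 𝒱 H U f h) {x : X} (hx : x ∈ closure U) :
    ∫ y, f y ∂(harmonicKernel 𝒱 H U x) = h x :=
  (hU.2.2 f hf.continuousOn).2.1 _ _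
    ((hU.isHarmonicKernel_harmonicKernel hH).2 f hf) hh hx

lemma IsRegular.eq_dirac (hH : IsNormalBauerFamily 𝒱 H) (hU : IsRegular 𝒱 H U) {x : X}
    (hx : x ∉ U) : harmonicKernel 𝒱 H U x = Measure.dirac x :=
  (hU.isHarmonicKernel_harmonicKernel hH).1.2 x hx

lemma IsRegular.ae_mem_frontier (hH : IsNormalBauerFamily 𝒱 H) (hU : IsRegular 𝒱 H U) {x : X}
    (hx : x ∈ U) : ∀ᵐ y ∂(harmonicKernel 𝒱 H U x), y ∈ frontier U :=
  (hU.isHarmonicKernel_harmonicKernel hH).1.1 x hx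

lemma IsRegular.isMarkovKernel (hH : IsNormalBauerFamily 𝒱 H) (hU : IsRegular 𝒱 H U) :
    IsMarkovKernel (harmonicKernel 𝒱 H U) := by
  refine ⟨fun x => ?_⟩
  by_cases hx : x ∈ U
  · have h1 := hU.integral_eq hH (f := fun _ => 1) (h := fun _ => 1) continuous_const
      ⟨continuousOn_const, isHarmonicOn_const hH 1, fun _ _ => rfl⟩ (subset_closure hx)
    simp only [integral_const, smul_eq_mul, mul_one] at h1
    exact isProbabilityMeasure_iff_real.2 h1
  · rw [hU.eq_dirac hH hx]
    infer_instance

lemma IsRegular.continuous_integral (hH : IsNormalBauerFamily 𝒱 H) (hU : IsRegular 𝒱 H U)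
    {f : X → ℝ} (hf : Continuous f) : Continuous fun x => ∫ y, f y ∂(harmonicKernel 𝒱 H U x) := by
  have h1 := ((hU.isHarmonicKernel_harmonicKernel hH).2 f hf).1
  have h2 : ContinuousOn (fun x => ∫ y, f y ∂(harmonicKernel 𝒱 H U x)) Uᶜ := by
    refine hf.continuousOn.congr fun x hx => ?_
    simp only [hU.eq_dirac hH hx, integral_dirac]
  have h3 := h1.union_of_isClosed h2 isClosed_closure hU.1.isClosed_compl
  have huniv : closure U ∪ Uᶜ = univ :=
    eq_univ_of_forall fun x => (em (x ∈ U)).imp (fun h => subset_closure h) id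
  rwa [huniv, continuousOn_univ] at h3

lemma kernel_ext_of_integral_eq {Y : Type*} [MeasurableSpace Y] {κ η : Kernel Y X}
    [IsMarkovKernel κ] [IsMarkovKernel η]
    (h : ∀ (f : X → ℝ) (C : ℝ), Continuous f → (∀ x, |f x| ≤ C) →
      ∀ x, ∫ y, f y ∂(κ x) = ∫ y, f y ∂(η x)) : κ = η := by
  ext1 x
  refine ext_of_forall_integral_eq_of_IsFiniteMeasure fun f => ?_
  exact h f ‖f‖ f.continuous (fun x => f.norm_coe_le_norm x) x

/-- Since `closure V ⊆ U` is not assumed, harmonicity on `U` does not apply to `V` directly; it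
applies to small sets inside `V`, and the local-to-global principle does the rest. -/
lemma IsRegular.comp_kernel_eq (hH : IsNormalBauerFamily 𝒱 H) (hP : IsPSet 𝒱 H P) (hUP : U ⊆ P)
    (hU : IsRegular 𝒱 H U) {V : Set X} (hV : V ∈ 𝒱) (hVU : V ⊆ U) :
    harmonicKernel 𝒱 H U ∘ₖ H V = harmonicKernel 𝒱 H U := by
  have := hU.isMarkovKernel hH
  have := hH.isMarkovKernel hV
  refine kernel_ext_of_integral_eq fun f C hf hC x => ?_
  rw [integral_comp_kernel_of_abs_le _ _ hf.measurable hC]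
  refine hP.integral_eq_of_local hH hV (hVU.trans hUP) (hU.continuous_integral hH hf)
    (fun x => abs_integral_le_of_abs_le hC) (fun y hy N hN => ?_) x
  obtain ⟨W, hW, hyW, hWN⟩ := hH.exists_closure_subset
    (inter_mem hN ((hH.isOpen hV).mem_nhds hy))
  exact ⟨W, hW, hyW, fun q hq => (hWN hq).1,
    ((hU.isHarmonicKernel_harmonicKernel hH).2 f hf).2.1.2 W hW (fun q hq => hVU (hWN hq).2) y hyW⟩

/-- `H_U f` is continuous on `X` and harmonic on `U'`, so it solves the Dirichlet problem on `U'`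
with itself as boundary data; uniqueness identifies it with `H_{U'} (H_U f)`. -/
lemma IsRegular.comp_harmonicKernel_eq (hH : IsNormalBauerFamily 𝒱 H)
    (hU : IsRegular 𝒱 H U) (hU' : IsRegular 𝒱 H U') (hUU : U' ⊆ U) :
    harmonicKernel 𝒱 H U ∘ₖ harmonicKernel 𝒱 H U' = harmonicKernel 𝒱 H U := by
  have := hU.isMarkovKernel hH
  have := hU'.isMarkovKernel hH
  refine kernel_ext_of_integral_eq fun f C hf hC x => ?_
  rw [integral_comp_kernel_of_abs_le _ _ hf.measurable hC]
  by_cases hx : x ∈ U'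
  · have hc := hU.continuous_integral hH hf
    exact hU'.integral_eq hH hc ⟨hc.continuousOn,
      ((hU.isHarmonicKernel_harmonicKernel hH).2 f hf).2.1.mono hUU, fun _ _ => rfl⟩
      (subset_closure hx)
  · rw [hU'.eq_dirac hH hx, integral_dirac]

/-- Strong Feller property: near a point `H_U f = H_V (H_U f)` for a member `V` of the family, and
`H_V` has this property by assumption. -/
lemma IsRegular.continuousOn_integral (hH : IsNormalBauerFamily 𝒱 H) (hP : IsPSet 𝒱 H P)
    (hUP : U ⊆ P) (hU : IsRegular 𝒱 H U) {f : X → ℝ} (hf : Measurable f) {C : ℝ}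
    (hC : ∀ x, |f x| ≤ C) : ContinuousOn (fun x => ∫ y, f y ∂(harmonicKernel 𝒱 H U x)) U := by
  have := hU.isMarkovKernel hH
  intro x hx
  obtain ⟨V, hV, hxV, hVU⟩ := hH.exists_closure_subset (hU.1.mem_nhds hx)
  have := hH.isMarkovKernel hV
  have heq : ∀ y, ∫ z, f z ∂(harmonicKernel 𝒱 H U y) =
      ∫ t, ∫ z, f z ∂(harmonicKernel 𝒱 H U t) ∂(H V y) := fun y => by
    rw [← integral_comp_kernel_of_abs_le _ _ hf hC,
      hU.comp_kernel_eq hH hP hUP hV (subset_closure.trans hVU)]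
  have h1 := hH.continuousOn_integral V hV (fun t => ∫ z, f z ∂(harmonicKernel 𝒱 H U t))
    (measurable_integral_kernel _ hf) ⟨C, fun t => abs_integral_le_of_abs_le hC⟩
  have h2 := h1.continuousAt ((hH.isOpen hV).mem_nhds hxV)
  simp only [← heq] at h2
  exact h2.continuousWithinAt

end HarmonicKernel

/-! ### Annuli around `K` and their harmonic measures -/

section Annulus

variable {X : Type*} [TopologicalSpace X] [T2Space X] [LocallyCompactSpace X]
  [SecondCountableTopology X] [MeasurableSpace X] [BorelSpace X]

/-- `g` is a continuous function on a neighborhood `O` of the compact `K` in a `𝒫`-set, which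
vanishes on `K`, is harmonic and strictly positive on `O \ K`, and has compact sublevel sets
`{g ≤ r}`, `r < R`. -/
structure IsAnnular (𝒱 : Set (Set X)) (H : Set X → Kernel X X) (K O : Set X) (g : X → ℝ)
    (R : ℝ) : Prop where
  exists_isPSet : ∃ P, IsPSet 𝒱 H P ∧ O ⊆ P
  isOpen : IsOpen O
  isCompact : IsCompact K
  subset : K ⊆ O
  continuousOn : ContinuousOn g O
  eq_zero : ∀ x ∈ K, g x = 0
  pos : ∀ x ∈ O \ K, 0 < g x
  isHarmonicOn : IsHarmonicOn 𝒱 H g (O \ K)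
  isCompact_le : ∀ r < R, IsCompact {x ∈ O | g x ≤ r}

/-- The open set `{g < r}` in `O \ K`. -/
def annulus (O K : Set X) (g : X → ℝ) (r : ℝ) : Set X := {x ∈ O \ K | g x < r}

/-- The level set `{g = r}` in `O \ K`. -/
def level (O K : Set X) (g : X → ℝ) (r : ℝ) : Set X := {x ∈ O \ K | g x = r}

variable {𝒱 : Set (Set X)} {H : Set X → Kernel X X} {K O : Set X} {g : X → ℝ} {R : ℝ}

namespace IsAnnular

lemma isOpen_diff (ha : IsAnnular 𝒱 H K O g R) : IsOpen (O \ K) :=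
  ha.isOpen.sdiff ha.isCompact.isClosed

lemma isOpen_annulus (ha : IsAnnular 𝒱 H K O g R) (r : ℝ) : IsOpen (annulus O K g r) :=
  (ha.continuousOn.mono sdiff_subset).isOpen_inter_preimage ha.isOpen_diff isOpen_Iio

lemma closure_annulus_subset (ha : IsAnnular 𝒱 H K O g R) {r : ℝ} (hr : r < R) :
    closure (annulus O K g r) ⊆ {x ∈ O | g x ≤ r} :=
  closure_minimal (fun _ hx => ⟨hx.1.1, hx.2.le⟩) (ha.isCompact_le r hr).isClosed

lemma isCompact_closure_annulus (ha : IsAnnular 𝒱 H K O g R) {r : ℝ} (hr : r < R) :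
    IsCompact (closure (annulus O K g r)) :=
  (ha.isCompact_le r hr).of_isClosed_subset isClosed_closure (ha.closure_annulus_subset hr)

lemma frontier_annulus_subset (ha : IsAnnular 𝒱 H K O g R) {r : ℝ} (hr : r < R) :
    frontier (annulus O K g r) ⊆ K ∪ level O K g r := by
  intro x hx
  rw [(ha.isOpen_annulus r).frontier_eq] at hx
  have h1 := ha.closure_annulus_subset hr hx.1
  by_cases hxK : x ∈ K
  · exact Or.inl hxK
  · refine Or.inr ⟨⟨h1.1, hxK⟩, le_antisymm h1.2 ?_⟩
    by_contra! h
    exact hx.2 ⟨⟨h1.1, hxK⟩, h⟩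

lemma isCompact_level (ha : IsAnnular 𝒱 H K O g R) {r : ℝ} (hr0 : 0 < r) (hr : r < R) :
    IsCompact (level O K g r) := by
  have hL := ha.isCompact_le r hr
  have h1 : IsClosed ({x ∈ O | g x ≤ r} ∩ g ⁻¹' {r}) :=
    (ha.continuousOn.mono fun x hx => hx.1).preimage_isClosed_of_isClosed hL.isClosed
      isClosed_singleton
  have h2 : level O K g r = {x ∈ O | g x ≤ r} ∩ g ⁻¹' {r} := by
    ext x
    constructor
    · exact fun hx => ⟨⟨hx.1.1, hx.2.le⟩, hx.2⟩
    · rintro ⟨hx, hgx⟩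
      have hgx : g x = r := hgx
      refine ⟨⟨hx.1, fun hxK => ?_⟩, hgx⟩
      rw [ha.eq_zero x hxK] at hgx
      exact hr0.ne hgx
  rw [h2]
  exact hL.of_isClosed_subset h1 inter_subset_left

/-- The barriers are `g` at boundary points in `K` and `r - g` at boundary points in the level set.
-/
lemma isRegular_annulus (hH : IsNormalBauerFamily 𝒱 H) (ha : IsAnnular 𝒱 H K O g R) {r : ℝ}
    (hr : r < R) : IsRegular 𝒱 H (annulus O K g r) := by
  obtain ⟨P, hP, hOP⟩ := ha.exists_isPSet
  refine hP.isRegular hH (ha.isOpen_annulus r) (fun x hx => hOP hx.1.1)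
    (ha.isCompact_closure_annulus hr) fun z hz => ?_
  have hzO := (ha.closure_annulus_subset hr (frontier_subset_closure hz)).1
  have hlim : Tendsto g (𝓝[annulus O K g r] z) (𝓝 (g z)) :=
    (ha.continuousOn z hzO).mono fun x hx => hx.1.1
  have hharm : IsHarmonicOn 𝒱 H g (annulus O K g r) := ha.isHarmonicOn.mono fun x hx => hx.1
  rcases ha.frontier_annulus_subset hr hz with hzK | hzS
  · refine ⟨g, hharm, fun x hx => ha.pos x hx.1, ?_⟩
    rwa [ha.eq_zero z hzK] at hlim
  · refine ⟨fun x => r - g x, (isHarmonicOn_const hH r).sub hH hharm,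
      fun x hx => sub_pos.2 hx.2, ?_⟩
    have := hlim.const_sub r
    rwa [hzS.2, sub_self] at this

/-- The function `g / r` solves the Dirichlet problem on the annulus with boundary values `0` on `K`
and `1` on the level set. -/
lemma measure_level (hH : IsNormalBauerFamily 𝒱 H) (ha : IsAnnular 𝒱 H K O g R) {r : ℝ}
    (hr0 : 0 < r) (hr : r < R) {x : X} (hx : x ∈ annulus O K g r) :
    harmonicKernel 𝒱 H (annulus O K g r) x (level O K g r) = ENNReal.ofReal (g x / r) := by
  have hreg := ha.isRegular_annulus hH hr
  have := hreg.isMarkovKernel hH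
  have hS := ha.isCompact_level hr0 hr
  obtain ⟨φ, hφ0, hφ1, hφ01⟩ := exists_continuous_zero_one_of_isClosed ha.isCompact.isClosed
    hS.isClosed (disjoint_left.2 fun y hyK hyS => hyS.1.2 hyK)
  have hsol : IsDirichletSolution 𝒱 H (annulus O K g r) φ fun y => r⁻¹ * g y := by
    refine ⟨(ha.continuousOn.mono fun y hy => (ha.closure_annulus_subset hr hy).1).const_mul _,
      (ha.isHarmonicOn.mono fun y hy => hy.1).const_mul _, fun y hy => ?_⟩
    rcases ha.frontier_annulus_subset hr hy with h | h
    · simp [hφ0 h, ha.eq_zero y h]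
    · simp only [hφ1 h, h.2, Pi.one_apply]
      field_simp
  have h1 := hreg.integral_eq hH φ.continuous hsol (subset_closure hx)
  have h2 : ∫ y, φ y ∂(harmonicKernel 𝒱 H (annulus O K g r) x) =
      (harmonicKernel 𝒱 H (annulus O K g r) x).real (level O K g r) := by
    rw [← integral_indicator_one hS.measurableSet]
    refine integral_congr_ae ?_
    filter_upwards [hreg.ae_mem_frontier hH hx] with y hy
    rcases ha.frontier_annulus_subset hr hy with h | h
    · rw [hφ0 h, indicator_of_notMem fun h' => h'.1.2 h, Pi.zero_apply]
    · rw [hφ1 h, indicator_of_mem h]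
  rw [← ENNReal.ofReal_toReal (measure_ne_top _ (level O K g r)), ← Measure.real, ← h2, h1]
  congr 1
  field_simp

end IsAnnular

end Annulus

end

section

/-! ### Normalized sweeping between level sets and the convergent subsequence -/

section Sweeping

variable {X : Type*} [TopologicalSpace X] [T2Space X] [LocallyCompactSpace X]
  [SecondCountableTopology X] [MeasurableSpace X] [BorelSpace X]
  {𝒱 : Set (Set X)} {H : Set X → Kernel X X} {K O : Set X} {g : X → ℝ} {R : ℝ}

lemma integral_bind_of_abs_le {Y Z : Type*} [MeasurableSpace Y] [MeasurableSpace Z]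
    (μ : Measure Y) [IsProbabilityMeasure μ] (κ : Kernel Y Z) [IsMarkovKernel κ] {f : Z → ℝ}
    (hf : Measurable f) {C : ℝ} (hC : ∀ x, |f x| ≤ C) :
    ∫ z, f z ∂(μ.bind κ) = ∫ y, ∫ z, f z ∂(κ y) ∂μ := by
  have := integral_comp_kernel_of_abs_le κ (Kernel.const Unit μ) hf hC ()
  simpa [Kernel.comp_apply] using this

variable (𝒱 H K O g) in
/-- The normalized swept measure `(t/r) (μ H_{A_t})|_{S_t}` of a measure `μ` on `S_r`. -/
def sweepMeasure (r t : ℝ) (μ : Measure X) : Measure X :=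
  ENNReal.ofReal (t / r) •
    (μ.bind (harmonicKernel 𝒱 H (annulus O K g t))).restrict (level O K g t)

open Classical in
variable (𝒱 H K O g) in
/-- The probability measure `(t/r) (μ H_{A_t})|_{S_t}` (and `μ` if this is not a probability). -/
def sweep (r t : ℝ) (μ : ProbabilityMeasure X) : ProbabilityMeasure X :=
  if h : IsProbabilityMeasure (sweepMeasure 𝒱 H K O g r t μ) then ⟨_, h⟩ else μ

namespace IsAnnular

variable {r s t : ℝ}

lemma level_subset_annulus (hrt : r < t) : level O K g r ⊆ annulus O K g t :=
  fun _ hx => ⟨hx.1, hx.2.trans_lt hrt⟩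

/-- Every point of `S_r` sends exactly the mass `r / t` to `S_t`, which the factor `t / r`
compensates. -/
lemma isProbabilityMeasure_sweepMeasure (hH : IsNormalBauerFamily 𝒱 H)
    (ha : IsAnnular 𝒱 H K O g R) (hr : 0 < r) (hrt : r < t) (htR : t < R) {μ : Measure X}
    [IsProbabilityMeasure μ] (hμ : μ (level O K g r)ᶜ = 0) :
    IsProbabilityMeasure (sweepMeasure 𝒱 H K O g r t μ) := by
  have ht : 0 < t := hr.trans hrt
  refine ⟨?_⟩
  have hS := (ha.isCompact_level ht htR).measurableSet
  have hae : ∀ᵐ x ∂μ, x ∈ level O K g r := hμ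
  rw [sweepMeasure, Measure.smul_apply, Measure.restrict_apply_univ,
    Measure.bind_apply hS (Kernel.aemeasurable _)]
  have h1 : ∫⁻ x, harmonicKernel 𝒱 H (annulus O K g t) x (level O K g t) ∂μ =
      ∫⁻ _, ENNReal.ofReal (r / t) ∂μ := by
    refine lintegral_congr_ae ?_
    filter_upwards [hae] with x hx
    rw [ha.measure_level hH ht htR (level_subset_annulus hrt hx), hx.2]
  rw [h1, lintegral_const, measure_univ, mul_one, smul_eq_mul,
    ← ENNReal.ofReal_mul (by positivity)]
  rw [show t / r * (r / t) = 1 by field_simp, ENNReal.ofReal_one]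

lemma coe_sweep (hH : IsNormalBauerFamily 𝒱 H)
    (ha : IsAnnular 𝒱 H K O g R) (hr : 0 < r) (hrt : r < t) (htR : t < R) {μ : ProbabilityMeasure X}
    (hμ : (μ : Measure X) (level O K g r)ᶜ = 0) :
    (sweep 𝒱 H K O g r t μ : Measure X) = sweepMeasure 𝒱 H K O g r t μ := by
  have h := ha.isProbabilityMeasure_sweepMeasure hH hr hrt htR hμ
  have heq : sweep 𝒱 H K O g r t μ = ⟨_, h⟩ := dif_pos h
  rw [heq]
  rfl

lemma sweep_compl_level (hH : IsNormalBauerFamily 𝒱 H)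
    (ha : IsAnnular 𝒱 H K O g R) (hr : 0 < r) (hrt : r < t) (htR : t < R) {μ : ProbabilityMeasure X}
    (hμ : (μ : Measure X) (level O K g r)ᶜ = 0) :
    (sweep 𝒱 H K O g r t μ : Measure X) (level O K g t)ᶜ = 0 := by
  have hS := (ha.isCompact_level (hr.trans hrt) htR).measurableSet
  rw [ha.coe_sweep hH hr hrt htR hμ, sweepMeasure, Measure.smul_apply,
    Measure.restrict_apply hS.compl, compl_inter_self, measure_empty, smul_zero]

/-- Mass stopped in `K` at the first stage never contributes on `S_t`, since `H_{A_t}` is Dirac on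
`K`. Hence the intermediate restriction to `S_r` loses nothing, and `H_{A_r} H_{A_t} = H_{A_t}`
applies. -/
lemma sweep_sweep (hH : IsNormalBauerFamily 𝒱 H) (ha : IsAnnular 𝒱 H K O g R) (hs : 0 < s)
    (hsr : s < r) (hrt : r < t) (htR : t < R) {μ : ProbabilityMeasure X}
    (hμ : (μ : Measure X) (level O K g s)ᶜ = 0) :
    sweep 𝒱 H K O g r t (sweep 𝒱 H K O g s r μ) = sweep 𝒱 H K O g s t μ := by
  have hr : 0 < r := hs.trans hsr
  have ht : 0 < t := hr.trans hrt
  have hrR : r < R := hrt.trans htR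
  apply Subtype.ext
  have h1 := ha.coe_sweep hH hs hsr hrR hμ
  have h2 := ha.sweep_compl_level hH hs hsr hrR hμ
  have h3 := ha.coe_sweep hH hs (hsr.trans hrt) htR hμ
  have h4 := ha.coe_sweep hH hr hrt htR h2
  change ((sweep 𝒱 H K O g r t (sweep 𝒱 H K O g s r μ) : ProbabilityMeasure X) : Measure X) =
    (sweep 𝒱 H K O g s t μ : ProbabilityMeasure X)
  rw [h3, h4, h1]
  have hregr := ha.isRegular_annulus hH hrR
  have hregt := ha.isRegular_annulus hH htR
  have hSr := (ha.isCompact_level hr hrR).measurableSet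
  have hSt := (ha.isCompact_level ht htR).measurableSet
  have hμs : ∀ᵐ x ∂(μ : Measure X), x ∈ level O K g s := hμ
  set Tr := harmonicKernel 𝒱 H (annulus O K g r) with hTr
  set Tt := harmonicKernel 𝒱 H (annulus O K g t) with hTt
  have hcomp : Tt ∘ₖ Tr = Tt :=
    hregt.comp_harmonicKernel_eq hH hregr fun x hx => ⟨hx.1, hx.2.trans hrt⟩
  ext B hB
  simp only [sweepMeasure, ← hTr, ← hTt]
  rw [Measure.smul_apply, Measure.smul_apply, Measure.restrict_apply hB, Measure.restrict_apply hB,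
    Measure.bind_apply (hB.inter hSt) (Kernel.aemeasurable _),
    Measure.bind_apply (hB.inter hSt) (Kernel.aemeasurable _), lintegral_smul_measure]
  have hae : ∀ᵐ y ∂((μ : Measure X).bind Tr), y ∈ K ∪ level O K g r := by
    have hmeas : MeasurableSet (K ∪ level O K g r) := ha.isCompact.measurableSet.union hSr
    rw [ae_iff]
    change ((μ : Measure X).bind Tr) (K ∪ level O K g r)ᶜ = 0
    rw [Measure.bind_apply hmeas.compl (Kernel.aemeasurable _), lintegral_eq_zero_iff
      (Kernel.measurable_coe _ hmeas.compl)]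
    filter_upwards [hμs] with x hx
    exact measure_mono_null (compl_subset_compl.2 (ha.frontier_annulus_subset hrR))
      (hregr.ae_mem_frontier hH (level_subset_annulus hsr hx))
  have h5 : ∫⁻ y in level O K g r, Tt y (B ∩ level O K g t) ∂((μ : Measure X).bind Tr) =
      ∫⁻ y, Tt y (B ∩ level O K g t) ∂((μ : Measure X).bind Tr) := by
    rw [← lintegral_indicator hSr]
    refine lintegral_congr_ae ?_
    filter_upwards [hae] with y hy
    by_cases hyS : y ∈ level O K g r
    · rw [indicator_of_mem hyS]
    · rw [indicator_of_notMem hyS]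
      have hyK : y ∈ K := hy.resolve_right hyS
      rw [hTt, hregt.eq_dirac hH fun h => h.1.2 hyK, Measure.dirac_apply' _ (hB.inter hSt),
        indicator_of_notMem fun h => h.2.1.2 hyK]
  have h6 : ∫⁻ y, Tt y (B ∩ level O K g t) ∂((μ : Measure X).bind Tr) =
      ∫⁻ x, Tt x (B ∩ level O K g t) ∂(μ : Measure X) := by
    rw [Measure.lintegral_bind (Kernel.aemeasurable _)
      (Kernel.measurable_coe _ (hB.inter hSt)).aemeasurable]
    refine lintegral_congr fun x => ?_
    rw [← Kernel.comp_apply' _ _ _ (hB.inter hSt), hcomp]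
  rw [h5, h6, smul_eq_mul, smul_eq_mul, smul_eq_mul, ← mul_assoc,
    ← ENNReal.ofReal_mul (by positivity)]
  congr 2
  field_simp

lemma integral_sweep (hH : IsNormalBauerFamily 𝒱 H) (ha : IsAnnular 𝒱 H K O g R) (hr : 0 < r)
    (hrt : r < t) (htR : t < R) {μ : ProbabilityMeasure X}
    (hμ : (μ : Measure X) (level O K g r)ᶜ = 0) {f : X → ℝ} (hf : Measurable f) {C : ℝ}
    (hC : ∀ x, |f x| ≤ C) :
    ∫ x, f x ∂(sweep 𝒱 H K O g r t μ : Measure X) = t / r * ∫ x, ∫ y, (level O K g t).indicator f y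
      ∂(harmonicKernel 𝒱 H (annulus O K g t) x) ∂(μ : Measure X) := by
  have ht : 0 < t := hr.trans hrt
  have hSt := (ha.isCompact_level ht htR).measurableSet
  have := (ha.isRegular_annulus hH htR).isMarkovKernel hH
  rw [ha.coe_sweep hH hr hrt htR hμ, sweepMeasure, integral_smul_measure,
    ENNReal.toReal_ofReal (by positivity), smul_eq_mul, ← integral_indicator hSt,
    integral_bind_of_abs_le _ _ (hf.indicator hSt) (C := C)]
  intro x
  by_cases hx : x ∈ level O K g t
  · rw [indicator_of_mem hx]; exact hC x
  · rw [indicator_of_notMem hx, abs_zero]; exact (abs_nonneg _).trans (hC x)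

/-- The function `H_{A_t} (1_{S_t} f)` need not be continuous on `X`, but by the strong Feller
property it is continuous on `A_t`, which contains the compact `S_r`; there a bounded continuous
function can replace it. -/
lemma tendsto_sweep (hH : IsNormalBauerFamily 𝒱 H) (ha : IsAnnular 𝒱 H K O g R) (hr : 0 < r)
    (hrt : r < t) (htR : t < R) {μ : ℕ → ProbabilityMeasure X} {μ₀ : ProbabilityMeasure X}
    (hμ : ∀ᶠ k in atTop, (μ k : Measure X) (level O K g r)ᶜ = 0)
    (hμ₀ : (μ₀ : Measure X) (level O K g r)ᶜ = 0) (hlim : Tendsto μ atTop (𝓝 μ₀)) :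
    Tendsto (fun k => sweep 𝒱 H K O g r t (μ k)) atTop (𝓝 (sweep 𝒱 H K O g r t μ₀)) := by
  obtain ⟨P, hP, hOP⟩ := ha.exists_isPSet
  have ht : 0 < t := hr.trans hrt
  have hSt := (ha.isCompact_level ht htR).measurableSet
  have hreg := ha.isRegular_annulus hH htR
  have := hreg.isMarkovKernel hH
  rw [ProbabilityMeasure.tendsto_iff_forall_integral_tendsto]
  intro f
  have hfC : ∀ x, |f x| ≤ ‖f‖ := fun x => f.norm_coe_le_norm x
  have hfC' : ∀ x, |(level O K g t).indicator f x| ≤ ‖f‖ := fun x => by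
    by_cases hx : x ∈ level O K g t
    · rw [indicator_of_mem hx]; exact hfC x
    · rw [indicator_of_notMem hx, abs_zero]; exact norm_nonneg f
  have hcont := hreg.continuousOn_integral hH hP (fun x hx => hOP hx.1.1)
    (f.continuous.measurable.indicator hSt) hfC'
  obtain ⟨F, C, hF, hFC, hFeq⟩ := exists_continuous_eqOn_of_isCompact
    (ha.isCompact_level hr (hrt.trans htR)) (hcont.mono (level_subset_annulus hrt))
  have key : ∀ ν : ProbabilityMeasure X, (ν : Measure X) (level O K g r)ᶜ = 0 →
      ∫ x, f x ∂(sweep 𝒱 H K O g r t ν : Measure X) = t / r * ∫ x, F x ∂(ν : Measure X) := by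
    intro ν hν
    rw [ha.integral_sweep hH hr hrt htR hν f.continuous.measurable hfC]
    congr 1
    refine integral_congr_ae ?_
    have hae : ∀ᵐ x ∂(ν : Measure X), x ∈ level O K g r := hν
    filter_upwards [hae] with x hx using (hFeq hx).symm
  rw [key μ₀ hμ₀]
  let Fb : BoundedContinuousFunction X ℝ :=
    BoundedContinuousFunction.ofNormedAddCommGroup F hF C hFC
  have h1 := (ProbabilityMeasure.tendsto_iff_forall_integral_tendsto.1 hlim Fb).const_mul (t / r)
  refine h1.congr' ?_
  filter_upwards [hμ] with k hk
  exact (key (μ k) hk).symm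

/-- Prokhorov's theorem, with the same compact set for every tolerance. -/
lemma isCompact_setOf_compl_level (ha : IsAnnular 𝒱 H K O g R) (hr : 0 < r) (hrR : r < R) :
    IsCompact {μ : ProbabilityMeasure X | (μ : Measure X) (level O K g r)ᶜ = 0} := by
  have h := isCompact_setOfPred_probabilityMeasure_mass_eq_compl_isCompact_le (E := X)
    (u := fun _ => 0) (K := fun _ => level O K g r) tendsto_const_nhds
    (fun _ => ha.isCompact_level hr hrR) (Or.inr monotone_const)
  convert h using 2
  simp

/-- Every sequence of probability measures on the level sets `S_{η n}`, `η n → 0`, has a subsequence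
whose normalized swept measures converge on all level sets, with compatible limits. -/
theorem exists_tendsto_sweep (hH : IsNormalBauerFamily 𝒱 H) (ha : IsAnnular 𝒱 H K O g R)
    {η : ℕ → ℝ} (hη : ∀ n, η n ∈ Ioo 0 R) (hanti : StrictAnti η) (hη0 : Tendsto η atTop (𝓝 0))
    {ν : ℕ → ProbabilityMeasure X} (hν : ∀ n, (ν n : Measure X) (level O K g (η n))ᶜ = 0) :
    ∃ n : ℕ → ℕ, StrictMono n ∧ ∃ σ : ℝ → ProbabilityMeasure X,
      (∀ r ∈ Ioo 0 R,
        Tendsto (fun k => sweep 𝒱 H K O g (η (n k)) r (ν (n k))) atTop (𝓝 (σ r)) ∧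
        (σ r : Measure X) (level O K g r)ᶜ = 0) ∧
      ∀ r t, 0 < r → r < t → t < R → sweep 𝒱 H K O g r t (σ r) = σ t := by
  -- For `m ≥ n` the level `η m` is not above `η n` and there is nothing to sweep. The default `ν m`
  -- only keeps the sequence in the compact product; for each `m` it concerns finitely many `n`.
  let ρ : ℕ → ℕ → ProbabilityMeasure X := fun n m =>
    if m < n then sweep 𝒱 H K O g (η n) (η m) (ν n) else ν m
  let 𝒞 : ℕ → Set (ProbabilityMeasure X) := fun m =>
    {μ | (μ : Measure X) (level O K g (η m))ᶜ = 0}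
  have h𝒞 : IsCompact (pi univ 𝒞) :=
    isCompact_univ_pi fun m => ha.isCompact_setOf_compl_level (hη m).1 (hη m).2
  have hρ : ∀ n, ρ n ∈ pi univ 𝒞 := by
    intro n m _
    change ((ρ n m : ProbabilityMeasure X) : Measure X) (level O K g (η m))ᶜ = 0
    simp only [ρ]
    split_ifs with h
    · exact ha.sweep_compl_level hH (hη n).1 (hanti h) (hη m).2 (hν n)
    · exact hν m
  obtain ⟨τ, hτ, n, hn, hlim⟩ := h𝒞.tendsto_subseq hρ
  have hτm : ∀ m, (τ m : Measure X) (level O K g (η m))ᶜ = 0 := fun m => hτ m (mem_univ m)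
  have hex : ∀ r : ℝ, 0 < r → ∃ m, η m < r := fun r hr =>
    (hη0.eventually (gt_mem_nhds hr)).exists
  choose! m hm using hex
  -- The limit is known on the level `η (m r) < r`; sweeping it up to `r` defines the limit there.
  let σ : ℝ → ProbabilityMeasure X := fun r => sweep 𝒱 H K O g (η (m r)) r (τ (m r))
  have hσS : ∀ r ∈ Ioo 0 R, (σ r : Measure X) (level O K g r)ᶜ = 0 := fun r hr =>
    ha.sweep_compl_level hH (hη _).1 (hm r hr.1) hr.2 (hτm _)
  have hev : ∀ r, 0 < r → ∀ᶠ k in atTop, η (n k) < r := fun r hr =>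
    (hη0.comp hn.tendsto_atTop).eventually (gt_mem_nhds hr)
  have hconv : ∀ r ∈ Ioo 0 R,
      Tendsto (fun k => sweep 𝒱 H K O g (η (n k)) r (ν (n k))) atTop (𝓝 (σ r)) := by
    intro r hr
    have h1 : Tendsto (fun k => ρ (n k) (m r)) atTop (𝓝 (τ (m r))) :=
      (tendsto_pi_nhds.1 hlim) (m r)
    have h2 := ha.tendsto_sweep hH (hη (m r)).1 (hm r hr.1) hr.2
      (Eventually.of_forall fun k => hρ (n k) (m r) (mem_univ _)) (hτm (m r)) h1
    refine h2.congr' ?_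
    filter_upwards [hn.tendsto_atTop.eventually (eventually_gt_atTop (m r))] with k hk
    simp only [ρ, if_pos hk]
    exact ha.sweep_sweep hH (hη _).1 (hanti hk) (hm r hr.1) hr.2 (hν _)
  refine ⟨n, hn, σ, fun r hr => ⟨hconv r hr, hσS r hr⟩, fun r t hr hrt htR => ?_⟩
  have h1 := ha.tendsto_sweep hH hr hrt htR (μ := fun k => sweep 𝒱 H K O g (η (n k)) r (ν (n k)))
    (by
      filter_upwards [hev r hr] with k hk
      exact ha.sweep_compl_level hH (hη _).1 hk (hrt.trans htR) (hν _))
    (hσS r ⟨hr, hrt.trans htR⟩) (hconv r ⟨hr, hrt.trans htR⟩)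
  refine tendsto_nhds_unique (h1.congr' ?_) (hconv t ⟨hr.trans hrt, htR⟩)
  filter_upwards [hev r hr] with k hk
  exact ha.sweep_sweep hH (hη _).1 hk hrt htR (hν _)

end IsAnnular

end Sweeping

end

section

/-! ### Annular functions from admissible sets and from strong stability -/

section Existence

variable {X : Type*} [TopologicalSpace X] [T2Space X] [LocallyCompactSpace X]
  [SecondCountableTopology X] [MeasurableSpace X] [BorelSpace X]
  {𝒱 : Set (Set X)} {H : Set X → Kernel X X} {K W₀ O : Set X} {g : X → ℝ} {R : ℝ}

lemma IsHarmonicOn.congr (hH : IsNormalBauerFamily 𝒱 H) {U : Set X} {h h' : X → ℝ}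
    (hh : IsHarmonicOn 𝒱 H h U) (heq : EqOn h' h U) : IsHarmonicOn 𝒱 H h' U := by
  refine ⟨hh.1.congr heq, fun V hV hVU x hx => ?_⟩
  rw [heq (hVU (subset_closure hx)), ← hh.2 V hV hVU x hx]
  refine integral_congr_ae ?_
  filter_upwards [hH.ae_mem_frontier hV hx] with y hy
  exact heq (hVU (frontier_subset_closure hy))

/-- As a harmonic measure of a set, `gFun` is not visibly continuous; on `W₀` it agrees with the
integral `G` of a continuous function that is `0` on `K` and `1` on `∂W₀`. As `G = 1` on `∂W₀`,
sublevel sets for `r < 1` do not reach `∂W₀`, hence are compact. -/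
lemma IsAdmissible.isAnnular (hH : IsNormalBauerFamily 𝒱 H) (hK : IsCompact K)
    (hW : IsAdmissible 𝒱 H K W₀) : IsAnnular 𝒱 H K W₀ (gFun 𝒱 H W₀ K) 1 := by
  have hWo : IsOpen W₀ := hW.isRegular.1
  have hreg := hW.isRegular_diff
  have := hreg.isMarkovKernel hH
  have hdisj : Disjoint K (frontier W₀) := disjoint_left.2 fun x hx hxf => by
    rw [hWo.frontier_eq] at hxf
    exact hxf.2 (hW.subset hx)
  obtain ⟨φ, hφ0, hφ1, hφ01⟩ := exists_continuous_zero_one_of_isClosed hK.isClosed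
    isClosed_frontier hdisj
  set G : X → ℝ := fun x => ∫ y, φ y ∂(harmonicKernel 𝒱 H (W₀ \ K) x) with hG
  have hGc : Continuous G := hreg.continuous_integral hH φ.continuous
  have hfr : frontier (W₀ \ K) ⊆ K ∪ frontier W₀ := fun x hx => by
    rw [hreg.1.frontier_eq] at hx
    rw [hWo.frontier_eq]
    by_cases hxK : x ∈ K
    · exact Or.inl hxK
    · exact Or.inr ⟨closure_mono sdiff_subset hx.1, fun h => hx.2 ⟨h, hxK⟩⟩
  have hmeas : MeasurableSet (frontier W₀) := isClosed_frontier.measurableSet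
  have hK0 : ∀ x ∈ K, gFun 𝒱 H W₀ K x = 0 := fun x hx => by
    rw [gFun, hreg.eq_dirac hH fun h => h.2 hx, Measure.real, Measure.dirac_apply' _ hmeas,
      indicator_of_notMem (disjoint_left.1 hdisj hx), ENNReal.toReal_zero]
  have hGK : ∀ x ∈ K, G x = 0 := fun x hx => by
    simp only [hG, hreg.eq_dirac hH fun h => h.2 hx, integral_dirac, hφ0 hx, Pi.zero_apply]
  have hGfr : ∀ x ∈ frontier W₀, G x = 1 := fun x hx => by
    have hxW : x ∉ W₀ := by
      rw [hWo.frontier_eq] at hx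
      exact hx.2
    simp only [hG, hreg.eq_dirac hH fun h => hxW h.1, integral_dirac, hφ1 hx, Pi.one_apply]
  have heqD : ∀ x ∈ W₀ \ K, gFun 𝒱 H W₀ K x = G x := fun x hx => by
    rw [gFun, ← integral_indicator_one hmeas]
    refine integral_congr_ae ?_
    filter_upwards [hreg.ae_mem_frontier hH hx] with y hy
    by_cases hyf : y ∈ frontier W₀
    · rw [indicator_of_mem hyf, hφ1 hyf]
    · rw [indicator_of_notMem hyf, hφ0 ((hfr hy).resolve_right hyf), Pi.zero_apply]
  have heq : EqOn (gFun 𝒱 H W₀ K) G W₀ := fun x hx => by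
    by_cases hxK : x ∈ K
    · rw [hK0 x hxK, hGK x hxK]
    · exact heqD x ⟨hx, hxK⟩
  refine ⟨⟨W₀, hW.isPSet, Subset.rfl⟩, hWo, hK, hW.subset, hGc.continuousOn.congr heq, hK0,
    hW.gFun_pos, ?_, fun r hr => ?_⟩
  · exact ((hreg.isHarmonicKernel_harmonicKernel hH).2 φ φ.continuous).2.1.congr hH heqD
  · have hset : {x ∈ W₀ | gFun 𝒱 H W₀ K x ≤ r} = closure W₀ ∩ G ⁻¹' Iic r := by
      ext x
      constructor
      · exact fun hx => ⟨subset_closure hx.1, (heq hx.1).symm.le.trans hx.2⟩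
      · rintro ⟨hx, hGx⟩
        have hGx : G x ≤ r := hGx
        have hxW : x ∈ W₀ := by
          by_contra h
          have := hGfr x (by rw [hWo.frontier_eq]; exact ⟨hx, h⟩)
          linarith
        exact ⟨hxW, (heq hxW).le.trans hGx⟩
    rw [hset]
    exact hW.isRegular.2.1.inter_right (isClosed_Iic.preimage hGc)

/-- No regular neighborhood is needed here. `R` is a positive lower bound of `h` on the boundary of
a relatively compact neighborhood `O` of `K`, so sublevel sets below `R` cannot reach `∂O`. -/
lemma IsStronglyStable.exists_isAnnular (hH : IsNormalBauerFamily 𝒱 H)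
    (hK : IsStronglyStable 𝒱 H K) : ∃ O g R, 0 < R ∧ IsAnnular 𝒱 H K O g R := by
  classical
  obtain ⟨hKc, -, W, hW, hKW, h, hh, hpos, hlim⟩ := hK
  obtain ⟨O, hO, hKO, hOW, hOc⟩ := exists_open_between_and_isCompact_closure hKc hW.1 hKW
  have hfrW : frontier O ⊆ W \ K := fun x hx => by
    refine ⟨hOW (frontier_subset_closure hx), fun hxK => ?_⟩
    rw [hO.frontier_eq] at hx
    exact hx.2 (hKO hxK)
  obtain ⟨R, hR, hRle⟩ := (hOc.of_isClosed_subset isClosed_frontier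
    frontier_subset_closure).exists_forall_le' (hh.1.mono hfrW) (a := 0)
      (fun x hx => hpos x (hfrW hx))
  set g : X → ℝ := Kᶜ.indicator h with hg
  have hgK : ∀ x ∈ K, g x = 0 := fun x hx => indicator_of_notMem (notMem_compl_iff.2 hx) _
  have hgh : ∀ x ∉ K, g x = h x := fun x hx => indicator_of_mem (s := Kᶜ) hx _
  have hWK : IsOpen (W \ K) := hW.1.sdiff hKc.isClosed
  have hgc : ContinuousOn g W := by
    intro x hx
    refine ContinuousAt.continuousWithinAt ?_
    by_cases hxK : x ∈ K
    · by_cases hxi : x ∈ interior K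
      · refine (continuousAt_const (y := (0 : ℝ))).congr ?_
        filter_upwards [isOpen_interior.mem_nhds hxi] with y hy
        exact (hgK y (interior_subset hy)).symm
      · rw [ContinuousAt, hgK x hxK, ← nhdsWithin_univ, ← union_compl_self K, nhdsWithin_union,
          tendsto_sup]
        constructor
        · refine tendsto_const_nhds.congr' ?_
          filter_upwards [self_mem_nhdsWithin] with y hy
          exact (hgK y hy).symm
        · have h1 : 𝓝[Kᶜ] x = 𝓝[W \ K] x := by
            rw [Set.sdiff_eq]
            exact (nhdsWithin_inter_of_mem (nhdsWithin_le_nhds (hW.1.mem_nhds hx))).symm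
          rw [h1]
          refine (hlim x ⟨subset_closure hxK, hxi⟩).congr' ?_
          filter_upwards [self_mem_nhdsWithin] with y hy
          exact (hgh y hy.2).symm
    · refine (hh.1.continuousAt (hWK.mem_nhds ⟨hx, hxK⟩)).congr ?_
      filter_upwards [hKc.isClosed.isOpen_compl.mem_nhds hxK] with y hy
      exact (hgh y hy).symm
  have hOW' : O ⊆ W := subset_closure.trans hOW
  refine ⟨O, g, R, hR, ⟨W, hW, hOW'⟩, hO, hKc, hKO, hgc.mono hOW', hgK,
    fun x hx => (hgh x hx.2).symm ▸ hpos x ⟨hOW' hx.1, hx.2⟩,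
    (hh.mono fun x hx => ⟨hOW' hx.1, hx.2⟩).congr hH fun x hx => hgh x hx.2, fun r hr => ?_⟩
  have hset : {x ∈ O | g x ≤ r} = closure O ∩ g ⁻¹' Iic r := by
    ext x
    constructor
    · exact fun hx => ⟨subset_closure hx.1, hx.2⟩
    · rintro ⟨hx, hgx⟩
      refine ⟨?_, hgx⟩
      by_contra hxO
      have hxf : x ∈ frontier O := by rw [hO.frontier_eq]; exact ⟨hx, hxO⟩
      have h1 := hRle x hxf
      rw [← hgh x (hfrW hxf).2] at h1
      have hgx : g x ≤ r := hgx
      linarith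
  rw [hset]
  exact hOc.of_isClosed_subset ((hgc.mono hOW).preimage_isClosed_of_isClosed isClosed_closure
    isClosed_Iic) inter_subset_left

/-- Otherwise `{g ≤ r} = {g < r}` would be open as well as compact, hence absorbing for the kernels
of small sets, which a `𝒫`-set does not allow. -/
lemma IsAnnular.nonempty_level (hH : IsNormalBauerFamily 𝒱 H) (ha : IsAnnular 𝒱 H K O g R)
    (hKne : K.Nonempty) {r : ℝ} (hr0 : 0 < r) (hr : r < R) : (level O K g r).Nonempty := by
  by_contra hempty
  rw [not_nonempty_iff_eq_empty] at hempty
  obtain ⟨P, hP, hOP⟩ := ha.exists_isPSet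
  set M := {x ∈ O | g x ≤ r} with hM
  have hMo : IsOpen M := by
    have : M = O ∩ g ⁻¹' Iio r := by
      ext x
      constructor
      · rintro ⟨hxO, hx⟩
        refine ⟨hxO, lt_of_le_of_ne hx fun h => ?_⟩
        have : x ∈ level O K g r :=
          ⟨⟨hxO, fun hxK => hr0.ne ((ha.eq_zero x hxK).symm.trans h)⟩, h⟩
        rw [hempty] at this
        exact this
      · exact fun hx => ⟨hx.1, le_of_lt hx.2⟩
    rw [this]
    exact ha.continuousOn.isOpen_inter_preimage ha.isOpen isOpen_Iio
  have hW : ∀ x ∈ M, ∃ W ∈ 𝒱, x ∈ W ∧ closure W ⊆ M := fun x hx =>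
    hH.exists_closure_subset (hMo.mem_nhds hx)
  choose! W hW𝒱 hxW hWM using hW
  have hMP : M ⊆ P := fun x hx => hOP hx.1
  obtain ⟨k, hk⟩ := hKne
  obtain ⟨x, hx, hne⟩ := hP.exists_measure_compl_ne_zero hH (ha.isCompact_le r hr)
    ⟨k, ha.subset hk, (ha.eq_zero k hk).le.trans hr0.le⟩ hMP W
    fun x hx => ⟨hW𝒱 x hx, hxW x hx, (hWM x hx).trans hMP⟩
  apply hne
  exact measure_mono_null (compl_subset_compl.2 (frontier_subset_closure.trans (hWM x hx)))
    ((hH.isBoundaryKernel _ (hW𝒱 x hx)).1 x (hxW x hx))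

/-- There are compatible probability measures on the level sets. -/
lemma IsAnnular.exists_compatible (hH : IsNormalBauerFamily 𝒱 H) (ha : IsAnnular 𝒱 H K O g R)
    (hKne : K.Nonempty) (hR : 0 < R) : ∃ σ : ℝ → ProbabilityMeasure X,
      (∀ r ∈ Ioo 0 R, (σ r : Measure X) (level O K g r)ᶜ = 0) ∧
      ∀ r t, 0 < r → r < t → t < R → sweep 𝒱 H K O g r t (σ r) = σ t := by
  obtain ⟨η, hanti, hη, hlim⟩ := exists_seq_strictAnti_tendsto' hR
  have hpt : ∀ n, ∃ x, x ∈ level O K g (η n) := fun n =>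
    ha.nonempty_level hH hKne (hη n).1 (hη n).2
  choose x hx using hpt
  -- Dirac measures at arbitrary points of the levels serve as starting sequence.
  obtain ⟨_, _, σ, hσ, hcomp⟩ := ha.exists_tendsto_sweep hH hη hanti hlim
    (ν := fun n => ⟨Measure.dirac (x n), inferInstance⟩) (fun n => by
      have hS := (ha.isCompact_level (hη n).1 (hη n).2).measurableSet
      change Measure.dirac (x n) (level O K g (η n))ᶜ = 0
      rw [Measure.dirac_apply' _ hS.compl, indicator_of_notMem (notMem_compl_iff.2 (hx n))])
  exact ⟨σ, fun r hr => (hσ r hr).2, hcomp⟩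

open Classical in
/-- Convergence of normalized swept measures for admissible sets. -/
theorem IsAdmissible.exists_subsequence (hH : IsNormalBauerFamily 𝒱 H) (hK : IsCompact K)
    (hW : IsAdmissible 𝒱 H K W₀) {η : ℕ → ℝ} (hη : ∀ n, η n ∈ Ioo (0 : ℝ) 1) (hanti : StrictAnti η)
    (hη0 : Tendsto η atTop (𝓝 0)) {ν : ℕ → ProbabilityMeasure X}
    (hν : ∀ n, (ν n : Measure X) (S 𝒱 H W₀ K (η n))ᶜ = 0) :
    ∃ n : ℕ → ℕ, StrictMono n ∧
      ∃ (σk : ℝ → ℕ → ProbabilityMeasure X) (σ : ℝ → ProbabilityMeasure X),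
        (∀ r ∈ Ioo (0 : ℝ) 1,
          (∀ k, η (n k) < r →
            (σk r k : Measure X) = ENNReal.ofReal (r / η (n k)) •
              (swept 𝒱 H W₀ K (ν (n k)) r).restrict (S 𝒱 H W₀ K r)) ∧
          Tendsto (σk r) atTop (𝓝 (σ r)) ∧
          (σ r : Measure X) (S 𝒱 H W₀ K r)ᶜ = 0) ∧
        IsCompatible 𝒱 H W₀ K fun r => (σ r : Measure X) := by
  have ha := hW.isAnnular hH hK
  obtain ⟨n, hn, σ, hσ, hcomp⟩ := ha.exists_tendsto_sweep hH hη hanti hη0 hν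
  refine ⟨n, hn, fun r k => sweep 𝒱 H K W₀ (gFun 𝒱 H W₀ K) (η (n k)) r (ν (n k)), σ,
    fun r hr => ⟨fun k hk => ha.coe_sweep hH (hη _).1 hk hr.2 (hν _), (hσ r hr).1, (hσ r hr).2⟩,
    fun r t hr hrt ht => ?_⟩
  have h1 := ha.coe_sweep hH hr hrt ht (hσ r ⟨hr, hrt.trans ht⟩).2
  rw [hcomp r t hr hrt ht] at h1
  have ht0 : 0 < t := hr.trans hrt
  simp only
  rw [h1, sweepMeasure, Measure.restrict_smul]
  change (swept 𝒱 H W₀ K (σ r) t).restrict (S 𝒱 H W₀ K t) = ENNReal.ofReal (r / t) •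
    ENNReal.ofReal (t / r) • ((swept 𝒱 H W₀ K (σ r) t).restrict (S 𝒱 H W₀ K t)).restrict
      (S 𝒱 H W₀ K t)
  rw [Measure.restrict_restrict_of_subset Subset.rfl, smul_smul,
    ← ENNReal.ofReal_mul (by positivity), show r / t * (t / r) = 1 by field_simp,
    ENNReal.ofReal_one, one_smul]

end Existence

end

section

/-! ### Topology of the collapsed space -/

section CollapseTopology

variable {X : Type*} [TopologicalSpace X] {K : Set X}

lemma isQuotientMap_proj : IsQuotientMap (proj K) := isQuotientMap_quotient_mk'

lemma continuous_proj : Continuous (proj K) := isQuotientMap_proj.continuous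

lemma surjective_proj : Function.Surjective (proj K) := isQuotientMap_proj.surjective

lemma proj_eq_iff {x y : X} : proj K x = proj K y ↔ x = y ∨ (x ∈ K ∧ y ∈ K) :=
  Quotient.eq (r := collapseSetoid K)

/-- `V` is saturated for the projection. -/
def IsSaturated (K V : Set X) : Prop := Disjoint V K ∨ K ⊆ V

lemma IsSaturated.proj_mem_image {V : Set X} (hV : IsSaturated K V) {x : X} :
    proj K x ∈ proj K '' V ↔ x ∈ V := by
  refine ⟨?_, mem_image_of_mem _⟩
  rintro ⟨y, hy, hyx⟩
  rcases proj_eq_iff.1 hyx with rfl | ⟨hyK, hxK⟩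
  · exact hy
  · rcases hV with h | h
    · exact (disjoint_left.1 h hy hyK).elim
    · exact h hxK

lemma IsSaturated.preimage_image {V : Set X} (hV : IsSaturated K V) :
    proj K ⁻¹' (proj K '' V) = V :=
  ext fun _ => hV.proj_mem_image

lemma IsSaturated.isOpen_image {V : Set X} (hV : IsSaturated K V) (hVo : IsOpen V) :
    IsOpen (proj K '' V) := by
  rw [← isQuotientMap_proj.isOpen_preimage, hV.preimage_image]
  exact hVo

/-- The saturation of a closed set is the set itself or its union with `K`. -/
lemma isClosedMap_proj (hK : IsClosed K) : IsClosedMap (proj K) := by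
  intro C hC
  rw [← isQuotientMap_proj.isClosed_preimage]
  by_cases hCK : Disjoint C K
  · rwa [IsSaturated.preimage_image (Or.inl hCK)]
  · have : proj K '' C = proj K '' (C ∪ K) := by
      refine (image_mono subset_union_left).antisymm ?_
      rintro _ ⟨x, hx | hx, rfl⟩
      · exact mem_image_of_mem _ hx
      · obtain ⟨y, hyC, hyK⟩ := not_disjoint_iff.1 hCK
        exact ⟨y, hyC, proj_eq_iff.2 (Or.inr ⟨hyK, hx⟩)⟩
    rw [this, IsSaturated.preimage_image (Or.inr subset_union_right)]
    exact hC.union hK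

/-- Because the projection is closed, a property near a point of `X₀` may be checked near each point
of its fiber. -/
lemma eventually_nhds_proj (hK : IsClosed K) {Q : Collapse K → Prop} {x : X}
    (h : ∀ x', proj K x' = proj K x → ∀ᶠ z in 𝓝 x', Q (proj K z)) :
    ∀ᶠ y in 𝓝 (proj K x), Q y := by
  filter_upwards [(isClosedMap_proj hK).eventually_nhds_fiber (proj K x) h] with y hy
  obtain ⟨z, rfl⟩ := surjective_proj y
  exact hy z rfl

lemma isCompact_fiber (hK : IsCompact K) (x : X) : IsCompact (proj K ⁻¹' {proj K x}) := by
  by_cases hx : x ∈ K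
  · have : proj K ⁻¹' {proj K x} = K := by
      ext y
      simp only [mem_preimage, mem_singleton_iff, proj_eq_iff]
      constructor
      · rintro (rfl | h)
        exacts [hx, h.1]
      · exact fun hy => Or.inr ⟨hy, hx⟩
    rwa [this]
  · have : proj K ⁻¹' {proj K x} = {x} := by
      ext y
      simp [proj_eq_iff, hx]
    rw [this]
    exact isCompact_singleton

lemma t2Space_collapse [T2Space X] (hK : IsCompact K) : T2Space (Collapse K) := by
  rw [t2Space_iff_disjoint_nhds]
  intro y₁ y₂ hne
  obtain ⟨x₁, rfl⟩ := surjective_proj y₁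
  obtain ⟨x₂, rfl⟩ := surjective_proj y₂
  obtain ⟨U, V, hU, hV, hxU, hxV, hUV⟩ := SeparatedNhds.of_isCompact_isCompact
    (isCompact_fiber hK x₁) (isCompact_fiber hK x₂)
    (disjoint_left.2 fun z hz₁ hz₂ => hne (hz₁.symm.trans hz₂))
  have h1 := (isClosedMap_proj hK.isClosed).eventually_nhds_fiber (p := (· ∈ U)) (proj K x₁)
    fun x hx => hU.mem_nhds (hxU hx)
  have h2 := (isClosedMap_proj hK.isClosed).eventually_nhds_fiber (p := (· ∈ V)) (proj K x₂)
    fun x hx => hV.mem_nhds (hxV hx)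
  refine Filter.disjoint_iff.2 ⟨_, h1, _, h2, disjoint_left.2 fun y hy₁ hy₂ => ?_⟩
  obtain ⟨z, rfl⟩ := surjective_proj y
  exact disjoint_left.1 hUV (hy₁ z rfl) (hy₂ z rfl)

lemma locallyCompactSpace_collapse [T2Space X] [LocallyCompactSpace X] (hK : IsCompact K) :
    LocallyCompactSpace (Collapse K) := by
  have := t2Space_collapse hK
  have : WeaklyLocallyCompactSpace (Collapse K) := by
    refine ⟨fun y => ?_⟩
    obtain ⟨x, rfl⟩ := surjective_proj y
    obtain ⟨L, hL, hKL⟩ := exists_compact_superset (hK.union (isCompact_singleton (x := x)))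
    refine ⟨proj K '' L, hL.image continuous_proj, ?_⟩
    have hsat : IsSaturated K (interior L) := Or.inr (subset_union_left.trans hKL)
    exact mem_of_superset ((hsat.isOpen_image isOpen_interior).mem_nhds
      (mem_image_of_mem _ (hKL (Or.inr rfl)))) (image_mono interior_subset)
  infer_instance

lemma isTopologicalBasis_collapse (ℬ : Set (Set X))
    (hℬ : ∀ V ∈ ℬ, IsOpen V ∧ IsSaturated K V)
    (h1 : ∀ x ∉ K, ∀ N, IsOpen N → x ∈ N → ∃ V ∈ ℬ, x ∈ V ∧ V ⊆ N)
    (h2 : ∀ N, IsOpen N → K ⊆ N → ∃ V ∈ ℬ, K ⊆ V ∧ V ⊆ N) :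
    TopologicalSpace.IsTopologicalBasis ((fun V => proj K '' V) '' ℬ) := by
  refine TopologicalSpace.isTopologicalBasis_of_isOpen_of_nhds ?_ fun y N hy hN => ?_
  · rintro _ ⟨V, hV, rfl⟩
    exact (hℬ V hV).2.isOpen_image (hℬ V hV).1
  · obtain ⟨x, rfl⟩ := surjective_proj y
    have hNo : IsOpen (proj K ⁻¹' N) := hN.preimage continuous_proj
    by_cases hx : x ∈ K
    · obtain ⟨V, hV, hKV, hVN⟩ := h2 _ hNo fun z hz => by
        rw [mem_preimage, proj_eq_iff.2 (Or.inr ⟨hz, hx⟩)]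
        exact hy
      exact ⟨_, ⟨V, hV, rfl⟩, mem_image_of_mem _ (hKV hx), image_subset_iff.2 hVN⟩
    · obtain ⟨V, hV, hxV, hVN⟩ := h1 x hx _ hNo hy
      exact ⟨_, ⟨V, hV, rfl⟩, mem_image_of_mem _ hxV, image_subset_iff.2 hVN⟩

open Classical in
/-- The section of the projection which maps the collapsed point to `k`. -/
def lift (K : Set X) (k : X) (y : Collapse K) : X :=
  if y = proj K k then k else Quotient.out y

lemma proj_lift (k : X) (y : Collapse K) : proj K (lift K k y) = y := by
  unfold lift
  split_ifs with h
  · exact h.symm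
  · exact Quotient.out_eq y

lemma lift_proj_of_notMem (k : X) {x : X} (hx : x ∉ K) : lift K k (proj K x) = x := by
  have h := proj_lift k (proj K x)
  rcases proj_eq_iff.1 h with h | h
  · exact h
  · exact (hx h.2).elim

lemma lift_proj_of_mem {k x : X} (hk : k ∈ K) (hx : x ∈ K) : lift K k (proj K x) = k :=
  if_pos (proj_eq_iff.2 (Or.inr ⟨hx, hk⟩))

/-- The section is continuous away from the collapsed point, and a single point does not affect
measurability. -/
lemma measurable_lift [T2Space X] [MeasurableSpace X] [BorelSpace X] (hK : IsCompact K) {k : X}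
    (hk : k ∈ K) : Measurable (lift K k) := by
  have := t2Space_collapse hK
  refine measurable_of_continuousOn_compl_singleton (proj K k) fun y hy => ?_
  obtain ⟨x, rfl⟩ := surjective_proj y
  have hx : x ∉ K := fun h => hy (proj_eq_iff.2 (Or.inr ⟨h, hk⟩))
  refine ContinuousAt.continuousWithinAt ?_
  rw [ContinuousAt, lift_proj_of_notMem k hx]
  intro N hN
  refine eventually_nhds_proj hK.isClosed fun x' hx' => ?_
  have hxx' : x' = x := (proj_eq_iff.1 hx').resolve_right fun h => hx h.2
  subst hxx'
  filter_upwards [hN, hK.isClosed.isOpen_compl.mem_nhds hx] with z hz hzK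
  rwa [lift_proj_of_notMem k hzK]

end CollapseTopology

/-! ### The neighborhoods `{g < r}` of `K` -/

section Balls

variable {X : Type*} [TopologicalSpace X] [T2Space X] [LocallyCompactSpace X]
  [SecondCountableTopology X] [MeasurableSpace X] [BorelSpace X]
  {𝒱 : Set (Set X)} {H : Set X → Kernel X X} {K O : Set X} {g : X → ℝ} {R r : ℝ}

/-- The open neighborhood `{g < r}` of `K`. -/
def ball (O : Set X) (g : X → ℝ) (r : ℝ) : Set X := {x ∈ O | g x < r}

namespace IsAnnular

lemma isOpen_ball (ha : IsAnnular 𝒱 H K O g R) (r : ℝ) : IsOpen (ball O g r) :=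
  ha.continuousOn.isOpen_inter_preimage ha.isOpen isOpen_Iio

lemma subset_ball (ha : IsAnnular 𝒱 H K O g R) (hr : 0 < r) : K ⊆ ball O g r :=
  fun x hx => ⟨ha.subset hx, (ha.eq_zero x hx).trans_lt hr⟩

lemma isSaturated_ball (ha : IsAnnular 𝒱 H K O g R) (hr : 0 < r) : IsSaturated K (ball O g r) :=
  Or.inr (ha.subset_ball hr)

lemma mem_annulus_of_mem_ball {x : X} (hx : x ∈ ball O g r) (hxK : x ∉ K) :
    x ∈ annulus O K g r :=
  ⟨⟨hx.1, hxK⟩, hx.2⟩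

lemma closure_ball_subset (ha : IsAnnular 𝒱 H K O g R) (hr : r < R) :
    closure (ball O g r) ⊆ {x ∈ O | g x ≤ r} :=
  closure_minimal (fun _ hx => ⟨hx.1, hx.2.le⟩) (ha.isCompact_le r hr).isClosed

/-- On the compact set `{g ≤ R / 2} \ N`, which misses `K`, the function `g` has a positive lower
bound; so the balls form a neighborhood base of `K`. -/
lemma exists_ball_subset (ha : IsAnnular 𝒱 H K O g R) (hR : 0 < R) {N : Set X} (hN : IsOpen N)
    (hKN : K ⊆ N) : ∃ c > 0, ∀ r < c, ball O g r ⊆ N := by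
  have hL : IsCompact ({x ∈ O | g x ≤ R / 2} \ N) := (ha.isCompact_le _ (by linarith)).diff hN
  obtain ⟨c, hc0, hc⟩ := hL.exists_forall_le' (ha.continuousOn.mono fun x hx => hx.1.1) (a := 0)
    fun x hx => ha.pos x ⟨hx.1.1, fun h => hx.2 (hKN h)⟩
  refine ⟨min c (R / 2), lt_min hc0 (by linarith), fun r hr x hx => ?_⟩
  by_contra hxN
  have h1 := hc x ⟨⟨hx.1, (hx.2.trans (hr.trans_le (min_le_right _ _))).le⟩, hxN⟩
  have h2 := hx.2
  have h3 := hr.trans_le (min_le_left _ _)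
  linarith

lemma secondCountableTopology_collapse (ha : IsAnnular 𝒱 H K O g R) (hR : 0 < R) :
    SecondCountableTopology (Collapse K) := by
  have hbasis := isTopologicalBasis_collapse (K := K)
    ({V ∈ TopologicalSpace.countableBasis X | Disjoint V K} ∪
      range fun n : ℕ => ball O g (1 / ((n : ℝ) + 1))) ?_ ?_ ?_
  · refine hbasis.secondCountableTopology (Countable.image ?_ _)
    exact ((TopologicalSpace.countable_countableBasis X).mono fun V hV => hV.1).union
      (countable_range _)
  · rintro V (hV | ⟨n, rfl⟩)
    · exact ⟨TopologicalSpace.isOpen_of_mem_countableBasis hV.1, Or.inl hV.2⟩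
    · exact ⟨ha.isOpen_ball _, ha.isSaturated_ball (by positivity)⟩
  · intro x hx N hN hxN
    obtain ⟨V, hV, hxV, hVN⟩ := (TopologicalSpace.isBasis_countableBasis X).mem_nhds_iff.1
      ((hN.sdiff ha.isCompact.isClosed).mem_nhds ⟨hxN, hx⟩)
    exact ⟨V, Or.inl ⟨hV, disjoint_left.2 fun y hy => (hVN hy).2⟩, hxV, fun y hy => (hVN hy).1⟩
  · intro N hN hKN
    obtain ⟨c, hc0, hc⟩ := ha.exists_ball_subset hR hN hKN
    obtain ⟨n, hn⟩ := exists_nat_one_div_lt hc0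
    exact ⟨_, Or.inr ⟨n, rfl⟩, ha.subset_ball (by positivity), hc _ hn⟩

end IsAnnular

end Balls

end

section

/-! ### Kernels for the balls, restarted at `K` -/

section BallKernel

variable {X : Type*} [TopologicalSpace X] [T2Space X] [LocallyCompactSpace X]
  [SecondCountableTopology X] [MeasurableSpace X] [BorelSpace X]
  {𝒱 : Set (Set X)} {H : Set X → Kernel X X} {K O : Set X} {g : X → ℝ} {R r s : ℝ}

open Classical in
/-- The kernel which replaces points of `K` by the measure `μ`. -/
def replaceKernel (K : Set X) (hK : IsCompact K) (μ : Measure X) : Kernel X X :=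
  Kernel.piecewise hK.measurableSet (Kernel.const X μ) Kernel.id

lemma replaceKernel_of_mem (hK : IsCompact K) (μ : Measure X) {x : X} (hx : x ∈ K) :
    replaceKernel K hK μ x = μ := by
  classical
  rw [replaceKernel, Kernel.piecewise_apply, if_pos hx, Kernel.const_apply]

lemma replaceKernel_of_notMem (hK : IsCompact K) (μ : Measure X) {x : X} (hx : x ∉ K) :
    replaceKernel K hK μ x = Measure.dirac x := by
  classical
  rw [replaceKernel, Kernel.piecewise_apply, if_neg hx, Kernel.id_apply]

instance (hK : IsCompact K) (μ : Measure X) [IsProbabilityMeasure μ] :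
    IsMarkovKernel (replaceKernel K hK μ) := by
  refine ⟨fun x => ?_⟩
  by_cases hx : x ∈ K
  · rw [replaceKernel_of_mem hK μ hx]; infer_instance
  · rw [replaceKernel_of_notMem hK μ hx]; infer_instance

variable (𝒱 H O g) in
/-- The boundary kernel for the neighborhood `{g < r}` of `K` obtained by restarting with `μ`
on `K`. -/
def ballKernel (hK : IsCompact K) (r : ℝ) (μ : Measure X) : Kernel X X :=
  replaceKernel K hK μ ∘ₖ harmonicKernel 𝒱 H (annulus O K g r)

/-- Compatible probability measures on the level sets `S_r`, `0 < r < R`. -/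
structure IsCompatibleFamily (𝒱 : Set (Set X)) (H : Set X → Kernel X X) (K O : Set X) (g : X → ℝ)
    (R : ℝ) (σ : ℝ → ProbabilityMeasure X) : Prop where
  measure_compl_level : ∀ r ∈ Ioo 0 R, (σ r : Measure X) (level O K g r)ᶜ = 0
  sweep_eq : ∀ r t, 0 < r → r < t → t < R → sweep 𝒱 H K O g r t (σ r) = σ t

lemma bind_dirac_kernel {Y Z : Type*} [MeasurableSpace Y] [MeasurableSpace Z] (κ : Kernel Y Z)
    (x : Y) : (Measure.dirac x).bind κ = κ x :=
  Measure.dirac_bind κ.measurable x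

namespace IsAnnular

variable {σ : ℝ → ProbabilityMeasure X}

lemma isMarkovKernel_ballKernel (hH : IsNormalBauerFamily 𝒱 H) (ha : IsAnnular 𝒱 H K O g R)
    (hr : r < R) (μ : Measure X) [IsProbabilityMeasure μ] :
    IsMarkovKernel (ballKernel 𝒱 H O g ha.isCompact r μ) := by
  have := (ha.isRegular_annulus hH hr).isMarkovKernel hH
  unfold ballKernel
  infer_instance

lemma ballKernel_of_mem (hH : IsNormalBauerFamily 𝒱 H) (ha : IsAnnular 𝒱 H K O g R)
    (hr : r < R) (μ : Measure X) {x : X} (hx : x ∈ K) :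
    ballKernel 𝒱 H O g ha.isCompact r μ x = μ := by
  rw [ballKernel, Kernel.comp_apply, (ha.isRegular_annulus hH hr).eq_dirac hH fun h => h.1.2 hx,
    bind_dirac_kernel, replaceKernel_of_mem _ _ hx]

lemma ballKernel_of_notMem (hH : IsNormalBauerFamily 𝒱 H) (ha : IsAnnular 𝒱 H K O g R)
    (hr0 : 0 < r) (hr : r < R) (μ : Measure X) {x : X} (hx : x ∉ ball O g r) :
    ballKernel 𝒱 H O g ha.isCompact r μ x = Measure.dirac x := by
  rw [ballKernel, Kernel.comp_apply, (ha.isRegular_annulus hH hr).eq_dirac hH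
    fun h => hx ⟨h.1.1, h.2⟩, bind_dirac_kernel,
    replaceKernel_of_notMem _ _ fun h => hx (ha.subset_ball hr0 h)]

lemma frontier_annulus_inter_level_subset (ha : IsAnnular 𝒱 H K O g R) :
    frontier (annulus O K g r) ∩ level O K g r ⊆ frontier (ball O g r) := by
  rintro x ⟨hx, hxS⟩
  rw [(ha.isOpen_ball r).frontier_eq]
  have hsub : annulus O K g r ⊆ ball O g r := fun y hy => ⟨hy.1.1, hy.2⟩
  exact ⟨closure_mono hsub (frontier_subset_closure hx), fun h => h.2.ne hxS.2⟩

/-- The level set `S_r` may contain points off the boundary of the ball. They are not charged,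
because `σ r` is itself swept from `σ (r / 2)` and is therefore carried by `∂A_r`. -/
lemma ae_mem_frontier_ball (hH : IsNormalBauerFamily 𝒱 H) (ha : IsAnnular 𝒱 H K O g R)
    (hσ : IsCompatibleFamily 𝒱 H K O g R σ) (hr0 : 0 < r) (hr : r < R) :
    ∀ᵐ y ∂(σ r : Measure X), y ∈ frontier (ball O g r) := by
  have hr2 : 0 < r / 2 := by linarith
  have hlt : r / 2 < r := by linarith
  have h2S := hσ.measure_compl_level (r / 2) ⟨hr2, hlt.trans hr⟩
  have h1 := ha.coe_sweep hH hr2 hlt hr h2S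
  rw [hσ.sweep_eq _ _ hr2 hlt hr] at h1
  have hreg := ha.isRegular_annulus hH hr
  have hbind : ∀ᵐ y ∂((σ (r / 2) : Measure X).bind (harmonicKernel 𝒱 H (annulus O K g r))),
      y ∈ frontier (annulus O K g r) := by
    have hm : MeasurableSet (frontier (annulus O K g r))ᶜ := isClosed_frontier.measurableSet.compl
    rw [ae_iff]
    change ((σ (r / 2) : Measure X).bind (harmonicKernel 𝒱 H (annulus O K g r)))
      (frontier (annulus O K g r))ᶜ = 0
    rw [Measure.bind_apply hm (Kernel.aemeasurable _), lintegral_eq_zero_iff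
      (Kernel.measurable_coe _ hm)]
    have hae : ∀ᵐ x ∂(σ (r / 2) : Measure X), x ∈ level O K g (r / 2) := h2S
    filter_upwards [hae] with x hx
    exact hreg.ae_mem_frontier hH (level_subset_annulus hlt hx)
  have h3 : ∀ᵐ y ∂(σ r : Measure X), y ∈ frontier (annulus O K g r) := by
    rw [h1, sweepMeasure]
    exact Measure.ae_smul_measure (ae_restrict_of_ae hbind) _
  have h4 : ∀ᵐ y ∂(σ r : Measure X), y ∈ level O K g r := hσ.measure_compl_level r ⟨hr0, hr⟩
  filter_upwards [h3, h4] with y hy3 hy4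
  exact ha.frontier_annulus_inter_level_subset ⟨hy3, hy4⟩

lemma ballKernel_compl_frontier (hH : IsNormalBauerFamily 𝒱 H) (ha : IsAnnular 𝒱 H K O g R)
    (hσ : IsCompatibleFamily 𝒱 H K O g R σ) (hr0 : 0 < r) (hr : r < R) {x : X}
    (hx : x ∈ ball O g r) :
    ballKernel 𝒱 H O g ha.isCompact r (σ r) x (frontier (ball O g r))ᶜ = 0 := by
  have hσfr := ha.ae_mem_frontier_ball hH hσ hr0 hr
  by_cases hxK : x ∈ K
  · rw [ha.ballKernel_of_mem hH hr _ hxK]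
    exact hσfr
  · have hreg := ha.isRegular_annulus hH hr
    have hm : MeasurableSet (frontier (ball O g r))ᶜ := isClosed_frontier.measurableSet.compl
    rw [ballKernel, Kernel.comp_apply' _ _ _ hm, lintegral_eq_zero_iff (Kernel.measurable_coe _ hm)]
    filter_upwards [hreg.ae_mem_frontier hH (mem_annulus_of_mem_ball hx hxK)] with y hy
    by_cases hyK : y ∈ K
    · rw [replaceKernel_of_mem _ _ hyK]
      exact hσfr
    · rw [replaceKernel_of_notMem _ _ hyK, Measure.dirac_apply' _ hm, indicator_of_notMem]
      · rfl
      · exact notMem_compl_iff.2 (ha.frontier_annulus_inter_level_subset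
          ⟨hy, (ha.frontier_annulus_subset hr hy).resolve_left hyK⟩)

lemma ballKernel_comp_kernel (hH : IsNormalBauerFamily 𝒱 H) (ha : IsAnnular 𝒱 H K O g R)
    (hr : r < R) (μ : Measure X) {V : Set X} (hV : V ∈ 𝒱) (hVA : V ⊆ annulus O K g r) :
    ballKernel 𝒱 H O g ha.isCompact r μ ∘ₖ H V = ballKernel 𝒱 H O g ha.isCompact r μ := by
  obtain ⟨P, hP, hOP⟩ := ha.exists_isPSet
  rw [ballKernel, Kernel.comp_assoc, (ha.isRegular_annulus hH hr).comp_kernel_eq hH hP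
    (fun x hx => hOP hx.1.1) hV hVA]

/-- Of the mass of `σ s`, the fraction `s / r` reaches `S_r` directly with distribution `σ r`, by
compatibility; the remainder falls into `K` and is redistributed as `σ r`. -/
lemma bind_ballKernel (hH : IsNormalBauerFamily 𝒱 H) (ha : IsAnnular 𝒱 H K O g R)
    (hσ : IsCompatibleFamily 𝒱 H K O g R σ) (hs : 0 < s) (hsr : s < r) (hr : r < R) :
    (σ s : Measure X).bind (ballKernel 𝒱 H O g ha.isCompact r (σ r)) = σ r := by
  have hr0 : 0 < r := hs.trans hsr
  have hreg := ha.isRegular_annulus hH hr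
  have := hreg.isMarkovKernel hH
  have hS := (ha.isCompact_level hr0 hr).measurableSet
  have hKm := ha.isCompact.measurableSet
  have hsS := hσ.measure_compl_level s ⟨hs, hsr.trans hr⟩
  have hcoe := ha.coe_sweep hH hs hsr hr hsS
  rw [hσ.sweep_eq _ _ hs hsr hr, sweepMeasure] at hcoe
  set T := harmonicKernel 𝒱 H (annulus O K g r) with hT
  set ρ := (σ s : Measure X).bind T with hρ
  have hρprob : IsProbabilityMeasure ρ := by
    rw [hρ]
    infer_instance
  have hρS : ∀ B, MeasurableSet B →
      ρ (B ∩ level O K g r) = ENNReal.ofReal (s / r) * (σ r : Measure X) B := fun B hB => by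
    rw [hcoe, Measure.smul_apply, Measure.restrict_apply hB, smul_eq_mul, ← mul_assoc,
      ← ENNReal.ofReal_mul (by positivity), show s / r * (r / s) = 1 by field_simp,
      ENNReal.ofReal_one, one_mul]
  have hρae : ∀ᵐ y ∂ρ, y ∈ K ∪ level O K g r := by
    have hm : MeasurableSet (K ∪ level O K g r)ᶜ := (hKm.union hS).compl
    rw [ae_iff]
    change ρ (K ∪ level O K g r)ᶜ = 0
    rw [hρ, Measure.bind_apply hm (Kernel.aemeasurable _), lintegral_eq_zero_iff
      (Kernel.measurable_coe _ hm)]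
    have hae : ∀ᵐ x ∂(σ s : Measure X), x ∈ level O K g s := hsS
    filter_upwards [hae] with x hx
    exact measure_mono_null (compl_subset_compl.2 (ha.frontier_annulus_subset hr))
      (hreg.ae_mem_frontier hH (level_subset_annulus hsr hx))
  have hdisj : Disjoint K (level O K g r) := disjoint_left.2 fun y hyK hyS => hyS.1.2 hyK
  have hρrestr : ρ = ρ.restrict K + ρ.restrict (level O K g r) := by
    rw [← Measure.restrict_union hdisj hS, Measure.restrict_eq_self_of_ae_mem hρae]
  have hone : ρ K + ENNReal.ofReal (s / r) = 1 := by
    have h1 := congrArg (fun m : Measure X => m univ) hρrestr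
    simp only [Measure.add_apply, Measure.restrict_apply_univ, measure_univ] at h1
    have h2 := hρS univ MeasurableSet.univ
    rw [univ_inter, measure_univ, mul_one] at h2
    rw [h1, h2]
  ext B hB
  have hbb : (σ s : Measure X).bind (ballKernel 𝒱 H O g ha.isCompact r (σ r)) =
      ρ.bind (replaceKernel K ha.isCompact (σ r)) := by
    rw [hρ, Measure.bind_bind (Kernel.aemeasurable _) (Kernel.aemeasurable _)]
    congr 1
  rw [hbb, Measure.bind_apply hB (Kernel.aemeasurable _), hρrestr, lintegral_add_measure]
  have e1 : ∫⁻ y in K, replaceKernel K ha.isCompact (σ r) y B ∂ρ = (σ r : Measure X) B * ρ K := by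
    rw [setLIntegral_congr_fun (g := fun _ => (σ r : Measure X) B) hKm fun y hy => by
      simp only [replaceKernel_of_mem _ _ hy], setLIntegral_const]
  have e2 : ∫⁻ y in level O K g r, replaceKernel K ha.isCompact (σ r) y B ∂ρ =
      ρ (B ∩ level O K g r) := by
    rw [setLIntegral_congr_fun (g := B.indicator 1) hS fun y hy => by
      simp only [replaceKernel_of_notMem ha.isCompact (σ r : Measure X) hy.1.2,
        Measure.dirac_apply' _ hB], lintegral_indicator_one hB, Measure.restrict_apply hB]
  rw [e1, e2, hρS B hB, mul_comm, ← add_mul, hone, one_mul]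

/-- For `s < r`, restarting in `K` with `σ s` and running on gives `σ r`, the same as restarting
with `σ r` at once; after that only the composition of the annular kernels remains. For `s = r` the
first kernel already ends on the boundary, where the second one is Dirac. -/
lemma ballKernel_comp_ballKernel (hH : IsNormalBauerFamily 𝒱 H) (ha : IsAnnular 𝒱 H K O g R)
    (hσ : IsCompatibleFamily 𝒱 H K O g R σ) (hs : 0 < s) (hsr : s ≤ r) (hr : r < R) :
    ballKernel 𝒱 H O g ha.isCompact r (σ r) ∘ₖ ballKernel 𝒱 H O g ha.isCompact s (σ s) =
      ballKernel 𝒱 H O g ha.isCompact r (σ r) := by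
  rcases hsr.eq_or_lt with rfl | hlt
  · ext1 x
    by_cases hx : x ∈ ball O g s
    · rw [Kernel.comp_apply]
      ext B hB
      rw [Measure.bind_apply hB (Kernel.aemeasurable _), ← lintegral_indicator_one hB]
      refine lintegral_congr_ae ?_
      have hae : ∀ᵐ y ∂(ballKernel 𝒱 H O g ha.isCompact s (σ s) x), y ∈ frontier (ball O g s) :=
        ha.ballKernel_compl_frontier hH hσ hs hr hx
      filter_upwards [hae] with y hy
      rw [(ha.isOpen_ball s).frontier_eq] at hy
      rw [ha.ballKernel_of_notMem hH hs hr _ hy.2, Measure.dirac_apply' _ hB]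
    · rw [Kernel.comp_apply, ha.ballKernel_of_notMem hH hs hr _ hx, bind_dirac_kernel,
        ha.ballKernel_of_notMem hH hs hr _ hx]
  · have h1 : ballKernel 𝒱 H O g ha.isCompact r (σ r) ∘ₖ replaceKernel K ha.isCompact (σ s) =
        ballKernel 𝒱 H O g ha.isCompact r (σ r) := by
      ext1 x
      rw [Kernel.comp_apply]
      by_cases hx : x ∈ K
      · rw [replaceKernel_of_mem _ _ hx, ha.ballKernel_of_mem hH hr _ hx,
          ha.bind_ballKernel hH hσ hs hlt hr]
      · rw [replaceKernel_of_notMem _ _ hx, bind_dirac_kernel]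
    rw [show ballKernel 𝒱 H O g ha.isCompact s (σ s) = replaceKernel K ha.isCompact (σ s) ∘ₖ
      harmonicKernel 𝒱 H (annulus O K g s) from rfl, ← Kernel.comp_assoc, h1, ballKernel,
      Kernel.comp_assoc, (ha.isRegular_annulus hH hr).comp_harmonicKernel_eq hH
      (ha.isRegular_annulus hH (hlt.trans hr)) fun x hx => ⟨hx.1, hx.2.trans hlt⟩]

lemma integral_ballKernel (hH : IsNormalBauerFamily 𝒱 H) (ha : IsAnnular 𝒱 H K O g R)
    (hr : r < R) (μ : Measure X) [IsProbabilityMeasure μ] {f : X → ℝ} (hf : Measurable f) {C : ℝ}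
    (hC : ∀ x, |f x| ≤ C) (x : X) :
    ∫ y, f y ∂(ballKernel 𝒱 H O g ha.isCompact r μ x) =
      ∫ y, ∫ z, f z ∂(replaceKernel K ha.isCompact μ y)
        ∂(harmonicKernel 𝒱 H (annulus O K g r) x) := by
  have := (ha.isRegular_annulus hH hr).isMarkovKernel hH
  exact integral_comp_kernel_of_abs_le _ _ hf hC x

/-- The restart turns the integrand into `∫ f dμ` on `K` and `f` elsewhere, which may jump at `∂K`.
Only its values on `K` and off the ball matter to `H_{A_r}`, so a Tietze extension from that closed
set may be integrated instead. -/
lemma continuous_integral_ballKernel_of_abs_le (hH : IsNormalBauerFamily 𝒱 H)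
    (ha : IsAnnular 𝒱 H K O g R)
    (hr0 : 0 < r) (hr : r < R) (μ : Measure X) [IsProbabilityMeasure μ]
    {f : X → ℝ} (hf : Continuous f) {C : ℝ} (hC : ∀ x, |f x| ≤ C) :
    Continuous fun x => ∫ y, f y ∂(ballKernel 𝒱 H O g ha.isCompact r μ x) := by
  classical
  have hreg := ha.isRegular_annulus hH hr
  have hcl : IsClosed ((ball O g r)ᶜ ∪ K) :=
    (ha.isOpen_ball r).isClosed_compl.union ha.isCompact.isClosed
  have hcont : ContinuousOn (K.piecewise (fun _ => ∫ y, f y ∂μ) f) ((ball O g r)ᶜ ∪ K) := by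
    refine ContinuousOn.union_of_isClosed ?_ ?_ (ha.isOpen_ball r).isClosed_compl
      ha.isCompact.isClosed
    · exact hf.continuousOn.congr fun x hx =>
        piecewise_eq_of_notMem _ _ _ fun h => hx (ha.subset_ball hr0 h)
    · exact continuousOn_const.congr fun x hx => piecewise_eq_of_mem _ _ _ hx
  obtain ⟨F, hF⟩ := ContinuousMap.exists_restrict_eq hcl ⟨_, hcont.domRestrict⟩
  have hFeq : ∀ x ∈ (ball O g r)ᶜ ∪ K, F x = ∫ z, f z ∂(replaceKernel K ha.isCompact μ x) := by
    intro x hx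
    have h1 : F x = K.piecewise (fun _ => ∫ y, f y ∂μ) f x :=
      congrArg (fun k : C(((ball O g r)ᶜ ∪ K : Set X), ℝ) => k ⟨x, hx⟩) hF
    rw [h1]
    by_cases hxK : x ∈ K
    · rw [piecewise_eq_of_mem _ _ _ hxK, replaceKernel_of_mem _ _ hxK]
    · rw [piecewise_eq_of_notMem _ _ _ hxK, replaceKernel_of_notMem _ _ hxK, integral_dirac]
  have heq : (fun x => ∫ y, f y ∂(ballKernel 𝒱 H O g ha.isCompact r μ x)) =
      fun x => ∫ y, F y ∂(harmonicKernel 𝒱 H (annulus O K g r) x) := by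
    ext x
    rw [ha.integral_ballKernel hH hr μ hf.measurable hC]
    by_cases hx : x ∈ annulus O K g r
    · refine integral_congr_ae ?_
      filter_upwards [hreg.ae_mem_frontier hH hx] with y hy
      refine (hFeq y ?_).symm
      rcases ha.frontier_annulus_subset hr hy with h | h
      · exact Or.inr h
      · exact Or.inl fun h' => h'.2.ne h.2
    · rw [hreg.eq_dirac hH hx, integral_dirac, integral_dirac, hFeq x]
      by_cases hxK : x ∈ K
      · exact Or.inr hxK
      · exact Or.inl fun h => hx (mem_annulus_of_mem_ball h hxK)
  rw [heq]
  exact hreg.continuous_integral hH F.continuous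

/-- Reduction to bounded integrands: from points of the closed ball only values on this compact set
are seen, and off the ball the kernel is Dirac. -/
lemma continuous_integral_ballKernel (hH : IsNormalBauerFamily 𝒱 H) (ha : IsAnnular 𝒱 H K O g R)
    (hσ : IsCompatibleFamily 𝒱 H K O g R σ) (hr0 : 0 < r) (hr : r < R)
    {f : X → ℝ} (hf : Continuous f) :
    Continuous fun x => ∫ y, f y ∂(ballKernel 𝒱 H O g ha.isCompact r (σ r) x) := by
  have hcomp : IsCompact (closure (ball O g r)) :=
    (ha.isCompact_le r hr).of_isClosed_subset isClosed_closure (ha.closure_ball_subset hr)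
  obtain ⟨F, C, hF, hC, hFf⟩ := exists_continuous_eqOn_of_isCompact hcomp hf.continuousOn
  have hin : ∀ x ∈ closure (ball O g r), ∫ y, f y ∂(ballKernel 𝒱 H O g ha.isCompact r (σ r) x) =
      ∫ y, F y ∂(ballKernel 𝒱 H O g ha.isCompact r (σ r) x) := fun x hx => by
    by_cases hxb : x ∈ ball O g r
    · refine integral_congr_ae ?_
      have hae : ∀ᵐ y ∂(ballKernel 𝒱 H O g ha.isCompact r (σ r) x), y ∈ frontier (ball O g r) :=
        ha.ballKernel_compl_frontier hH hσ hr0 hr hxb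
      filter_upwards [hae] with y hy
      exact (hFf (frontier_subset_closure hy)).symm
    · rw [ha.ballKernel_of_notMem hH hr0 hr _ hxb, integral_dirac, integral_dirac, hFf hx]
  have h1 : ContinuousOn (fun x => ∫ y, f y ∂(ballKernel 𝒱 H O g ha.isCompact r (σ r) x))
      (closure (ball O g r)) :=
    (ha.continuous_integral_ballKernel_of_abs_le hH hr0 hr (σ r) hF hC).continuousOn.congr hin
  have h2 : ContinuousOn (fun x => ∫ y, f y ∂(ballKernel 𝒱 H O g ha.isCompact r (σ r) x))
      (ball O g r)ᶜ := by
    refine hf.continuousOn.congr fun x hx => ?_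
    simp only [ha.ballKernel_of_notMem hH hr0 hr _ hx, integral_dirac]
  have h3 := h1.union_of_isClosed h2 isClosed_closure (ha.isOpen_ball r).isClosed_compl
  have huniv : closure (ball O g r) ∪ (ball O g r)ᶜ = univ :=
    eq_univ_of_forall fun x => (em (x ∈ ball O g r)).imp (fun h => subset_closure h) id
  rwa [huniv, continuousOn_univ] at h3

/-- Off `K` this is the strong Feller property on the annulus. At `K`, the restarted integrand
equals the constant `c = ∫ f dμ` on `K`, so the deviation from `c` is at most `2 * C` times the
harmonic measure `g / r` of the level set, which tends to `0`. -/
lemma continuousOn_integral_ballKernel (hH : IsNormalBauerFamily 𝒱 H)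
    (ha : IsAnnular 𝒱 H K O g R) (hr0 : 0 < r) (hr : r < R) (μ : Measure X)
    [IsProbabilityMeasure μ] {f : X → ℝ} (hf : Measurable f) {C : ℝ} (hC : ∀ x, |f x| ≤ C) :
    ContinuousOn (fun x => ∫ y, f y ∂(ballKernel 𝒱 H O g ha.isCompact r μ x)) (ball O g r) := by
  obtain ⟨P, hP, hOP⟩ := ha.exists_isPSet
  have hreg := ha.isRegular_annulus hH hr
  have := hreg.isMarkovKernel hH
  have hS := (ha.isCompact_level hr0 hr).measurableSet
  set φ : X → ℝ := fun y => ∫ z, f z ∂(replaceKernel K ha.isCompact μ y) with hφ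
  have hφm : Measurable φ := measurable_integral_kernel _ hf
  have hφC : ∀ y, |φ y| ≤ C := fun y => abs_integral_le_of_abs_le hC
  intro x hx
  refine ContinuousAt.continuousWithinAt ?_
  simp only [ha.integral_ballKernel hH hr μ hf hC]
  by_cases hxK : x ∈ K
  swap
  · exact (hreg.continuousOn_integral hH hP (fun x hx => hOP hx.1.1) hφm hφC).continuousAt
      (hreg.1.mem_nhds (mem_annulus_of_mem_ball hx hxK))
  set c := ∫ y, f y ∂μ with hc
  have hcC : |c| ≤ C := abs_integral_le_of_abs_le hC
  have hφK : ∀ y ∈ K, φ y = c := fun y hy => by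
    simp only [hφ, replaceKernel_of_mem ha.isCompact μ hy, hc]
  have hval : ∀ y ∈ K, ∫ z, φ z ∂(harmonicKernel 𝒱 H (annulus O K g r) y) = c := fun y hy => by
    rw [hreg.eq_dirac hH fun h => h.1.2 hy, integral_dirac, hφK y hy]
  rw [ContinuousAt, hval x hxK, tendsto_iff_dist_tendsto_zero]
  have hgx : Tendsto (fun y => 2 * C * (g y / r)) (𝓝 x) (𝓝 0) := by
    have h1 : Tendsto g (𝓝 x) (𝓝 (g x)) :=
      ha.continuousOn.continuousAt (ha.isOpen.mem_nhds (ha.subset hxK))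
    rw [ha.eq_zero x hxK] at h1
    simpa using (h1.div_const r).const_mul (2 * C)
  refine squeeze_zero' (Eventually.of_forall fun y => dist_nonneg) ?_ hgx
  filter_upwards [(ha.isOpen_ball r).mem_nhds hx] with y hy
  by_cases hyK : y ∈ K
  · rw [hval y hyK, dist_self, ha.eq_zero y hyK]
    simp
  have hyA := mem_annulus_of_mem_ball hy hyK
  have iφ : Integrable φ (harmonicKernel 𝒱 H (annulus O K g r) y) :=
    integrable_of_measurable_of_abs_le hφm hφC
  have h1 : (∫ z, φ z ∂(harmonicKernel 𝒱 H (annulus O K g r) y)) - c =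
      ∫ z, (φ z - c) ∂(harmonicKernel 𝒱 H (annulus O K g r) y) := by
    rw [integral_sub iφ (integrable_const _)]
    simp
  have h2 : ∫ z, (level O K g r).indicator (fun _ => 2 * C) z
      ∂(harmonicKernel 𝒱 H (annulus O K g r) y) = 2 * C * (g y / r) := by
    rw [integral_indicator hS, setIntegral_const, Measure.real, ha.measure_level hH hr0 hr hyA,
      ENNReal.toReal_ofReal (div_nonneg (ha.pos y hyA.1).le hr0.le), smul_eq_mul, mul_comm]
  rw [Real.dist_eq, h1, ← h2]
  refine abs_integral_le_integral_abs.trans (integral_mono_ae (iφ.sub (integrable_const _)).abs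
    ((integrable_const _).indicator hS) ?_)
  filter_upwards [hreg.ae_mem_frontier hH hyA] with z hz
  rcases ha.frontier_annulus_subset hr hz with h | h
  · rw [indicator_of_notMem fun h' => h'.1.2 h, hφK z h, sub_self, abs_zero]
  · rw [indicator_of_mem h]
    have := hφC z
    rw [abs_le] at this hcC ⊢
    constructor <;> linarith

end IsAnnular

end BallKernel

end

section

/-! ### Extended integrals and truncation -/

section EIntegral

variable {X : Type*} [TopologicalSpace X] [T2Space X] [LocallyCompactSpace X]
  [SecondCountableTopology X] [MeasurableSpace X] [BorelSpace X]
  {𝒱 : Set (Set X)} {H : Set X → Kernel X X}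

lemma eintegral_congr_ae {μ : Measure X} {u v : X → EReal} (h : u =ᵐ[μ] v) :
    eintegral μ u = eintegral μ v := by
  have h1 : ∫⁻ y, (u y).toENNReal ∂μ = ∫⁻ y, (v y).toENNReal ∂μ :=
    lintegral_congr_ae (h.mono fun y hy => by simp only [hy])
  have h2 : ∫⁻ y, (-u y).toENNReal ∂μ = ∫⁻ y, (-v y).toENNReal ∂μ :=
    lintegral_congr_ae (h.mono fun y hy => by simp only [hy])
  rw [eintegral, eintegral, h1, h2]

lemma eintegral_of_nonneg {μ : Measure X} {u : X → EReal} (h : ∀ᵐ y ∂μ, 0 ≤ u y) :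
    eintegral μ u = ((∫⁻ y, (u y).toENNReal ∂μ : ℝ≥0∞) : EReal) := by
  have hneg : ∫⁻ y, (-u y).toENNReal ∂μ = 0 := by
    rw [← lintegral_zero (μ := μ)]
    refine lintegral_congr_ae ?_
    filter_upwards [h] with y hy
    simp [EReal.toENNReal_of_nonpos, hy]
  rw [eintegral, hneg]
  simp

lemma eintegral_coe {μ : Measure X} [IsFiniteMeasure μ] {w : X → ℝ} (hw : Measurable w) {C : ℝ}
    (h0 : ∀ x, 0 ≤ w x) (hC : ∀ x, w x ≤ C) :
    eintegral μ (fun x => (w x : EReal)) = ((∫ x, w x ∂μ : ℝ) : EReal) := by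
  have hintg : Integrable w μ := integrable_of_measurable_of_abs_le hw (C := C) fun x => by
    rw [abs_of_nonneg (h0 x)]; exact hC x
  rw [eintegral_of_nonneg (ae_of_all _ fun x => by exact_mod_cast h0 x)]
  simp only [EReal.toENNReal_of_ne_top (EReal.coe_ne_top _), EReal.toReal_coe]
  rw [← ofReal_integral_eq_lintegral_ofReal hintg (ae_of_all _ h0), EReal.coe_ennreal_ofReal,
    max_eq_left (integral_nonneg h0)]

lemma eintegral_map {Y : Type*} [TopologicalSpace Y] [MeasurableSpace Y] {μ : Measure X} {f : X → Y}
    (hf : Measurable f) {u : Y → EReal} (hu : Measurable u) :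
    eintegral (μ.map f) u = eintegral μ (u ∘ f) := by
  rw [eintegral, eintegral,
    lintegral_map (f := fun y => (u y).toENNReal) (measurable_ereal_toENNReal.comp hu) hf,
    lintegral_map (f := fun y => (-u y).toENNReal) (measurable_ereal_toENNReal.comp hu.neg) hf]
  rfl

/-- Truncation of a positive hyperharmonic function. -/
lemma IsHyperharmonicOn.exists_truncation (hH : IsNormalBauerFamily 𝒱 H) {P : Set X}
    (hP : IsOpen P) {v : X → EReal} (hv : IsHyperharmonicOn H (fullChoice 𝒱 P) v P)
    (hpos : ∀ x ∈ P, 0 ≤ v x) {C : ℝ} (hC : 0 ≤ C) :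
    ∃ w : X → ℝ, LowerSemicontinuous w ∧ (∀ x, 0 ≤ w x) ∧ (∀ x, w x ≤ C) ∧
      (∀ x ∈ P, (w x : EReal) = min (v x) C) ∧
      ∀ W ∈ 𝒱, closure W ⊆ P → ∀ x ∈ W, ∫ y, w y ∂(H W x) ≤ w x := by
  classical
  set v' : X → EReal := P.piecewise v fun _ => 0 with hv'
  have hv'lsc : LowerSemicontinuous v' := lowerSemicontinuous_piecewise_zero hP hv.1 hpos
  have hv'0 : ∀ x, 0 ≤ v' x := fun x => by
    by_cases hx : x ∈ P
    · simp only [hv', piecewise_eq_of_mem _ _ _ hx, hpos x hx]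
    · simp only [hv', piecewise_eq_of_notMem _ _ _ hx, le_refl]
  have hC' : (0 : EReal) ≤ C := by exact_mod_cast hC
  set w : X → ℝ := fun x => (min (v' x) C).toReal with hw
  have hcoe : ∀ x, (w x : EReal) = min (v' x) C := fun x => by
    refine EReal.coe_toReal ?_ ?_
    · exact ((min_le_right _ _).trans_lt (EReal.coe_lt_top C)).ne
    · exact ((EReal.bot_lt_zero).trans_le (le_min (hv'0 x) hC')).ne'
  have hlsc : LowerSemicontinuous w := by
    intro x t ht
    have ht' : (t : EReal) < min (v' x) C := by
      rw [← hcoe x]; exact_mod_cast ht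
    have h1 := hv'lsc x t (ht'.trans_le (min_le_left _ _))
    filter_upwards [h1] with y hy
    have : (t : EReal) < w y := by
      rw [hcoe y]
      exact lt_min hy (ht'.trans_le (min_le_right _ _))
    exact_mod_cast this
  have hw0 : ∀ x, 0 ≤ w x := fun x => by
    have : (0 : EReal) ≤ w x := by rw [hcoe x]; exact le_min (hv'0 x) hC'
    exact_mod_cast this
  have hwC : ∀ x, w x ≤ C := fun x => by
    have : (w x : EReal) ≤ C := by rw [hcoe x]; exact min_le_right _ _
    exact_mod_cast this
  refine ⟨w, hlsc, hw0, hwC, fun x hx => ?_, fun W hW hWP x hx => ?_⟩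
  · rw [hcoe x, hv', piecewise_eq_of_mem _ _ _ hx]
  have := hH.isMarkovKernel hW
  have hxP : x ∈ P := hWP (subset_closure hx)
  have haeP : ∀ᵐ y ∂(H W x), y ∈ P := by
    filter_upwards [hH.ae_mem_frontier hW hx] with y hy using hWP (frontier_subset_closure hy)
  have h1 : ((∫ y, w y ∂(H W x) : ℝ) : EReal) ≤ v x := by
    refine le_trans ?_ (hv.2.2 x hxP W ⟨hW, hWP, hx⟩)
    rw [← eintegral_coe hlsc.measurable hw0 hwC,
      eintegral_of_nonneg (ae_of_all _ fun y => by exact_mod_cast hw0 y),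
      eintegral_of_nonneg (haeP.mono fun y hy => hpos y hy)]
    refine EReal.coe_ennreal_le_coe_ennreal_iff.2 (lintegral_mono_ae ?_)
    filter_upwards [haeP] with y hy
    refine EReal.toENNReal_le_toENNReal ?_
    rw [hcoe y, hv', piecewise_eq_of_mem _ _ _ hy]
    exact min_le_left _ _
  have h2 : ∫ y, w y ∂(H W x) ≤ C := by
    refine (abs_le.1 (abs_integral_le_of_abs_le fun y => ?_)).2
    rw [abs_of_nonneg (hw0 y)]
    exact hwC y
  have h3 : ((∫ y, w y ∂(H W x) : ℝ) : EReal) ≤ w x := by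
    rw [hcoe x, hv', piecewise_eq_of_mem _ _ _ hxP]
    exact le_min h1 (by exact_mod_cast h2)
  exact_mod_cast h3

end EIntegral

/-! ### Descending kernels to `X₀` -/

section CollapseFamily

variable {X : Type*} [TopologicalSpace X] [T2Space X] [LocallyCompactSpace X]
  [SecondCountableTopology X] [MeasurableSpace X] [BorelSpace X]
  {𝒱 : Set (Set X)} {H : Set X → Kernel X X} {K O : Set X} {g : X → ℝ} {R : ℝ}
  {σ : ℝ → ProbabilityMeasure X}

lemma measurable_proj : Measurable (proj K) :=
  continuous_proj.measurable

/-- The kernel on `X₀` induced by a kernel on `X`. -/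
def descend (hK : IsCompact K) {k : X} (hk : k ∈ K) (T : Kernel X X) :
    Kernel (Collapse K) (Collapse K) :=
  (T.comap (lift K k) (measurable_lift hK hk)).map (proj K)

lemma descend_proj (hK : IsCompact K) {k : X} (hk : k ∈ K) {T : Kernel X X}
    (hT : ∀ x ∈ K, (T x).map (proj K) = (T k).map (proj K)) (x : X) :
    descend hK hk T (proj K x) = (T x).map (proj K) := by
  rw [descend, Kernel.map_apply _ measurable_proj, Kernel.comap_apply]
  by_cases hx : x ∈ K
  · rw [lift_proj_of_mem hk hx, hT x hx]
  · rw [lift_proj_of_notMem k hx]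

open Classical in
variable (𝒱 H O g R σ) in
/-- The kernels of the darning. -/
def darnedKernel (hK : IsCompact K) {k : X} (hk : k ∈ K) (Z : Set (Collapse K)) :
    Kernel (Collapse K) (Collapse K) :=
  descend hK hk (if h : ∃ r ∈ Ioo 0 R, Z = proj K '' ball O g r
    then ballKernel 𝒱 H O g hK h.choose (σ h.choose) else H (proj K ⁻¹' Z))

variable (𝒱 K O g R) in
/-- The sets in `X` whose images are the base of the darning. -/
def darnedBase : Set (Set X) :=
  {V ∈ 𝒱 | Disjoint (closure V) K} ∪ (fun r => ball O g r) '' Ioo 0 R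

lemma darnedKernel_image (hH : IsNormalBauerFamily 𝒱 H) (hK : IsCompact K) {k : X} (hk : k ∈ K)
    (ha : IsAnnular 𝒱 H K O g R) {V : Set X} (hV : V ∈ 𝒱) (hVK : Disjoint (closure V) K) (x : X) :
    darnedKernel 𝒱 H O g R σ hK hk (proj K '' V) (proj K x) = (H V x).map (proj K) := by
  have hVK' : Disjoint V K := hVK.mono_left subset_closure
  have hsat : IsSaturated K V := Or.inl hVK'
  have hno : ¬ ∃ r ∈ Ioo 0 R, proj K '' V = proj K '' ball O g r := by
    rintro ⟨r, hr, h⟩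
    have h1 : proj K k ∈ proj K '' V := by
      rw [h]
      exact mem_image_of_mem _ (ha.subset_ball hr.1 hk)
    exact disjoint_left.1 hVK' (hsat.proj_mem_image.1 h1) hk
  rw [darnedKernel, dif_neg hno, hsat.preimage_image]
  refine descend_proj hK hk (fun y hy => ?_) x
  rw [hH.eq_dirac hV fun h => disjoint_left.1 hVK' h hy,
    hH.eq_dirac hV fun h => disjoint_left.1 hVK' h hk, Measure.map_dirac' measurable_proj,
    Measure.map_dirac' measurable_proj, proj_eq_iff.2 (Or.inr ⟨hy, hk⟩)]

/-- Level sets are nonempty, so a ball determines its radius. This makes the choice of radius in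
`darnedKernel` harmless and turns inclusions of balls into inequalities. -/
lemma IsAnnular.le_of_ball_subset (hH : IsNormalBauerFamily 𝒱 H) (ha : IsAnnular 𝒱 H K O g R)
    (hKne : K.Nonempty) {r s : ℝ} (hr : r ∈ Ioo 0 R) (h : ball O g s ⊆ ball O g r) : s ≤ r := by
  by_contra! hlt
  obtain ⟨x, hx⟩ := ha.nonempty_level hH hKne hr.1 hr.2
  exact (h ⟨hx.1.1, hx.2.trans_lt hlt⟩).2.ne hx.2

lemma darnedKernel_ball (hH : IsNormalBauerFamily 𝒱 H) (hK : IsCompact K) {k : X} (hk : k ∈ K)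
    (ha : IsAnnular 𝒱 H K O g R) {r : ℝ} (hr : r ∈ Ioo 0 R) (x : X) :
    darnedKernel 𝒱 H O g R σ hK hk (proj K '' ball O g r) (proj K x) =
      (ballKernel 𝒱 H O g hK r (σ r) x).map (proj K) := by
  have hex : ∃ s ∈ Ioo 0 R, proj K '' ball O g r = proj K '' ball O g s := ⟨r, hr, rfl⟩
  have hchoose : hex.choose = r := by
    obtain ⟨h1, h2⟩ := hex.choose_spec
    have h3 : ball O g r = ball O g hex.choose := by
      have h4 := congrArg (fun Z => proj K ⁻¹' Z) h2
      simpa only [(ha.isSaturated_ball hr.1).preimage_image,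
        (ha.isSaturated_ball h1.1).preimage_image] using h4
    exact le_antisymm (ha.le_of_ball_subset hH ⟨k, hk⟩ hr h3.ge)
      (ha.le_of_ball_subset hH ⟨k, hk⟩ h1 h3.le)
  rw [darnedKernel, dif_pos hex, hchoose]
  refine descend_proj hK hk (fun y hy => ?_) x
  rw [ha.ballKernel_of_mem hH hr.2 _ hy, ha.ballKernel_of_mem hH hr.2 _ hk]

/-- A kernel on `X` representing the darned kernel of the image of a set of the base. -/
structure Represents (H₀ : Set (Collapse K) → Kernel (Collapse K) (Collapse K)) (V : Set X)
    (T : Kernel X X) : Prop where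
  isOpen : IsOpen V
  isSaturated : IsSaturated K V
  isCompact_closure : IsCompact (closure V)
  isMarkovKernel : IsMarkovKernel T
  isBoundaryKernel : IsBoundaryKernel V T
  continuous_integral : ∀ f : X → ℝ, Continuous f → Continuous fun x => ∫ y, f y ∂(T x)
  continuousOn_integral : ∀ f : X → ℝ, Measurable f → (∃ C : ℝ, ∀ x, |f x| ≤ C) →
    ContinuousOn (fun x => ∫ y, f y ∂(T x)) V
  map_eq : ∀ x, H₀ (proj K '' V) (proj K x) = (T x).map (proj K)

lemma represents_of_mem (hH : IsNormalBauerFamily 𝒱 H) (hK : IsCompact K) {k : X} (hk : k ∈ K)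
    (ha : IsAnnular 𝒱 H K O g R) {V : Set X} (hV : V ∈ 𝒱) (hVK : Disjoint (closure V) K) :
    Represents (darnedKernel 𝒱 H O g R σ hK hk) V (H V) where
  isOpen := hH.isOpen hV
  isSaturated := Or.inl (hVK.mono_left subset_closure)
  isCompact_closure := hH.isCompact_closure V hV
  isMarkovKernel := hH.isMarkovKernel hV
  isBoundaryKernel := hH.isBoundaryKernel V hV
  continuous_integral := hH.continuous_integral V hV
  continuousOn_integral := hH.continuousOn_integral V hV
  map_eq := darnedKernel_image hH hK hk ha hV hVK

lemma represents_ball (hH : IsNormalBauerFamily 𝒱 H) (hK : IsCompact K) {k : X} (hk : k ∈ K)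
    (ha : IsAnnular 𝒱 H K O g R) (hσ : IsCompatibleFamily 𝒱 H K O g R σ) {r : ℝ}
    (hr : r ∈ Ioo 0 R) :
    Represents (darnedKernel 𝒱 H O g R σ hK hk) (ball O g r) (ballKernel 𝒱 H O g hK r (σ r)) where
  isOpen := ha.isOpen_ball r
  isSaturated := ha.isSaturated_ball hr.1
  isCompact_closure :=
    (ha.isCompact_le r hr.2).of_isClosed_subset isClosed_closure (ha.closure_ball_subset hr.2)
  isMarkovKernel := ha.isMarkovKernel_ballKernel hH hr.2 _
  isBoundaryKernel := ⟨fun _ hx => ha.ballKernel_compl_frontier hH hσ hr.1 hr.2 hx,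
    fun _ hx => ha.ballKernel_of_notMem hH hr.1 hr.2 _ hx⟩
  continuous_integral _ hf := ha.continuous_integral_ballKernel hH hσ hr.1 hr.2 hf
  continuousOn_integral _ hf := fun ⟨_, hC⟩ =>
    ha.continuousOn_integral_ballKernel hH hr.1 hr.2 _ hf hC
  map_eq := darnedKernel_ball hH hK hk ha hr

namespace Represents

variable {H₀ : Set (Collapse K) → Kernel (Collapse K) (Collapse K)} {V W : Set X}
  {T T' : Kernel X X}

lemma integral_eq (hT : Represents H₀ V T) {f : Collapse K → ℝ} (hf : Measurable f) (x : X) :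
    ∫ y, f y ∂(H₀ (proj K '' V) (proj K x)) = ∫ y, f (proj K y) ∂(T x) := by
  rw [hT.map_eq, integral_map measurable_proj.aemeasurable hf.aestronglyMeasurable]

lemma isBoundaryKernel_image (hK : IsCompact K) (hT : Represents H₀ V T) :
    IsBoundaryKernel (proj K '' V) (H₀ (proj K '' V)) := by
  have := t2Space_collapse hK
  constructor
  · rintro _ ⟨x, hx, rfl⟩
    rw [hT.map_eq, Measure.map_apply measurable_proj isClosed_frontier.measurableSet.compl]
    suffices hsub : frontier V ⊆ proj K ⁻¹' frontier (proj K '' V) by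
      rw [preimage_compl]
      exact measure_mono_null (compl_subset_compl.2 hsub) (hT.isBoundaryKernel.1 x hx)
    intro y hyf
    rw [hT.isOpen.frontier_eq] at hyf
    rw [mem_preimage, (hT.isSaturated.isOpen_image hT.isOpen).frontier_eq]
    exact ⟨image_closure_subset_closure_image continuous_proj (mem_image_of_mem _ hyf.1),
      fun h => hyf.2 (hT.isSaturated.proj_mem_image.1 h)⟩
  · intro y hy
    obtain ⟨x, rfl⟩ := surjective_proj y
    rw [hT.map_eq, hT.isBoundaryKernel.2 x fun h => hy (mem_image_of_mem _ h),
      Measure.map_dirac' measurable_proj]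

lemma isCompact_closure_image (hK : IsCompact K) (hT : Represents H₀ V T) :
    IsCompact (closure (proj K '' V)) := by
  rw [(isClosedMap_proj hK.isClosed).closure_image_eq_of_continuous continuous_proj]
  exact hT.isCompact_closure.image continuous_proj

lemma comp_eq (hT : Represents H₀ V T) (hT' : Represents H₀ W T') (h : T ∘ₖ T' = T) :
    H₀ (proj K '' V) ∘ₖ H₀ (proj K '' W) = H₀ (proj K '' V) := by
  ext1 y
  obtain ⟨x, rfl⟩ := surjective_proj y
  ext B hB
  have hB' := measurable_proj hB
  rw [Kernel.comp_apply' _ _ _ hB, hT'.map_eq, lintegral_map (Kernel.measurable_coe _ hB)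
    measurable_proj, hT.map_eq, Measure.map_apply measurable_proj hB]
  simp only [hT.map_eq, Measure.map_apply measurable_proj hB]
  rw [← Kernel.comp_apply' _ _ _ hB', h]

lemma continuous_integral_image (hT : Represents H₀ V T) {f : Collapse K → ℝ}
    (hf : Continuous f) : Continuous fun y => ∫ z, f z ∂(H₀ (proj K '' V) y) := by
  rw [isQuotientMap_proj.continuous_iff]
  have : ((fun y => ∫ z, f z ∂(H₀ (proj K '' V) y)) ∘ proj K) =
      fun x => ∫ z, f (proj K z) ∂(T x) := funext fun x => hT.integral_eq hf.measurable x
  rw [this]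
  exact hT.continuous_integral _ (hf.comp continuous_proj)

lemma continuousOn_integral_image (hT : Represents H₀ V T) {f : Collapse K → ℝ}
    (hf : Measurable f) (hC : ∃ C : ℝ, ∀ y, |f y| ≤ C) :
    ContinuousOn (fun y => ∫ z, f z ∂(H₀ (proj K '' V) y)) (proj K '' V) := by
  rw [isQuotientMap_proj.continuousOn_isOpen_iff (hT.isSaturated.isOpen_image hT.isOpen),
    hT.isSaturated.preimage_image]
  have : ((fun y => ∫ z, f z ∂(H₀ (proj K '' V) y)) ∘ proj K) =
      fun x => ∫ z, f (proj K z) ∂(T x) := funext fun x => hT.integral_eq hf x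
  rw [this]
  obtain ⟨C, hC⟩ := hC
  exact hT.continuousOn_integral _ (hf.comp measurable_proj) ⟨C, fun x => hC _⟩

lemma normal_image (hT : Represents H₀ V T) (y : Collapse K) : H₀ (proj K '' V) y univ = 1 := by
  obtain ⟨x, rfl⟩ := surjective_proj y
  have := hT.isMarkovKernel
  rw [hT.map_eq, Measure.map_apply measurable_proj MeasurableSet.univ, preimage_univ, measure_univ]

lemma eintegral_eq (hT : Represents H₀ V T) {u : Collapse K → EReal} (hu : Measurable u) (x : X) :
    eintegral (H₀ (proj K '' V) (proj K x)) u = eintegral (T x) (u ∘ proj K) := by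
  rw [hT.map_eq, eintegral_map measurable_proj hu]

end Represents

end CollapseFamily

end

/-! ### Separation on `X₀` and assembly of the darning -/

section

variable {X : Type*} [TopologicalSpace X] [T2Space X] [LocallyCompactSpace X]
  [SecondCountableTopology X] [MeasurableSpace X] [BorelSpace X]
  {𝒱 : Set (Set X)} {H : Set X → Kernel X X} {K O : Set X} {g : X → ℝ} {R : ℝ}
  {σ : ℝ → ProbabilityMeasure X}

section Transport

variable {ℬ : Set (Set X)} {𝒞 : X → Set (Set X)} {V : Set X} {k : X}

lemma closure_image_proj_subset (hK : IsClosed K) {W : Set X} (h : closure W ⊆ V) :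
    closure (proj K '' W) ⊆ proj K '' V := by
  rw [(isClosedMap_proj hK).closure_image_eq_of_continuous continuous_proj]
  exact image_mono h

/-- A choice on a saturated set of `X` which is constant on `K` induces a local choice on `X₀`. -/
lemma isLocalChoice_image (hK : IsClosed K) (hk : k ∈ K) (hV : IsSaturated K V)
    (h : ∀ x ∈ V, ∀ W ∈ 𝒞 x, W ∈ ℬ ∧ closure W ⊆ V ∧ x ∈ W)
    (hout : ∀ x ∈ V, x ∉ K → ∀ N, IsOpen N → x ∈ N → ∃ W ∈ 𝒞 x, W ⊆ N)
    (hin : k ∈ V → ∀ N, IsOpen N → K ⊆ N → ∃ W ∈ 𝒞 k, W ⊆ N) :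
    IsLocalChoice ((fun V => proj K '' V) '' ℬ) (proj K '' V)
      (fun y => (fun V => proj K '' V) '' 𝒞 (lift K k y)) := by
  intro y hy
  have hyV : lift K k y ∈ V := hV.proj_mem_image.1 (by rwa [proj_lift])
  refine ⟨?_, fun N hN => ?_⟩
  · rintro _ ⟨W, hW, rfl⟩
    obtain ⟨h1, h2, h3⟩ := h _ hyV W hW
    refine ⟨mem_image_of_mem _ h1, closure_image_proj_subset hK h2, ?_⟩
    rw [← proj_lift k y]
    exact mem_image_of_mem _ h3
  · obtain ⟨N', hN'N, hN'o, hyN'⟩ := mem_nhds_iff.1 hN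
    have hpre := hN'o.preimage (continuous_proj (K := K))
    have hmem : lift K k y ∈ proj K ⁻¹' N' := by rwa [mem_preimage, proj_lift]
    have key : ∃ W ∈ 𝒞 (lift K k y), W ⊆ proj K ⁻¹' N' := by
      by_cases hyK : lift K k y ∈ K
      · have hyk : lift K k y = k := by
          rw [← proj_lift k y]
          exact lift_proj_of_mem hk hyK
        rw [hyk] at hyV ⊢
        refine hin hyV _ hpre fun x hx => ?_
        rw [mem_preimage, proj_eq_iff.2 (Or.inr ⟨hx, hyK⟩)]
        exact hmem
      · exact hout _ hyV hyK _ hpre hmem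
    obtain ⟨W, hW, hWN⟩ := key
    exact ⟨_, mem_image_of_mem _ hW, (image_subset_iff.2 hWN).trans hN'N⟩

/-- Representing kernels turn mean value inequalities on `X₀` into inequalities on `X`. Lower
semicontinuity at the collapsed point follows from that at all points of `K`, as the projection is
closed. -/
lemma isHyperharmonicOn_image {H₀ : Set (Collapse K) → Kernel (Collapse K) (Collapse K)}
    (hK : IsCompact K) (hk : k ∈ K) (hV : IsSaturated K V) (hVo : IsOpen V) {u : X → EReal}
    (hu : Measurable u) (hlsc : LowerSemicontinuousOn u V) (hbot : ∀ x ∈ V, u x ≠ ⊥)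
    (hconst : ∀ x ∈ K, u x = u k)
    (hle : ∀ x ∈ V, ∀ W ∈ 𝒞 x, ∃ T, Represents H₀ W T ∧ eintegral (T x) u ≤ u x) :
    (u ∘ lift K k) ∘ proj K = u ∧ IsHyperharmonicOn H₀
      (fun y => (fun V => proj K '' V) '' 𝒞 (lift K k y)) (u ∘ lift K k) (proj K '' V) := by
  have hup : (u ∘ lift K k) ∘ proj K = u := by
    funext x
    by_cases hx : x ∈ K
    · simp only [Function.comp_apply, lift_proj_of_mem hk hx, hconst x hx]
    · simp only [Function.comp_apply, lift_proj_of_notMem k hx]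
  refine ⟨hup, ?_, ?_, ?_⟩
  · rintro _ ⟨x, hx, rfl⟩ t ht
    refine eventually_nhdsWithin_of_eventually_nhds
      (eventually_nhds_proj hK.isClosed fun x' hx' => ?_)
    have hx'V : x' ∈ V := hV.proj_mem_image.1 (hx' ▸ mem_image_of_mem _ hx)
    have ht' : t < u x' := by
      rw [← hup, Function.comp_apply, hx']
      exact ht
    have := hlsc x' hx'V t ht'
    rw [hVo.nhdsWithin_eq hx'V] at this
    filter_upwards [this] with z hz
    rw [← hup] at hz
    exact hz
  · rintro _ ⟨x, hx, rfl⟩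
    have := hbot x hx
    rw [← hup] at this
    exact this
  · rintro y hy _ ⟨W, hW, rfl⟩
    have hyV : lift K k y ∈ V := hV.proj_mem_image.1 (by rwa [proj_lift])
    obtain ⟨T, hT, hTle⟩ := hle _ hyV W hW
    have := hT.eintegral_eq (hu.comp (measurable_lift hK hk)) (lift K k y)
    rw [proj_lift, hup] at this
    simp only [this, Function.comp_apply]
    exact hTle

end Transport

/-- Separation for the sets of the base which stay away from `K`. -/
lemma separates_image_of_mem (hH : IsNormalBauerFamily 𝒱 H) (hK : IsCompact K) {k : X} (hk : k ∈ K)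
    (ha : IsAnnular 𝒱 H K O g R) {V : Set X} (hV : V ∈ 𝒱) (hVK : Disjoint (closure V) K) :
    ∃ 𝒲, IsLocalChoice ((fun V => proj K '' V) '' darnedBase 𝒱 K O g R) (proj K '' V) 𝒲 ∧
      PosHyperharmonicSeparates (darnedKernel 𝒱 H O g R σ hK hk) 𝒲 (proj K '' V) := by
  classical
  have hVK' : Disjoint V K := hVK.mono_left subset_closure
  have hsat : IsSaturated K V := Or.inl hVK'
  have hVo := hH.isOpen hV
  have haway : ∀ {W : Set X}, closure W ⊆ V → Disjoint (closure W) K := fun h => hVK'.mono_left h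
  obtain ⟨𝒲, h𝒲, hsep⟩ := hH.separates V hV
  refine ⟨_, isLocalChoice_image (𝒞 := 𝒲) hK.isClosed hk hsat (fun x hx W hW => ?_)
    (fun x hx _ N hN hxN => (h𝒲 x hx).2 N (hN.mem_nhds hxN))
    (fun hkV => (disjoint_left.1 hVK' hkV hk).elim), ?_⟩
  · obtain ⟨h1, h2, h3⟩ := (h𝒲 x hx).1 W hW
    exact ⟨Or.inl ⟨h1, haway h2⟩, h2, h3⟩
  · rintro _ ⟨x, hx, rfl⟩ _ ⟨x', hx', rfl⟩ hne
    obtain ⟨u, hu, hpos, hux⟩ := hsep x hx x' hx' fun h => hne (by rw [h])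
    -- The zero extension is globally measurable and constant on `K`, so it descends.
    set u' : X → EReal := V.piecewise u fun _ => 0 with hu'
    have hlsc : LowerSemicontinuous u' := lowerSemicontinuous_piecewise_zero hVo hu.1 hpos
    have hon : ∀ z ∈ V, u' z = u z := fun z hz => piecewise_eq_of_mem _ _ _ hz
    have hoff : ∀ z ∈ K, u' z = 0 := fun z hz =>
      piecewise_eq_of_notMem _ _ _ fun h => disjoint_left.1 hVK' h hz
    obtain ⟨hup, hhyp⟩ := isHyperharmonicOn_image (𝒞 := 𝒲)
      (H₀ := darnedKernel 𝒱 H O g R σ hK hk) hK hk hsat hVo hlsc.measurable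
      (hlsc.lowerSemicontinuousOn V) (fun z hz => by rw [hon z hz]; exact hu.2.1 z hz)
      (fun z hz => by rw [hoff z hz, hoff k hk]) fun z hz W hW => by
        obtain ⟨h1, h2, h3⟩ := (h𝒲 z hz).1 W hW
        refine ⟨H W, represents_of_mem hH hK hk ha h1 (haway h2), ?_⟩
        rw [hon z hz, eintegral_congr_ae (v := u)]
        · exact hu.2.2 z hz W hW
        · filter_upwards [hH.ae_mem_frontier h1 h3] with y hy
          exact hon y (h2 (frontier_subset_closure hy))
    refine ⟨_, hhyp, ?_, ?_⟩
    · rintro _ ⟨z, hz, rfl⟩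
      rw [← Function.comp_apply (f := u' ∘ lift K k), hup, hon z hz]
      exact hpos z hz
    · rw [← Function.comp_apply (f := u' ∘ lift K k), hup,
        ← Function.comp_apply (f := u' ∘ lift K k) (x := x'), hup, hon x hx, hon x' hx']
      exact hux

/-- The choice on a ball: smaller balls on `K`, and small sets of the base off `K`. -/
def ballChoice (𝒱 : Set (Set X)) (K O : Set X) (g : X → ℝ) (r : ℝ) (x : X) : Set (Set X) :=
  {W | (x ∈ K ∧ ∃ s ∈ Ioo 0 r, W = ball O g s) ∨
    (x ∉ K ∧ W ∈ 𝒱 ∧ closure W ⊆ annulus O K g r ∧ x ∈ W)}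

open Classical in
/-- The function `min (v + N (r - g)) d`. -/
def cap (O : Set X) (g : X → ℝ) (r : ℝ) (v : X → ℝ) (N d : ℝ) (x : X) : ℝ :=
  min (v x + N * (r - (ball O g r).piecewise g (fun _ => 0) x)) d

lemma cap_of_mem {r : ℝ} {v : X → ℝ} {N d : ℝ} {x : X} (hx : x ∈ ball O g r) :
    cap O g r v N d x = min (v x + N * (r - g x)) d := by
  classical
  rw [cap, piecewise_eq_of_mem _ _ _ hx]

namespace IsAnnular

lemma nonneg (ha : IsAnnular 𝒱 H K O g R) {x : X} (hx : x ∈ O) : 0 ≤ g x := by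
  by_cases hxK : x ∈ K
  · exact (ha.eq_zero x hxK).ge
  · exact (ha.pos x ⟨hx, hxK⟩).le

/-- The functions `min (v + N (r - g)) d` descend to hyperharmonic functions. -/
lemma isHyperharmonicOn_cap (hH : IsNormalBauerFamily 𝒱 H) (ha : IsAnnular 𝒱 H K O g R) {k : X}
    (hk : k ∈ K) (hσ : IsCompatibleFamily 𝒱 H K O g R σ) {r : ℝ} (hr : r ∈ Ioo 0 R) {v : X → ℝ}
    (hv : LowerSemicontinuous v) (hv0 : ∀ x, 0 ≤ v x) {C : ℝ} (hvC : ∀ x, v x ≤ C)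
    (hvH : ∀ W ∈ 𝒱, closure W ⊆ annulus O K g r → ∀ x ∈ W, ∫ y, v y ∂(H W x) ≤ v x)
    {N d : ℝ} (hN : 0 ≤ N) (hd0 : 0 ≤ d) (hd : d ≤ N * r) :
    ∃ u : Collapse K → EReal, IsHyperharmonicOn (darnedKernel 𝒱 H O g R σ ha.isCompact hk)
      (fun y => (fun V => proj K '' V) '' ballChoice 𝒱 K O g r (lift K k y)) u
        (proj K '' ball O g r) ∧ (∀ y, 0 ≤ u y) ∧
      ∀ x, u (proj K x) = (cap O g r v N d x : EReal) := by
  classical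
  -- Nothing is known about `g` outside `O`; cutting it off makes it measurable and bounded without
  -- changing it on the ball.
  set G : X → ℝ := (ball O g r).piecewise g fun _ => 0 with hG
  have hGon : ∀ x ∈ ball O g r, G x = g x := fun x hx => piecewise_eq_of_mem _ _ _ hx
  have hGoff : ∀ x ∉ ball O g r, G x = 0 := fun x hx => piecewise_eq_of_notMem _ _ _ hx
  have hGm : Measurable G := ContinuousOn.measurable_piecewise
    (ha.continuousOn.mono fun x hx => hx.1) continuousOn_const (ha.isOpen_ball r).measurableSet
  have hG0 : ∀ x, 0 ≤ G x := fun x => by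
    by_cases hx : x ∈ ball O g r
    · rw [hGon x hx]; exact ha.nonneg hx.1
    · exact (hGoff x hx).ge
  have hGr : ∀ x, G x ≤ r := fun x => by
    by_cases hx : x ∈ ball O g r
    · rw [hGon x hx]; exact hx.2.le
    · exact (hGoff x hx).le.trans hr.1.le
  have hcapdef : ∀ x, cap O g r v N d x = min (v x + N * (r - G x)) d := fun x => rfl
  set w : X → ℝ := cap O g r v N d with hw
  have hwm : Measurable w :=
    (hv.measurable.add ((measurable_const.sub hGm).const_mul N)).min measurable_const
  have hw0 : ∀ x, 0 ≤ w x := fun x => by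
    rw [hcapdef]
    exact le_min (add_nonneg (hv0 x) (mul_nonneg hN (sub_nonneg.2 (hGr x)))) hd0
  have hwd : ∀ x, w x ≤ d := fun x => (hcapdef x).trans_le (min_le_right _ _)
  -- Here `d ≤ N * r` enters: on `K`, where `g = 0`, the cap is active. So `w` has its maximal value
  -- `d` there, and the mean value inequality for the small balls holds whatever `σ` is.
  have hwK : ∀ x ∈ K, w x = d := fun x hx => by
    rw [hcapdef, hGon x (ha.subset_ball hr.1 hx), ha.eq_zero x hx, sub_zero]
    exact min_eq_right (hd.trans (le_add_of_nonneg_left (hv0 x)))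
  have hwlsc : LowerSemicontinuousOn w (ball O g r) := by
    have h1 : LowerSemicontinuousOn (fun x => v x + N * (r - G x)) (ball O g r) := by
      refine (hv.lowerSemicontinuousOn _).add (ContinuousOn.lowerSemicontinuousOn ?_)
      refine ContinuousOn.congr (f := fun x => N * (r - g x)) ?_ fun x hx => by rw [hGon x hx]
      exact continuousOn_const.mul
        (continuousOn_const.sub (ha.continuousOn.mono fun x hx => hx.1))
    intro x hx t ht
    have h2 := h1 x hx t (ht.trans_le ((hcapdef x).trans_le (min_le_left _ _)))
    filter_upwards [h2] with y hy
    rw [hcapdef]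
    exact lt_min hy (ht.trans_le (hwd x))
  have hlsc : LowerSemicontinuousOn (fun x => (w x : EReal)) (ball O g r) :=
    continuous_coe_real_ereal.comp_lowerSemicontinuousOn hwlsc
      fun _ _ h => EReal.coe_le_coe_iff.2 h
  have hle : ∀ x ∈ ball O g r, ∀ W ∈ ballChoice 𝒱 K O g r x,
      ∃ T, Represents (darnedKernel 𝒱 H O g R σ ha.isCompact hk) W T ∧
        eintegral (T x) (fun x => (w x : EReal)) ≤ w x := by
    rintro x hx W (⟨hxK, s, hs, rfl⟩ | ⟨hxK, hW, hWA, hxW⟩)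
    · have hT := represents_ball hH ha.isCompact hk ha hσ ⟨hs.1, hs.2.trans hr.2⟩
      have := hT.isMarkovKernel
      refine ⟨_, hT, ?_⟩
      rw [eintegral_coe hwm hw0 hwd, EReal.coe_le_coe_iff, hwK x hxK]
      refine (abs_le.1 (abs_integral_le_of_abs_le fun y => ?_)).2
      rw [abs_of_nonneg (hw0 y)]
      exact hwd y
    · have hWK : Disjoint (closure W) K := disjoint_left.2 fun y hy => (hWA hy).1.2
      have hT := represents_of_mem (σ := σ) hH ha.isCompact hk ha hW hWK
      have := hT.isMarkovKernel
      refine ⟨_, hT, ?_⟩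
      rw [eintegral_coe hwm hw0 hwd, EReal.coe_le_coe_iff]
      have hwi : Integrable w (H W x) := integrable_of_measurable_of_abs_le hwm (C := d)
        fun y => by rw [abs_of_nonneg (hw0 y)]; exact hwd y
      have hvi : Integrable v (H W x) := integrable_of_measurable_of_abs_le hv.measurable (C := C)
        fun y => by rw [abs_of_nonneg (hv0 y)]; exact hvC y
      have hGi : Integrable G (H W x) := integrable_of_measurable_of_abs_le hGm (C := r)
        fun y => by rw [abs_of_nonneg (hG0 y)]; exact hGr y
      have hGx : ∫ y, G y ∂(H W x) = G x := by
        rw [hGon x hx, ← ha.isHarmonicOn.2 W hW (fun y hy => (hWA hy).1) x hxW]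
        refine integral_congr_ae ?_
        filter_upwards [hH.ae_mem_frontier hW hxW] with y hy
        have hyA := hWA (frontier_subset_closure hy)
        exact hGon y ⟨hyA.1.1, hyA.2⟩
      have hNi : Integrable (fun y => N * (r - G y)) (H W x) :=
        ((integrable_const r).sub hGi).const_mul N
      rw [hcapdef x]
      refine le_min ?_ ?_
      · calc ∫ y, w y ∂(H W x) ≤ ∫ y, (v y + N * (r - G y)) ∂(H W x) :=
              integral_mono hwi (hvi.add hNi)
                fun y => (hcapdef y).trans_le (min_le_left _ _)
          _ = ∫ y, v y ∂(H W x) + N * (r - G x) := by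
              rw [integral_add hvi hNi,
                integral_const_mul, integral_sub (integrable_const r) hGi, hGx]
              simp
          _ ≤ v x + N * (r - G x) := by
              gcongr
              exact hvH W hW hWA x hxW
      · refine (abs_le.1 (abs_integral_le_of_abs_le fun y => ?_)).2
        rw [abs_of_nonneg (hw0 y)]
        exact hwd y
  obtain ⟨hup, hhyp⟩ := isHyperharmonicOn_image (𝒞 := ballChoice 𝒱 K O g r)
    (H₀ := darnedKernel 𝒱 H O g R σ ha.isCompact hk) ha.isCompact hk (ha.isSaturated_ball hr.1)
    (ha.isOpen_ball r) (measurable_coe_real_ereal.comp hwm) hlsc (fun x _ => EReal.coe_ne_bot _)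
    (fun x hx => congrArg Real.toEReal ((hwK x hx).trans (hwK k hk).symm)) hle
  exact ⟨_, hhyp, fun y => EReal.coe_nonneg.2 (hw0 _), fun x => congrFun hup x⟩

lemma isLocalChoice_ballChoice (hH : IsNormalBauerFamily 𝒱 H) (ha : IsAnnular 𝒱 H K O g R) {k : X}
    (hk : k ∈ K) {r : ℝ} (hr : r ∈ Ioo 0 R) :
    IsLocalChoice ((fun V => proj K '' V) '' darnedBase 𝒱 K O g R) (proj K '' ball O g r)
      (fun y => (fun V => proj K '' V) '' ballChoice 𝒱 K O g r (lift K k y)) := by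
  refine isLocalChoice_image ha.isCompact.isClosed hk (ha.isSaturated_ball hr.1) ?_ ?_ ?_
  · rintro x hx W (⟨hxK, s, hs, rfl⟩ | ⟨hxK, hW, hWA, hxW⟩)
    · refine ⟨Or.inr ⟨s, ⟨hs.1, hs.2.trans hr.2⟩, rfl⟩, fun y hy => ?_, ha.subset_ball hs.1 hxK⟩
      have := ha.closure_ball_subset (hs.2.trans hr.2) hy
      exact ⟨this.1, this.2.trans_lt hs.2⟩
    · exact ⟨Or.inl ⟨hW, disjoint_left.2 fun y hy => (hWA hy).1.2⟩,
        fun y hy => ⟨(hWA hy).1.1, (hWA hy).2⟩, hxW⟩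
  · intro x hx hxK N hN hxN
    have hopen : IsOpen (N ∩ (ball O g r \ K)) :=
      hN.inter ((ha.isOpen_ball r).sdiff ha.isCompact.isClosed)
    obtain ⟨W, hW, hxW, hWN⟩ := hH.exists_closure_subset (hopen.mem_nhds ⟨hxN, hx, hxK⟩)
    exact ⟨W, Or.inr ⟨hxK, hW, fun y hy => mem_annulus_of_mem_ball (hWN hy).2.1 (hWN hy).2.2, hxW⟩,
      fun y hy => (hWN (subset_closure hy)).1⟩
  · intro _ N hN hKN
    obtain ⟨c, hc, hcN⟩ := ha.exists_ball_subset (hr.1.trans hr.2) hN hKN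
    have hm : 0 < min c r := lt_min hc hr.1
    exact ⟨_, Or.inl ⟨hk, min c r / 2, ⟨by linarith, by linarith [min_le_right c r]⟩, rfl⟩,
      hcN _ (by linarith [min_le_left c r])⟩

/-- Separation of two points off `K` by the functions `min (v + N (r - g)) d`. -/
lemma exists_cap_ne (hH : IsNormalBauerFamily 𝒱 H) (ha : IsAnnular 𝒱 H K O g R) {r : ℝ}
    {x x' : X} (hx : x ∈ ball O g r) (hxK : x ∉ K) (hx' : x' ∈ ball O g r)
    (hx'K : x' ∉ K) (hne : x ≠ x') :
    ∃ (v : X → ℝ) (C N d : ℝ), LowerSemicontinuous v ∧ (∀ z, 0 ≤ v z) ∧ (∀ z, v z ≤ C) ∧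
      (∀ W ∈ 𝒱, closure W ⊆ annulus O K g r → ∀ z ∈ W, ∫ y, v y ∂(H W z) ≤ v z) ∧
      0 ≤ N ∧ 0 ≤ d ∧ d ≤ N * r ∧ cap O g r v N d x ≠ cap O g r v N d x' := by
  obtain ⟨P, hP, hOP⟩ := ha.exists_isPSet
  obtain ⟨u, hu, hpos, hux⟩ := hP.2 x (hOP hx.1) x' (hOP hx'.1) hne
  have hv : ∃ (v : X → ℝ) (C : ℝ), LowerSemicontinuous v ∧ (∀ z, 0 ≤ v z) ∧ (∀ z, v z ≤ C) ∧
      (∀ W ∈ 𝒱, closure W ⊆ P → ∀ z ∈ W, ∫ y, v y ∂(H W z) ≤ v z) ∧ v x ≠ v x' := by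
    have hmin : 0 ≤ min (u x) (u x') := le_min (hpos x (hOP hx.1)) (hpos x' (hOP hx'.1))
    -- A truncation level strictly between the two values keeps them distinct.
    obtain ⟨C, hC1, hC2⟩ := EReal.lt_iff_exists_real_btwn.1 (min_lt_max.2 hux)
    have hC0 : 0 ≤ C := EReal.coe_nonneg.1 (hmin.trans hC1.le)
    obtain ⟨v, h1, h2, h3, h4, h5⟩ := hu.exists_truncation hH hP.1 hpos hC0
    refine ⟨v, C, h1, h2, h3, h5, fun h => ?_⟩
    have h6 : min (u x) C = min (u x') C := by rw [← h4 x (hOP hx.1), ← h4 x' (hOP hx'.1), h]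
    rcases lt_or_gt_of_ne hux with hlt | hlt
    · rw [min_eq_left hlt.le] at hC1
      rw [max_eq_right hlt.le] at hC2
      rw [min_eq_left hC1.le, min_eq_right hC2.le] at h6
      exact hC1.ne h6
    · rw [min_eq_right hlt.le] at hC1
      rw [max_eq_left hlt.le] at hC2
      rw [min_eq_left hC1.le, min_eq_right hC2.le] at h6
      exact hC1.ne h6.symm
  obtain ⟨v, C, h1, h2, h3, h4, hvne⟩ := hv
  set δ := min (g x) (g x') with hδ
  have hδ0 : 0 < δ := lt_min (ha.pos x ⟨hx.1, hxK⟩) (ha.pos x' ⟨hx'.1, hx'K⟩)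
  have hδr : δ < r := (min_le_left _ _).trans_lt hx.2
  have hC0 : 0 ≤ C := (h2 x).trans (h3 x)
  -- For `d = N * r - N * δ / 2` the cap is inactive where `g ≥ δ`: there `N * (r - g) ≤ N * r - N *
  -- δ`, and `v ≤ C ≤ N * δ / 2`.
  have hval : ∀ N, 2 * C / δ ≤ N → ∀ z ∈ ball O g r, δ ≤ g z →
      cap O g r v N (N * r - N * δ / 2) z = v z + N * (r - g z) := by
    intro N hN z hz hgz
    rw [cap_of_mem hz]
    rw [div_le_iff₀ hδ0] at hN
    have hN0 : 0 ≤ N := nonneg_of_mul_nonneg_left ((by positivity : 0 ≤ 2 * C).trans hN) hδ0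
    have := mul_le_mul_of_nonneg_left hgz hN0
    refine min_eq_left ?_
    linarith [h3 z]
  -- Equality for two different values of `N` would force `g x = g x'` and then `v x = v x'`.
  have hfin : ∃ N, 2 * C / δ ≤ N ∧ v x + N * (r - g x) ≠ v x' + N * (r - g x') := by
    by_contra! hcon
    have e1 := hcon (2 * C / δ) le_rfl
    have e2 := hcon (2 * C / δ + 1) (by linarith)
    have e3 : g x = g x' := by linarith
    rw [e3] at e1
    exact hvne (add_right_cancel e1)
  obtain ⟨N, hN, hNne⟩ := hfin
  have hN0 : 0 ≤ N := (by positivity : 0 ≤ 2 * C / δ).trans hN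
  have hNδ := mul_le_mul_of_nonneg_left hδr.le hN0
  have hNδ0 := mul_nonneg hN0 hδ0.le
  refine ⟨v, C, N, N * r - N * δ / 2, h1, h2, h3,
    fun W hW hWA => h4 W hW fun y hy => hOP (hWA hy).1.1, hN0, by linarith, by linarith, ?_⟩
  rw [hval N hN x hx (min_le_left _ _), hval N hN x' hx' (min_le_right _ _)]
  exact hNne

/-- Separation for the images of the balls. -/
lemma separates_image_ball (hH : IsNormalBauerFamily 𝒱 H) (ha : IsAnnular 𝒱 H K O g R) {k : X}
    (hk : k ∈ K) (hσ : IsCompatibleFamily 𝒱 H K O g R σ) {r : ℝ} (hr : r ∈ Ioo 0 R) :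
    PosHyperharmonicSeparates (darnedKernel 𝒱 H O g R σ ha.isCompact hk)
      (fun y => (fun V => proj K '' V) '' ballChoice 𝒱 K O g r (lift K k y))
      (proj K '' ball O g r) := by
  rintro _ ⟨x, hx, rfl⟩ _ ⟨x', hx', rfl⟩ hne
  have key : ∃ (v : X → ℝ) (C N d : ℝ), LowerSemicontinuous v ∧ (∀ z, 0 ≤ v z) ∧ (∀ z, v z ≤ C) ∧
      (∀ W ∈ 𝒱, closure W ⊆ annulus O K g r → ∀ z ∈ W, ∫ y, v y ∂(H W z) ≤ v z) ∧
      0 ≤ N ∧ 0 ≤ d ∧ d ≤ N * r ∧ cap O g r v N d x ≠ cap O g r v N d x' := by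
    have hlin : g x ≠ g x' → ∃ (v : X → ℝ) (C N d : ℝ),
        LowerSemicontinuous v ∧ (∀ z, 0 ≤ v z) ∧ (∀ z, v z ≤ C) ∧
        (∀ W ∈ 𝒱, closure W ⊆ annulus O K g r → ∀ z ∈ W, ∫ y, v y ∂(H W z) ≤ v z) ∧
        0 ≤ N ∧ 0 ≤ d ∧ d ≤ N * r ∧ cap O g r v N d x ≠ cap O g r v N d x' := by
      intro hg
      -- This is `r - g` itself: the cap `d = r` changes nothing because `g ≥ 0`. It also separates
      -- `K` from the points off `K`.
      refine ⟨fun _ => 0, 0, 1, r, lowerSemicontinuous_const, fun _ => le_rfl, fun _ => le_rfl,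
        fun W _ _ z _ => by simp, zero_le_one, hr.1.le, by linarith, ?_⟩
      rw [cap_of_mem hx, cap_of_mem hx', min_eq_left (by linarith [ha.nonneg hx.1]),
        min_eq_left (by linarith [ha.nonneg hx'.1])]
      intro h
      exact hg (by linarith)
    by_cases hxK : x ∈ K
    · have hx'K : x' ∉ K := fun h => hne (proj_eq_iff.2 (Or.inr ⟨hxK, h⟩))
      exact hlin (by rw [ha.eq_zero x hxK]; exact (ha.pos x' ⟨hx'.1, hx'K⟩).ne)
    by_cases hx'K : x' ∈ K
    · exact hlin (by rw [ha.eq_zero x' hx'K]; exact (ha.pos x ⟨hx.1, hxK⟩).ne')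
    exact ha.exists_cap_ne hH hx hxK hx' hx'K fun h => hne (by rw [h])
  obtain ⟨v, C, N, d, h1, h2, h3, h4, hN, hd0, hd, hcap⟩ := key
  obtain ⟨u, hu, hu0, hux⟩ := ha.isHyperharmonicOn_cap hH hk hσ hr h1 h2 h3 h4 hN hd0 hd
  refine ⟨u, hu, fun z _ => hu0 z, ?_⟩
  rw [hux, hux]
  exact fun h => hcap (EReal.coe_injective h)

lemma isTopologicalBasis_darnedBase (hH : IsNormalBauerFamily 𝒱 H) (ha : IsAnnular 𝒱 H K O g R)
    (hR : 0 < R) : TopologicalSpace.IsTopologicalBasis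
      ((fun V => proj K '' V) '' darnedBase 𝒱 K O g R) := by
  refine isTopologicalBasis_collapse _ ?_ (fun x hxK N hN hxN => ?_) fun N hN hKN => ?_
  · rintro V (⟨hV, hVK⟩ | ⟨r, hr, rfl⟩)
    · exact ⟨hH.isOpen hV, Or.inl (hVK.mono_left subset_closure)⟩
    · exact ⟨ha.isOpen_ball r, ha.isSaturated_ball hr.1⟩
  · obtain ⟨W, hW, hxW, hWN⟩ := hH.exists_closure_subset
      ((hN.sdiff ha.isCompact.isClosed).mem_nhds ⟨hxN, hxK⟩)
    exact ⟨W, Or.inl ⟨hW, disjoint_left.2 fun y hy => (hWN hy).2⟩, hxW,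
      fun y hy => (hWN (subset_closure hy)).1⟩
  · obtain ⟨c, hc, hcN⟩ := ha.exists_ball_subset hR hN hKN
    have hm : 0 < min c R := lt_min hc hR
    have hm2 : 0 < min c R / 2 := by linarith
    exact ⟨_, Or.inr ⟨min c R / 2, ⟨hm2, by linarith [min_le_right c R]⟩, rfl⟩,
      ha.subset_ball hm2, hcN _ (by linarith [min_le_left c R])⟩

/-- The images of the kernels `H V`, `V` away from `K`, and of the kernels for the balls around `K`
form a normal Bauer family on `X₀`. -/
lemma isNormalBauerFamily_darnedKernel (hH : IsNormalBauerFamily 𝒱 H)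
    (ha : IsAnnular 𝒱 H K O g R) (hR : 0 < R) {k : X} (hk : k ∈ K)
    (hσ : IsCompatibleFamily 𝒱 H K O g R σ) :
    IsNormalBauerFamily ((fun V => proj K '' V) '' darnedBase 𝒱 K O g R)
      (darnedKernel 𝒱 H O g R σ ha.isCompact hk) := by
  have hrep : ∀ V ∈ darnedBase 𝒱 K O g R,
      ∃ T, Represents (darnedKernel 𝒱 H O g R σ ha.isCompact hk) V T := by
    rintro V (⟨hV, hVK⟩ | ⟨r, hr, rfl⟩)
    · exact ⟨_, represents_of_mem hH ha.isCompact hk ha hV hVK⟩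
    · exact ⟨_, represents_ball hH ha.isCompact hk ha hσ hr⟩
  refine ⟨ha.isTopologicalBasis_darnedBase hH hR, ?_, ?_, ?_, ?_, ?_, ?_, ?_⟩
  · rintro _ ⟨V, hV, rfl⟩
    obtain ⟨T, hT⟩ := hrep V hV
    exact hT.isCompact_closure_image ha.isCompact
  · rintro _ ⟨V, hV, rfl⟩
    obtain ⟨T, hT⟩ := hrep V hV
    exact hT.isBoundaryKernel_image ha.isCompact
  · rintro _ ⟨V, hV, rfl⟩ _ ⟨W, hW, rfl⟩ hWV
    obtain ⟨TV, hTV⟩ := hrep V hV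
    obtain ⟨TW, hTW⟩ := hrep W hW
    have hsub : W ⊆ V := fun x hx => hTV.isSaturated.proj_mem_image.1 (hWV (mem_image_of_mem _ hx))
    -- A set away from `K` contains no ball, so only three kinds of inclusion occur.
    rcases hV with ⟨hV, hVK⟩ | ⟨r, hr, rfl⟩ <;> rcases hW with ⟨hW, hWK⟩ | ⟨s, hs, rfl⟩
    · exact (represents_of_mem hH ha.isCompact hk ha hV hVK).comp_eq
        (represents_of_mem hH ha.isCompact hk ha hW hWK) (hH.comp_eq V hV W hW hsub)
    · exact (disjoint_left.1 (hVK.mono_left subset_closure)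
        (hsub (ha.subset_ball hs.1 hk)) hk).elim
    · exact (represents_ball hH ha.isCompact hk ha hσ hr).comp_eq
        (represents_of_mem hH ha.isCompact hk ha hW hWK)
        (ha.ballKernel_comp_kernel hH hr.2 _ hW fun x hx => mem_annulus_of_mem_ball (hsub hx)
          (disjoint_left.1 (hWK.mono_left subset_closure) hx))
    · exact (represents_ball hH ha.isCompact hk ha hσ hr).comp_eq
        (represents_ball hH ha.isCompact hk ha hσ hs)
        (ha.ballKernel_comp_ballKernel hH hσ hs.1 (ha.le_of_ball_subset hH ⟨k, hk⟩ hr hsub) hr.2)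
  · rintro _ ⟨V, hV, rfl⟩ f hf
    obtain ⟨T, hT⟩ := hrep V hV
    exact hT.continuous_integral_image hf
  · rintro _ ⟨V, hV, rfl⟩ y
    obtain ⟨T, hT⟩ := hrep V hV
    exact hT.normal_image y
  · rintro _ ⟨V, ⟨hV, hVK⟩ | ⟨r, hr, rfl⟩, rfl⟩
    · exact separates_image_of_mem hH ha.isCompact hk ha hV hVK
    · exact ⟨_, ha.isLocalChoice_ballChoice hH hk hr, ha.separates_image_ball hH hk hσ hr⟩
  · rintro _ ⟨V, hV, rfl⟩ f hf hC
    obtain ⟨T, hT⟩ := hrep V hV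
    exact hT.continuousOn_integral_image hf hC

end IsAnnular

/-- A darning of a strongly stable compact set exists. -/
lemma IsStronglyStable.exists_isDarning (hH : IsNormalBauerFamily 𝒱 H)
    (hK : IsStronglyStable 𝒱 H K) : ∃ 𝒱₀ H₀, IsDarning 𝒱 H K 𝒱₀ H₀ := by
  obtain ⟨O, g, R, hR, ha⟩ := hK.exists_isAnnular hH
  obtain ⟨k, hk⟩ := hK.2.1
  obtain ⟨σ, hσ1, hσ2⟩ := ha.exists_compatible hH hK.2.1 hR
  have hσ : IsCompatibleFamily 𝒱 H K O g R σ := ⟨hσ1, hσ2⟩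
  exact ⟨_, _, t2Space_collapse ha.isCompact, locallyCompactSpace_collapse ha.isCompact,
    ha.secondCountableTopology_collapse hR, ha.isNormalBauerFamily_darnedKernel hH hR hk hσ,
    fun V hV hVK => mem_image_of_mem _ (Or.inl ⟨hV, hVK⟩),
    fun V hV hVK => darnedKernel_image hH ha.isCompact hk ha hV hVK⟩

end

end Darning

end

theorem proposition2p4 {X : Type*} [TopologicalSpace X] [T2Space X] [LocallyCompactSpace X]
    [SecondCountableTopology X] [MeasurableSpace X] [BorelSpace X]
    (𝒱 : Set (Set X)) (H : Set X → Kernel X X) (hH : Darning.IsNormalBauerFamily 𝒱 H)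
    (K : Set X) (hK : Darning.IsStronglyStable 𝒱 H K) :
    (∀ W₀ : Set X, Darning.IsAdmissible 𝒱 H K W₀ →
      ∀ η : ℕ → ℝ, (∀ n, η n ∈ Ioo (0 : ℝ) 1) → StrictAnti η → Tendsto η atTop (𝓝 0) →
      ∀ ν : ℕ → ProbabilityMeasure X,
        (∀ n, (ν n : Measure X) (Darning.S 𝒱 H W₀ K (η n))ᶜ = 0) →
      ∃ n : ℕ → ℕ, StrictMono n ∧
      ∃ (σk : ℝ → ℕ → ProbabilityMeasure X) (σ : ℝ → ProbabilityMeasure X),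
        (∀ r ∈ Ioo (0 : ℝ) 1,
          (∀ k, η (n k) < r →
            (σk r k : Measure X) = ENNReal.ofReal (r / η (n k)) •
              (Darning.swept 𝒱 H W₀ K (ν (n k)) r).restrict (Darning.S 𝒱 H W₀ K r)) ∧
          Tendsto (σk r) atTop (𝓝 (σ r)) ∧
          (σ r : Measure X) (Darning.S 𝒱 H W₀ K r)ᶜ = 0) ∧
        Darning.IsCompatible 𝒱 H W₀ K fun r => (σ r : Measure X)) ∧
    ∃ (𝒱₀ : Set (Set (Darning.Collapse K)))
      (H₀ : Set (Darning.Collapse K) → Kernel (Darning.Collapse K) (Darning.Collapse K)),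
      Darning.IsDarning 𝒱 H K 𝒱₀ H₀ := by
  exact ⟨fun _ hW _ hη hanti hη0 _ hν => hW.exists_subsequence hH hK.1 hη hanti hη0 hν,
    hK.exists_isDarning hH⟩
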